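/- Consider a static spherically symmetric self-gravitating Newtonian perfect fluid ball ($G=1$) with centre $0$ and radius $R>0$: density $\rho$ and pressure $p$ depend on $r=|x|$ only, are positive for $r<R$, vanish for $r>R$, $\rho$ is $C^1$ for $r<R$ and continuous up to the surface $r=R$ (where it may be zero or positive), $p$ is $C^1$ for $r<R$ and continuous with $p=0$ at $r=R$; $p=p(\rho)$ in the star for a function $p(\cdot)$ that is differentiable at the values $\rho(r)$, $0<r<R$; the radial potential $\Phi$ is $C^1$ on $\mathbb R^3$, $C^2$ off the surface, tends to $0$ at infinity, and satisfies $\frac1\rho\nabla p+\nabla\Phi=0$ in the star, $\nabla^2\Phi=4\pi\rho$ inside and $\nabla^2\Phi=0$ outside. Let $\Gamma(r)=\frac{\rho}{p}\frac{dp}{d\rho}$ for $0<r<R$, and let $\gamma:[0,R)\to(0,\infty)$ be continuous (the adiabatic index of the perturbations). The star is called isentropic if $\gamma(r)=\Gamma(r)$ for all $0<r<R$. A stationary perturbation is a time-independent $(\delta\rho,\delta p,\delta\Phi,\delta v)$, with $\delta\rho$ continuous and $\delta p$ $C^1$ in the open ball, $\delta v$ $C^1$ on the closed ball, $\delta\Phi$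 continuous on $\mathbb R^3$, $C^2$ off the surface and tending to $0$ at infinity, such that in the star $$\nabla_a(\rho\,\delta v^a)=0,\qquad \frac1\rho\nabla_a\delta p-\frac{\delta\rho}{\rho^2}\nabla_a p+\nabla_a\delta\Phi=0,\qquad \nabla^2\delta\Phi=4\pi\,\delta\rho,$$ $\nabla^2\delta\Phi=0$ outside, and such that for a Lagrangian displacement $\xi(t,x)$ with $\partial_t\xi=\delta v$, continuous in $x$ on the closed ball, and for all $t$: the Lagrangian pressure change $\delta p+\xi\cdot\nabla p$ tends to $0$ at the surface, and $\nabla\delta\Phi$ has limits at the surface from both sides, which differ (outside minus inside) by $4\pi\rho(R)\,\xi^r$ times the outer unit normal. It is a zero-frequency perturbation of the star (for $\gamma$) if moreover $\xi$ can be chosen so that, for all $t$, $\frac{\delta p}{\gamma p}=\frac{\delta\rho}{\rho}+\xi^r\left[\frac{\rho'}{\rho}-\frac{p'}{\gamma p}\right]$ in the star. It is non-radial if $\delta\rho,\delta p,\delta v^r$ (for $0<r<R$) and $\delta\Phi$ (for $r>0$) have zero mean on spheres of radius $r$ (no $l=0$ part). It is centred if $\delta\Phi=o(|x|^{-2})$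 at infinity (no dipole moment: the centre of mass is not displaced). For $l\ge1$, an r-mode (resp. g-mode) of degree $l$ is a vector field $\delta v$ on the closed ball such that $(0,0,0,\delta v)$ is a zero-frequency perturbation and $\delta v^a=U(r)\,\epsilon^{abc}\nabla_bY\nabla_cr$ (axial; resp. $\delta v^a=\frac{W(r)}{r}Y\nabla^ar+V(r)\nabla^aY$, polar) at every $x\ne0$, where $Y$ is a real spherical harmonic of degree $l$, i.e. a real linear combination of the spherical harmonics $Y_l^m$. Then: 1. For every stationary non-radial perturbation there is $c\in\mathbb R^3$ such that $\delta\rho=c\cdot\nabla\rho$, $\delta p=c\cdot\nabla p$ in the star and $\delta\Phi=c\cdot\nabla\Phi$ (an infinitesimal rigid translation of the star). If the perturbation is centred, then $\delta\rho=\delta p=0$ in the star and $\delta\Phi=0$. In all cases $\nabla_a(\rho\,\delta v^a)=0$. (Linearization stability is not assumed, so this holds in particular under it.) 2. For every $\gamma$ and every $l\ge1$ there is a nonzero r-mode of degree $l$; moreover every axial field of degree $l$ that is $C^1$ on the closed ball is an r-mode. 3. For every $l\ge1$: there is a g-mode of degree $l$ whose radial component does not vanish identically on any shell $a<r<b$,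 $0\le a<b\le R$, if and only if the star is isentropic. Also, all polar fields $\delta v$ of degree $l$ for which $(0,0,0,\delta v)$ is a stationary perturbation are g-modes if and only if the star is isentropic. 4. Suppose that the star is isentropic. Then for every finite linear combination $\delta v$ of r- and g-modes, $(0,0,0,\delta v)$ is a non-radial zero-frequency perturbation. Conversely, for every non-radial zero-frequency perturbation, $\delta\rho,\delta p,\delta\Phi$ are as in 1 (zero if it is centred), and $\delta v=\sum_{l\ge1}(a_l+b_l)$, where $a_l$ is a finite linear combination of r-modes and $b_l$ one of g-modes of degree $l$, and the series converges in $L^2$ on every sphere $|x|=r$, $0<r<R$. -/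

import Mathlib

open MeasureTheory Filter Topology Metric Set
open scoped Gradient Laplacian ContDiff

noncomputable section

namespace StellarModes

/-- Euclidean three-space, with the centre of the star at the origin. -/
abbrev E3 : Type := EuclideanSpace ℝ (Fin 3)

/-- The divergence of a vector field. -/
def divergence (v : E3 → E3) (x : E3) : ℝ :=
  ∑ i, (fderiv ℝ v x (EuclideanSpace.single i 1)) i

/-- The vector product, that is, the vector with components `ε^{abc} u_b w_c`. -/
def cross (u w : E3) : E3 :=
  WithLp.toLp 2 (crossProduct (WithLp.ofLp u) (WithLp.ofLp w))

/-- A static, spherically symmetric, self-gravitating perfect fluid ball of radius `R` with the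
one-parameter equation of state `p = eos ρ`, in Newtonian gravity with `G = 1`.
The density may vanish at the surface or have a positive limit there; in both cases the pressure
vanishes at the surface. -/
structure BarotropicStar where
  R : ℝ
  ρ : E3 → ℝ
  p : E3 → ℝ
  Φ : E3 → ℝ
  eos : ℝ → ℝ
  R_pos : 0 < R
  ρ_radial : ∀ x y, ‖x‖ = ‖y‖ → ρ x = ρ y
  p_radial : ∀ x y, ‖x‖ = ‖y‖ → p x = p y
  Φ_radial : ∀ x y, ‖x‖ = ‖y‖ → Φ x = Φ y
  ρ_cont : ContinuousOn ρ (closedBall 0 R)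
  ρ_smooth : ContDiffOn ℝ 1 ρ (ball 0 R)
  p_cont : Continuous p
  p_smooth : ContDiffOn ℝ 1 p (ball 0 R)
  Φ_C1 : ContDiff ℝ 1 Φ
  Φ_inner : ContDiffOn ℝ 2 Φ (ball 0 R)
  Φ_outer : ContDiffOn ℝ 2 Φ (closedBall 0 R)ᶜ
  ρ_pos : ∀ x ∈ ball (0 : E3) R, 0 < ρ x
  p_pos : ∀ x ∈ ball (0 : E3) R, 0 < p x
  ρ_outside : ∀ x ∉ closedBall (0 : E3) R, ρ x = 0
  p_outside : ∀ x ∉ ball (0 : E3) R, p x = 0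
  eos_eq : ∀ x ∈ ball (0 : E3) R, p x = eos (ρ x)
  eos_diff : ∀ x ∈ ball (0 : E3) R, x ≠ 0 → DifferentiableAt ℝ eos (ρ x)
  equilibrium : ∀ x ∈ ball (0 : E3) R, (1 / ρ x) • ∇ p x + ∇ Φ x = 0
  poisson_inner : ∀ x ∈ ball (0 : E3) R, Δ Φ x = 4 * Real.pi * ρ x
  poisson_outer : ∀ x ∈ (closedBall (0 : E3) R)ᶜ, Δ Φ x = 0
  Φ_infinity : Tendsto Φ (cocompact E3) (𝓝 0)

/-- The index `Γ = (ρ / p) dp/dρ` of the equilibrium equation of state. -/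
def BarotropicStar.Gam (S : BarotropicStar) (x : E3) : ℝ :=
  S.ρ x / S.p x * deriv S.eos (S.ρ x)

/-- The star is isentropic for the adiabatic index `γ = γ(r)` of its perturbations if `γ = Γ`. -/
def BarotropicStar.IsIsentropic (S : BarotropicStar) (γ : ℝ → ℝ) : Prop :=
  ∀ x ∈ ball (0 : E3) S.R, x ≠ 0 → γ ‖x‖ = S.Gam x

/-- A time-independent Eulerian perturbation `(δρ, δp, δΦ, δv)`. The fields `δρ`, `δp`, `δv` are
relevant on the star only. -/
structure Perturbation where
  dρ : E3 → ℝ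
  dp : E3 → ℝ
  dΦ : E3 → ℝ
  dv : E3 → E3

/-- The perturbation `(0, 0, 0, v)`: a stationary fluid current. -/
def current (v : E3 → E3) : Perturbation := ⟨fun _ => 0, fun _ => 0, fun _ => 0, v⟩

/-- `q` solves the linearized time-independent equations, is regular at the centre and at the
surface, and satisfies the boundary conditions at the surface and at infinity, where `ξ t` is the
Lagrangian displacement at time `t`, so that `∂ξ/∂t = δv`.

At the surface, the Lagrangian change of the pressure vanishes, and `∇δΦ` jumps by `4πσ` times the
outer normal, with `σ = ρ ξ^r` the surface density of the displaced layer (which is zero if the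
density vanishes at the surface). -/
structure IsStationary (S : BarotropicStar) (q : Perturbation) (ξ : ℝ → E3 → E3) : Prop where
  dρ_cont : ContinuousOn q.dρ (ball 0 S.R)
  dp_smooth : ContDiffOn ℝ 1 q.dp (ball 0 S.R)
  dΦ_cont : Continuous q.dΦ
  dΦ_inner : ContDiffOn ℝ 2 q.dΦ (ball 0 S.R)
  dΦ_outer : ContDiffOn ℝ 2 q.dΦ (closedBall 0 S.R)ᶜ
  dv_smooth : ContDiffOn ℝ 1 q.dv (closedBall 0 S.R)
  mass : ∀ x ∈ ball (0 : E3) S.R, divergence (fun z => S.ρ z • q.dv z) x = 0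
  euler : ∀ x ∈ ball (0 : E3) S.R,
    (1 / S.ρ x) • ∇ q.dp x - (q.dρ x / S.ρ x ^ 2) • ∇ S.p x + ∇ q.dΦ x = 0
  poisson_inner : ∀ x ∈ ball (0 : E3) S.R, Δ q.dΦ x = 4 * Real.pi * q.dρ x
  poisson_outer : ∀ x ∈ (closedBall (0 : E3) S.R)ᶜ, Δ q.dΦ x = 0
  dΦ_infinity : Tendsto q.dΦ (cocompact E3) (𝓝 0)
  ξ_cont : ∀ t, ContinuousOn (ξ t) (closedBall 0 S.R)
  ξ_velocity : ∀ t, ∀ x ∈ closedBall (0 : E3) S.R, HasDerivAt (fun s => ξ s x) (q.dv x) t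
  surface_pressure : ∀ t, ∀ y ∈ sphere (0 : E3) S.R,
    Tendsto (fun x => q.dp x + inner ℝ (ξ t x) (∇ S.p x)) (𝓝[ball 0 S.R] y) (𝓝 0)
  surface_gravity : ∀ t, ∀ y ∈ sphere (0 : E3) S.R, ∃ g_in g_out : E3,
    Tendsto (fun x => ∇ q.dΦ x) (𝓝[ball 0 S.R] y) (𝓝 g_in) ∧
    Tendsto (fun x => ∇ q.dΦ x) (𝓝[(closedBall 0 S.R)ᶜ] y) (𝓝 g_out) ∧
    g_out - g_in
      = (4 * Real.pi * S.ρ y * inner ℝ (ξ t y) (‖y‖⁻¹ • y)) • (‖y‖⁻¹ • y)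

/-- The adiabatic relation
`δp / (γ p) = δρ / ρ + ξ^r (ρ' / ρ - p' / (γ p))` at all times. As the star is spherical,
`ξ^r ρ' = ξ · ∇ρ` and `ξ^r p' = ξ · ∇p`. -/
def IsAdiabatic (S : BarotropicStar) (γ : ℝ → ℝ) (q : Perturbation) (ξ : ℝ → E3 → E3) : Prop :=
  ∀ t, ∀ x ∈ ball (0 : E3) S.R,
    q.dp x / (γ ‖x‖ * S.p x) = q.dρ x / S.ρ x
      + (inner ℝ (ξ t x) (∇ S.ρ x) / S.ρ x - inner ℝ (ξ t x) (∇ S.p x) / (γ ‖x‖ * S.p x))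

/-- Membership in the zero-frequency subspace of the star whose perturbations have adiabatic
index `γ`. -/
def IsZeroFrequency (S : BarotropicStar) (γ : ℝ → ℝ) (q : Perturbation) : Prop :=
  ∃ ξ : ℝ → E3 → E3, IsStationary S q ξ ∧ IsAdiabatic S γ q ξ

/-- The integral of `f` over the unit sphere of directions at radius `r`. -/
def sphereIntegral (f : E3 → ℝ) (r : ℝ) : ℝ :=
  ∫ n : sphere (0 : E3) 1, f (r • (n : E3)) ∂((volume : Measure E3).toSphere)

/-- A non-radial perturbation: its part with `l = 0` vanishes. -/
structure IsNonRadial (S : BarotropicStar) (q : Perturbation) : Prop where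
  dρ_mean : ∀ r ∈ Ioo 0 S.R, sphereIntegral q.dρ r = 0
  dp_mean : ∀ r ∈ Ioo 0 S.R, sphereIntegral q.dp r = 0
  dΦ_mean : ∀ r ∈ Ioi (0 : ℝ), sphereIntegral q.dΦ r = 0
  dv_mean : ∀ r ∈ Ioo 0 S.R, sphereIntegral (fun x => inner ℝ (q.dv x) (‖x‖⁻¹ • x)) r = 0

/-- `δρ`, `δp` and `δΦ` are those of the star rigidly displaced by `-c`. -/
structure IsTranslation (S : BarotropicStar) (c : E3) (q : Perturbation) : Prop where
  dρ_eq : ∀ x ∈ ball (0 : E3) S.R, q.dρ x = inner ℝ c (∇ S.ρ x)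
  dp_eq : ∀ x ∈ ball (0 : E3) S.R, q.dp x = inner ℝ c (∇ S.p x)
  dΦ_eq : ∀ x, q.dΦ x = inner ℝ c (∇ S.Φ x)

/-- The perturbation does not displace the centre of mass: the gravitational potential of a
non-radial perturbation has no dipole term at infinity. -/
def IsCentred (q : Perturbation) : Prop :=
  Tendsto (fun x => ‖x‖ ^ 2 * q.dΦ x) (cocompact E3) (𝓝 0)

/-- `δρ = δp = 0` in the star and `δΦ = 0` everywhere. -/
def ScalarsVanish (S : BarotropicStar) (q : Perturbation) : Prop :=
  (∀ x ∈ ball (0 : E3) S.R, q.dρ x = 0) ∧ (∀ x ∈ ball (0 : E3) S.R, q.dp x = 0) ∧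
    ∀ x, q.dΦ x = 0

/-- Solid harmonics of degree `l`: the harmonic homogeneous polynomials of degree `l` (a smooth
function on the whole space that is homogeneous of degree `l` is a polynomial). Their restrictions
to the unit sphere are the real linear combinations of the spherical harmonics of degree `l`. -/
structure IsSolidHarmonic (l : ℕ) (H : E3 → ℝ) : Prop where
  smooth : ContDiff ℝ ∞ H
  harmonic : ∀ x, Δ H x = 0
  homogeneous : ∀ (c : ℝ) (x : E3), H (c • x) = c ^ l * H x

/-- The spherical harmonic of a solid harmonic, as a function of the direction of `x`. -/
def angular (H : E3 → ℝ) (x : E3) : ℝ := H (‖x‖⁻¹ • x)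

/-- Axial parity, degree `l`: `v = U(r) ∇Y × ∇r`, where `∇r = x / r`. -/
def IsAxial (R : ℝ) (l : ℕ) (v : E3 → E3) : Prop :=
  ∃ (H : E3 → ℝ) (U : ℝ → ℝ), IsSolidHarmonic l H ∧
    ∀ x ∈ closedBall (0 : E3) R, x ≠ 0 →
      v x = U ‖x‖ • cross (∇ (angular H) x) (‖x‖⁻¹ • x)

/-- Polar parity, degree `l`: `v = (W(r) / r) Y ∇r + V(r) ∇Y`. -/
def IsPolar (R : ℝ) (l : ℕ) (v : E3 → E3) : Prop :=
  ∃ (H : E3 → ℝ) (W V : ℝ → ℝ), IsSolidHarmonic l H ∧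
    ∀ x ∈ closedBall (0 : E3) R, x ≠ 0 →
      v x = (W ‖x‖ / ‖x‖ * angular H x) • (‖x‖⁻¹ • x) + V ‖x‖ • ∇ (angular H) x

/-- Zero-frequency r-modes: stationary currents with axial parity. -/
def IsRMode (S : BarotropicStar) (γ : ℝ → ℝ) (l : ℕ) (v : E3 → E3) : Prop :=
  1 ≤ l ∧ IsAxial S.R l v ∧ IsZeroFrequency S γ (current v)

/-- Zero-frequency g-modes: stationary currents with polar parity. -/
def IsGMode (S : BarotropicStar) (γ : ℝ → ℝ) (l : ℕ) (v : E3 → E3) : Prop :=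
  1 ≤ l ∧ IsPolar S.R l v ∧ IsZeroFrequency S γ (current v)

/-- The radial component of `v` does not vanish identically on any shell inside the star. -/
def RadialNonvanishing (R : ℝ) (v : E3 → E3) : Prop :=
  ∀ a b : ℝ, 0 ≤ a → a < b → b ≤ R → ∃ x : E3, a < ‖x‖ ∧ ‖x‖ < b ∧ inner ℝ (v x) x ≠ 0

/-- `v` is the sum of the series `∑_{l ≥ 1} w l`, in the mean square on every sphere inside the
star. -/
def IsSumOnSpheres (R : ℝ) (w : ℕ → E3 → E3) (v : E3 → E3) : Prop :=
  ∀ r ∈ Ioo 0 R,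
    Tendsto (fun N : ℕ => ∫⁻ n : sphere (0 : E3) 1,
        ‖v (r • (n : E3)) - ∑ l ∈ Finset.Icc 1 N, w l (r • (n : E3))‖ₑ ^ 2
          ∂((volume : Measure E3).toSphere))
      atTop (𝓝 0)

end StellarModes

end

open scoped RealInnerProductSpace

noncomputable section

namespace StellarModes

/-! Scalar part: a uniqueness argument. Multiply the perturbed Euler equation by ρ and use
hydrostatic equilibrium: ∇(δp + ρ δΦ) = δΦ ∇ρ - δρ ∇Φ. The right side is radial, so δp + ρ δΦ is
constant on spheres, and having no mean it vanishes (`IsStationary.dp_eq_neg`). Hence δρ g = ρ' δΦ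
with g = Φ', and the perturbed Poisson equation closes on δΦ. The projection f of δΦ on a harmonic
of degree l ≥ 1 obeys a linear radial equation that g itself solves for l = 1, since a translated
star is again a solution. Put w = r² g² (f/g)'. Then w f/g has the derivative (l(l+1) - 2) f² +
w²/(r² g²) ≥ 0, it tends to 0 at the centre, and its inner limit at the surface is (1 - l) R f(R)² ≤
0, by decay outside and the jump of ∇δΦ. So it vanishes identically, which gives f = c g, with c = 0
for l ≥ 2 (`radial_rigidity`). Completeness of the harmonics assembles the projections into δΦ = c ·
∇Φ, and the dipole term at infinity detects c.

Velocity part: δv is constant in time, so ξ is affine in time, and comparing two times isolates the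
conditions on v = δv. They are div(ρ v) = 0, ρ v^r = 0 at the surface (`IsCurrent`) and, for a
current to have zero frequency, v^r (ρ'/ρ - p'/(γ p)) = 0 (`isZeroFrequency_current_iff`). Axial
fields are tangential and free of divergence, hence r-modes for every γ. The bracket vanishes when γ
= Γ; conversely a g-mode whose radial part is nonzero somewhere in every shell forces it to vanish,
by continuity. One explicit polar current, built from bump functions
(`BarotropicStar.exists_polar_current`), is the witness for both equivalences about g-modes.

Expansion: in an isentropic star the projections of a current on vector spherical harmonics are
modes (`IsCurrent.exists_modes`). Convergence is density of these harmonics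
(`exists_vectorSpan_approx`), reduced to scalar Stone–Weierstrass density by decomposing the fields
H e with e constant. The delicate point is that each projection of a C¹ field is C¹ at the centre
(`hasRegularModes_of_contDiffOn`): the affine Taylor part is treated explicitly, and the remainder
has amplitudes that vanish to first order.

All integrations by parts on spheres come from the invariance of the surface measure under
rotations, so no charts are needed. -/

/-- The surface measure of the unit sphere. -/
abbrev sphereMeasure : Measure (sphere (0 : E3) 1) := (volume : Measure E3).toSphere

/-! ### Shells, coordinates and spherical means -/

/-- The set of points whose distance from the origin lies in `I`. -/
def shell (I : Set ℝ) : Set E3 := {x | ‖x‖ ∈ I}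

/-- The `i`-th unit vector. -/
abbrev unitVec (i : Fin 3) : E3 := EuclideanSpace.single i (1 : ℝ)

lemma inner_E3 (x y : E3) : ⟪x, y⟫ = x 0 * y 0 + x 1 * y 1 + x 2 * y 2 := by
  simp [PiLp.inner_apply, Fin.sum_univ_three, mul_comm]

lemma normSq_E3 (x : E3) : ‖x‖ ^ 2 = x 0 ^ 2 + x 1 ^ 2 + x 2 ^ 2 := by
  rw [← real_inner_self_eq_norm_sq, inner_E3]; ring

lemma norm_sphere (n : sphere (0 : E3) 1) : ‖(n : E3)‖ = 1 := by simp

lemma norm_smul_sphere {r : ℝ} (hr : 0 ≤ r) (n : sphere (0 : E3) 1) : ‖r • (n : E3)‖ = r := by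
  rw [norm_smul, norm_sphere, Real.norm_of_nonneg hr, mul_one]

lemma isOpen_shell {I : Set ℝ} (hI : IsOpen I) : IsOpen (shell I) := hI.preimage continuous_norm

lemma smul_mem_shell {I : Set ℝ} (hI0 : I ⊆ Ioi 0) {r : ℝ} (hr : r ∈ I) (n : sphere (0 : E3) 1) :
    r • (n : E3) ∈ shell I := by
  simpa [shell, norm_smul_sphere (le_of_lt (hI0 hr))] using hr

lemma unit_smul_sphere {r : ℝ} (hr : 0 < r) (n : sphere (0 : E3) 1) :
    ‖r • (n : E3)‖⁻¹ • r • (n : E3) = n := by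
  rw [norm_smul_sphere hr.le, smul_smul, inv_mul_cancel₀ hr.ne', one_smul]

lemma sphere_rotation_map (A : E3 ≃ₗᵢ[ℝ] E3) (n : sphere (0 : E3) 1) : A n ∈ sphere (0 : E3) 1 := by
  simp

open scoped Pointwise in
/-- The surface measure of the sphere is invariant under linear isometries. -/
lemma integral_sphere_isometry (A : E3 ≃ₗᵢ[ℝ] E3) (f : E3 → ℝ) :
    ∫ n : sphere (0 : E3) 1, f (A n) ∂sphereMeasure = ∫ n : sphere (0 : E3) 1, f n ∂sphereMeasure := by
  let T : sphere (0 : E3) 1 ≃ₜ sphere (0 : E3) 1 :=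
    { toFun := fun n => ⟨A n, sphere_rotation_map A n⟩
      invFun := fun n => ⟨A.symm n, sphere_rotation_map A.symm n⟩
      left_inv := fun n => by ext1; simp
      right_inv := fun n => by ext1; simp
      continuous_toFun := by fun_prop
      continuous_invFun := by fun_prop }
  have hT : MeasurePreserving T sphereMeasure sphereMeasure := by
    refine ⟨T.continuous.measurable, ?_⟩
    ext s hs
    rw [Measure.map_apply T.continuous.measurable hs, Measure.toSphere_apply' _ hs,
      Measure.toSphere_apply' _ (T.continuous.measurable hs)]
    -- The surface measure of a set is, up to a factor, the volume of the cone over it; a linear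
    -- isometry maps cones to cones and preserves volume.
    have hset : Ioo (0 : ℝ) 1 • (Subtype.val '' (T ⁻¹' s)) = A ⁻¹' (Ioo (0 : ℝ) 1 • (Subtype.val '' s)) := by
      ext x
      simp only [Set.mem_smul, mem_preimage, mem_image]
      constructor
      · rintro ⟨c, hc, -, ⟨n, hn, rfl⟩, rfl⟩
        exact ⟨c, hc, A n, ⟨T n, hn, rfl⟩, by simp⟩
      · rintro ⟨c, hc, -, ⟨n, hn, rfl⟩, h⟩
        refine ⟨c, hc, A.symm n, ⟨T.symm n, by simpa using hn, rfl⟩, ?_⟩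
        apply A.injective
        simpa using h
    rw [hset]
    congr 1
    exact A.measurePreserving.measure_preimage_equiv (f := A.toMeasurableEquiv) _
  exact hT.integral_comp T.measurableEmbedding (fun n => f n)

/-- Differentiation under the integral: a closed ball of parameters times the sphere is compact, so
continuity of the derivative already gives a constant dominating function. -/
lemma hasDerivAt_integral_sphere {G G' : ℝ → sphere (0 : E3) 1 → ℝ} {t₀ : ℝ} {V : Set ℝ}
    (hV : V ∈ 𝓝 t₀) (hG : ∀ t ∈ V, ∀ n, HasDerivAt (fun s => G s n) (G' t n) t)
    (hGc : ∀ t ∈ V, Continuous (G t)) (hG'c : ContinuousOn (fun q : ℝ × _ => G' q.1 q.2) (V ×ˢ univ)) :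
    HasDerivAt (fun t => ∫ n, G t n ∂sphereMeasure) (∫ n, G' t₀ n ∂sphereMeasure) t₀ := by
  obtain ⟨ε, hε, hεV⟩ := Metric.nhds_basis_closedBall.mem_iff.1 hV
  have hK : IsCompact (closedBall t₀ ε ×ˢ (univ : Set (sphere (0 : E3) 1))) :=
    (isCompact_closedBall _ _).prod isCompact_univ
  obtain ⟨C, hC⟩ := hK.exists_bound_of_continuousOn
    (hG'c.mono (prod_mono hεV (subset_refl _)))
  have ht₀ : t₀ ∈ V := mem_of_mem_nhds hV
  have hc : Continuous (G' t₀) :=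
    continuousOn_univ.1 (hG'c.comp (by fun_prop : Continuous fun n => (t₀, n)).continuousOn
      (fun n _ => ⟨ht₀, mem_univ _⟩))
  refine (hasDerivAt_integral_of_dominated_loc_of_deriv_le (bound := fun _ => C)
    (closedBall_mem_nhds t₀ hε) ?_ ?_ ?_ ?_ ?_ ?_).2
  · filter_upwards [hV] with t ht using (hGc t ht).aestronglyMeasurable
  · exact (hGc t₀ ht₀).integrable_of_hasCompactSupport (HasCompactSupport.of_compactSpace _)
  · exact hc.aestronglyMeasurable
  · exact Eventually.of_forall fun n t ht => hC (t, n) ⟨ht, mem_univ _⟩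
  · exact integrable_const _
  · exact Eventually.of_forall fun n t ht => hG t (hεV ht) n

lemma continuous_sphere_integrable {f : sphere (0 : E3) 1 → ℝ} (hf : Continuous f) :
    Integrable f sphereMeasure :=
  hf.integrable_of_hasCompactSupport (HasCompactSupport.of_compactSpace _)

lemma continuous_on_sphere {F : Type*} [TopologicalSpace F] {f : E3 → F} {s : Set E3}
    (hf : ContinuousOn f s) {r : ℝ} (h : ∀ n : sphere (0 : E3) 1, r • (n : E3) ∈ s) :
    Continuous fun n : sphere (0 : E3) 1 => f (r • (n : E3)) :=
  continuousOn_univ.1 (hf.comp (by fun_prop : Continuous fun n : sphere (0 : E3) 1 =>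
    r • (n : E3)).continuousOn (fun n _ => h n))

lemma sphereIntegral_continuousOn {I : Set ℝ} [LocallyCompactSpace I] {f : E3 → ℝ} {s : Set E3}
    (hf : ContinuousOn f s) (hs : ∀ r ∈ I, ∀ n : sphere (0 : E3) 1, r • (n : E3) ∈ s) :
    ContinuousOn (sphereIntegral f) I := by
  rw [continuousOn_iff_continuous_domRestrict]
  have : Continuous fun q : I × sphere (0 : E3) 1 => f ((q.1 : ℝ) • (q.2 : E3)) :=
    continuousOn_univ.1 (hf.comp (by fun_prop : Continuous fun q : I × sphere (0 : E3) 1 =>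
      (q.1 : ℝ) • (q.2 : E3)).continuousOn (fun q _ => hs q.1 q.1.2 q.2))
  have h := continuous_parametric_integral_of_continuous (μ := sphereMeasure)
    (f := fun (r : I) (n : sphere (0 : E3) 1) => f ((r : ℝ) • (n : E3))) this isCompact_univ
  simpa [Set.domRestrict_def, sphereIntegral] using h

lemma contDiffOn_fderiv_continuousOn {F : Type*} [NormedAddCommGroup F] [NormedSpace ℝ F]
    {f : E3 → F} {U : Set E3} (hU : IsOpen U) (hf : ContDiffOn ℝ 1 f U) :
    ContinuousOn (fderiv ℝ f) U := hf.continuousOn_fderiv_of_isOpen hU le_rfl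

lemma sphereIntegral_hasDerivAt {I : Set ℝ} (hI : IsOpen I) (hI0 : I ⊆ Ioi 0) {f : E3 → ℝ}
    (hf : ContDiffOn ℝ 1 f (shell I)) {r : ℝ} (hr : r ∈ I) :
    HasDerivAt (sphereIntegral f)
      (sphereIntegral (fun x => fderiv ℝ f x (‖x‖⁻¹ • x)) r) r := by
  have hU := isOpen_shell hI
  have h1 := contDiffOn_fderiv_continuousOn hU hf
  have key := hasDerivAt_integral_sphere (G := fun t n => f (t • (n : E3)))
    (G' := fun t n => fderiv ℝ f (t • (n : E3)) n) (hI.mem_nhds hr) ?_ ?_ ?_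
  · have he : sphereIntegral (fun x => fderiv ℝ f x (‖x‖⁻¹ • x)) r
        = ∫ n : sphere (0 : E3) 1, fderiv ℝ f (r • (n : E3)) n ∂sphereMeasure := by
      simp only [sphereIntegral, unit_smul_sphere (hI0 hr)]
    rw [he]
    exact key
  · intro t ht n
    have hd : HasFDerivAt f (fderiv ℝ f (t • (n : E3))) (t • (n : E3)) :=
      ((hf.differentiableOn one_ne_zero).differentiableAt
        (hU.mem_nhds (smul_mem_shell hI0 ht n))).hasFDerivAt
    have h2 : HasDerivAt (fun s : ℝ => s • (n : E3)) (n : E3) t := by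
      simpa using (hasDerivAt_id t).smul_const (n : E3)
    exact hd.comp_hasDerivAt t h2
  · exact fun t ht => continuous_on_sphere hf.continuousOn (smul_mem_shell hI0 ht)
  · refine ContinuousOn.clm_apply (h1.comp (by fun_prop) ?_) (by fun_prop)
    exact fun q hq => smul_mem_shell hI0 hq.1 q.2

/-- Rotation by the angle `t` in the plane of the `i`-th and `j`-th axes. -/
def planeRotation (i j : Fin 3) (t : ℝ) : E3 →ₗ[ℝ] E3 where
  toFun x := x + ((Real.cos t - 1) * x i - Real.sin t * x j) • unitVec i
    + (Real.sin t * x i + (Real.cos t - 1) * x j) • unitVec j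
  map_add' x y := by
    simp only [PiLp.add_apply]; module
  map_smul' c x := by
    simp only [PiLp.smul_apply, smul_eq_mul, RingHom.id_apply]; module

lemma planeRotation_norm {i j : Fin 3} (hij : i ≠ j) (t : ℝ) (x : E3) :
    ‖planeRotation i j t x‖ = ‖x‖ := by
  have h : Real.sin t ^ 2 = 1 - Real.cos t ^ 2 := by linarith [Real.sin_sq_add_cos_sq t]
  rw [← sq_eq_sq₀ (norm_nonneg _) (norm_nonneg _), normSq_E3, normSq_E3]
  fin_cases i <;> fin_cases j <;> simp [planeRotation] at hij ⊢ <;> ring_nf <;> rw [h] <;> ring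

/-- `planeRotation` as a linear isometric equivalence. -/
def planeRotationEquiv {i j : Fin 3} (hij : i ≠ j) (t : ℝ) : E3 ≃ₗᵢ[ℝ] E3 :=
  LinearIsometry.toLinearIsometryEquiv ⟨planeRotation i j t, planeRotation_norm hij t⟩ rfl

/-- The integral of the derivative along an infinitesimal rotation vanishes. -/
lemma sphereIntegral_rotation {I : Set ℝ} (hI : IsOpen I) (hI0 : I ⊆ Ioi 0) {f : E3 → ℝ}
    (hf : ContDiffOn ℝ 1 f (shell I)) {r : ℝ} (hr : r ∈ I) {i j : Fin 3} (hij : i ≠ j) :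
    sphereIntegral (fun x => fderiv ℝ f x (x i • unitVec j - x j • unitVec i)) r = 0 := by
  have hU := isOpen_shell hI
  have h1 := contDiffOn_fderiv_continuousOn hU hf
  obtain ⟨A, hA⟩ : ∃ A : ℝ → E3 ≃ₗᵢ[ℝ] E3, ∀ t x, A t x = x
    + ((Real.cos t - 1) * x i - Real.sin t * x j) • unitVec i
    + (Real.sin t * x i + (Real.cos t - 1) * x j) • unitVec j := ⟨planeRotationEquiv hij, fun _ _ => rfl⟩
  have hmem : ∀ t (n : sphere (0 : E3) 1), r • A t n ∈ shell I := fun t n =>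
    smul_mem_shell hI0 hr ⟨A t n, sphere_rotation_map (A t) n⟩
  have hAc : Continuous fun q : ℝ × sphere (0 : E3) 1 => A q.1 (q.2 : E3) := by
    simp only [hA]
    fun_prop
  let A' : ℝ → E3 → E3 := fun t x => (-Real.sin t * x i - Real.cos t * x j) • unitVec i
    + (Real.cos t * x i - Real.sin t * x j) • unitVec j
  have hA' : ∀ t x, HasDerivAt (fun s => A s x) (A' t x) t := by
    intro t x
    simp only [hA]
    have e1 : HasDerivAt (fun s => (Real.cos s - 1) * x i - Real.sin s * x j)
        (-Real.sin t * x i - Real.cos t * x j) t :=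
      (((Real.hasDerivAt_cos t).sub_const 1).mul_const (x i)).sub
        ((Real.hasDerivAt_sin t).mul_const (x j))
    have e2 : HasDerivAt (fun s => Real.sin s * x i + (Real.cos s - 1) * x j)
        (Real.cos t * x i + -Real.sin t * x j) t :=
      ((Real.hasDerivAt_sin t).mul_const (x i)).add
        (((Real.hasDerivAt_cos t).sub_const 1).mul_const (x j))
    have := ((e1.smul_const (unitVec i)).const_add x).add (e2.smul_const (unitVec j))
    refine this.congr_deriv ?_
    simp only [A']
    module
  have key := hasDerivAt_integral_sphere (t₀ := 0) (V := univ) (G := fun t n => f (r • A t n))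
    (G' := fun t n => fderiv ℝ f (r • A t n) (r • A' t n)) univ_mem ?_ ?_ ?_
  -- By invariance of the surface measure the mean of f over the rotated sphere does not depend on
  -- the angle, so its derivative at angle 0 vanishes.
  · have h0 : (fun t => ∫ n : sphere (0 : E3) 1, f (r • A t n) ∂sphereMeasure)
        = fun _ => ∫ n : sphere (0 : E3) 1, f (r • (n : E3)) ∂sphereMeasure := by
      ext t
      exact integral_sphere_isometry (A t) (fun x => f (r • x))
    rw [h0] at key
    have h2 := key.unique (hasDerivAt_const 0 _)
    rw [← h2]
    unfold sphereIntegral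
    congr 1
    ext n
    have e1 : A 0 n = n := by simp [hA]
    have e2 : r • A' 0 n = (r • (n : E3)) i • unitVec j - (r • (n : E3)) j • unitVec i := by
      simp only [A', Real.sin_zero, Real.cos_zero, PiLp.smul_apply, smul_eq_mul]
      module
    rw [e1, e2]
  · intro t _ n
    have hd : HasFDerivAt f (fderiv ℝ f (r • A t n)) (r • A t n) :=
      ((hf.differentiableOn one_ne_zero).differentiableAt
        (hU.mem_nhds (hmem t n))).hasFDerivAt
    exact hd.comp_hasDerivAt t ((hA' t n).const_smul r)
  · intro t _
    refine continuousOn_univ.1 (hf.continuousOn.comp (Continuous.continuousOn ?_) fun n _ => hmem t n)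
    exact (hAc.comp (by fun_prop : Continuous fun n : sphere (0 : E3) 1 => (t, n))).const_smul r
  · refine ContinuousOn.clm_apply (h1.comp (hAc.const_smul r).continuousOn fun q _ => hmem q.1 q.2) ?_
    simp only [A']
    fun_prop

/-! ### Divergence, gradient and Laplacian in coordinates -/

lemma fderiv_coord {v : E3 → E3} {x : E3} (hv : DifferentiableAt ℝ v x) (i : Fin 3) (y : E3) :
    fderiv ℝ (fun z => v z i) x y = (fderiv ℝ v x y) i := by
  have h := ((EuclideanSpace.proj i : E3 →L[ℝ] ℝ).hasFDerivAt (x := v x)).comp x hv.hasFDerivAt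
  have h2 : HasFDerivAt (fun z => v z i) ((EuclideanSpace.proj i : E3 →L[ℝ] ℝ).comp (fderiv ℝ v x)) x := h
  rw [h2.fderiv]; rfl

lemma divergence_eq_coord {v : E3 → E3} {x : E3} (hv : DifferentiableAt ℝ v x) :
    divergence v x = fderiv ℝ (fun z => v z 0) x (unitVec 0) + fderiv ℝ (fun z => v z 1) x (unitVec 1)
      + fderiv ℝ (fun z => v z 2) x (unitVec 2) := by
  simp only [divergence, Fin.sum_univ_three, fderiv_coord hv]

lemma divergence_congr {u v : E3 → E3} {x : E3} (h : u =ᶠ[𝓝 x] v) :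
    divergence u x = divergence v x := by
  simp only [divergence, h.fderiv_eq]

lemma inner_grad (f : E3 → ℝ) (x y : E3) : ⟪∇ f x, y⟫ = fderiv ℝ f x y :=
  inner_gradient_left

lemma inner_unitVec (v : E3) (i : Fin 3) : ⟪v, unitVec i⟫ = v i := by
  rw [EuclideanSpace.inner_single_right]; simp

lemma gradient_coord (f : E3 → ℝ) (x : E3) (i : Fin 3) : (∇ f x) i = fderiv ℝ f x (unitVec i) := by
  rw [← inner_grad, EuclideanSpace.inner_single_right]
  simp

lemma coord_sum (v : E3) : v = v 0 • unitVec 0 + v 1 • unitVec 1 + v 2 • unitVec 2 := by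
  ext i; fin_cases i <;> simp

lemma divergence_smul {f : E3 → ℝ} {u : E3 → E3} {x : E3} (hf : DifferentiableAt ℝ f x)
    (hu : DifferentiableAt ℝ u x) :
    divergence (fun z => f z • u z) x = f x * divergence u x + ⟪∇ f x, u x⟫ := by
  rw [inner_grad]
  conv_rhs => rw [coord_sum (u x)]
  simp only [divergence, fderiv_fun_smul hf hu, Fin.sum_univ_three, map_add, map_smul]
  simp
  ring

lemma divergence_add {u v : E3 → E3} {x : E3} (hu : DifferentiableAt ℝ u x)
    (hv : DifferentiableAt ℝ v x) :
    divergence (fun z => u z + v z) x = divergence u x + divergence v x := by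
  simp [divergence, fderiv_fun_add hu hv, Finset.sum_add_distrib]

lemma divergence_const_smul (c : ℝ) {u : E3 → E3} {x : E3} (hu : DifferentiableAt ℝ u x) :
    divergence (fun z => c • u z) x = c * divergence u x := by
  simp [divergence, fderiv_fun_const_smul hu, Finset.mul_sum]

lemma divergence_id (x : E3) : divergence (fun z => z) x = 3 := by
  simp [divergence]

lemma divergence_zero (x : E3) : divergence (fun _ => 0) x = 0 := by
  simp [divergence]

lemma gradient_contDiffOn {n m : WithTop ℕ∞} {f : E3 → ℝ} {U : Set E3} (hU : IsOpen U)
    (hf : ContDiffOn ℝ n f U) (hmn : m + 1 ≤ n) : ContDiffOn ℝ m (∇ f) U := by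
  have h := hf.fderiv_of_isOpen hU hmn
  exact ((InnerProductSpace.toDual ℝ E3).symm.toContinuousLinearEquiv.contDiff).comp_contDiffOn h

lemma gradient_contDiff {f : E3 → ℝ} (hf : ContDiff ℝ ∞ f) : ContDiff ℝ ∞ (∇ f) :=
  contDiffOn_univ.1 (gradient_contDiffOn isOpen_univ hf.contDiffOn (by simp))

lemma gradient_differentiableAt {f : E3 → ℝ} {x : E3} (hf : ContDiffAt ℝ 2 f x) :
    DifferentiableAt ℝ (∇ f) x :=
  (((InnerProductSpace.toDual ℝ E3).symm.toContinuousLinearEquiv.contDiff).comp_contDiffAt x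
    (hf.fderiv_right (m := 1) (by norm_num))).differentiableAt one_ne_zero

lemma inner_fderiv_gradient {f : E3 → ℝ} {x : E3} (hf : ContDiffAt ℝ 2 f x) (a b : E3) :
    ⟪fderiv ℝ (∇ f) x a, b⟫ = fderiv ℝ (fderiv ℝ f) x a b := by
  have h1 : DifferentiableAt ℝ (fderiv ℝ f) x :=
    (hf.fderiv_right (m := 1) (by norm_num)).differentiableAt one_ne_zero
  have e : (fun z => ⟪∇ f z, b⟫) = fun z => fderiv ℝ f z b := by
    ext z; exact inner_grad f z b
  have h2 := fderiv_inner_apply ℝ (gradient_differentiableAt hf) (differentiableAt_const (c := b)) a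
  rw [e, fderiv_clm_apply h1 (differentiableAt_const _)] at h2
  simpa using h2.symm

lemma laplacian_eq_divergence {f : E3 → ℝ} {x : E3} (hf : ContDiffAt ℝ 2 f x) :
    Δ f x = divergence (∇ f) x := by
  rw [InnerProductSpace.laplacian_eq_iteratedFDeriv_orthonormalBasis f
    (EuclideanSpace.basisFun (Fin 3) ℝ), divergence]
  refine Finset.sum_congr rfl fun i _ => ?_
  rw [iteratedFDeriv_two_apply]
  have h := inner_fderiv_gradient hf (unitVec i) (unitVec i)
  rw [EuclideanSpace.inner_single_right] at h
  simpa using h.symm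

/-! ### The vector product and curl-type fields -/

lemma cross_zero (u w : E3) : cross u w 0 = u 1 * w 2 - u 2 * w 1 := by
  simp [cross, cross_apply]
lemma cross_one (u w : E3) : cross u w 1 = u 2 * w 0 - u 0 * w 2 := by
  simp [cross, cross_apply]
lemma cross_two (u w : E3) : cross u w 2 = u 0 * w 1 - u 1 * w 0 := by
  simp [cross, cross_apply]

lemma contDiffOn_cross {n : WithTop ℕ∞} {u w : E3 → E3} {s : Set E3} (hu : ContDiffOn ℝ n u s)
    (hw : ContDiffOn ℝ n w s) : ContDiffOn ℝ n (fun z => cross (u z) (w z)) s := by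
  rw [contDiffOn_euclidean] at *
  intro i
  fin_cases i
  · simp only [Fin.zero_eta, cross_zero]; exact ((hu 1).mul (hw 2)).sub ((hu 2).mul (hw 1))
  · simp only [Fin.mk_one, cross_one]; exact ((hu 2).mul (hw 0)).sub ((hu 0).mul (hw 2))
  · simp only [Fin.reduceFinMk, cross_two]; exact ((hu 0).mul (hw 1)).sub ((hu 1).mul (hw 0))

lemma cross_smul_left (c : ℝ) (u w : E3) : cross (c • u) w = c • cross u w := by
  simp [cross]
lemma cross_smul_right (c : ℝ) (u w : E3) : cross u (c • w) = c • cross u w := by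
  simp [cross]
lemma cross_add_left (u v w : E3) : cross (u + v) w = cross u w + cross v w := by
  simp [cross]
lemma cross_sub_left (u v w : E3) : cross (u - v) w = cross u w - cross v w := by
  simp [cross]
lemma cross_self' (u : E3) : cross u u = 0 := by
  simp [cross]
lemma cross_zero_left (u : E3) : cross 0 u = 0 := by
  simp [cross]
lemma inner_cross_self_right (u w : E3) : ⟪cross u w, w⟫ = 0 := by
  rw [inner_E3, cross_zero, cross_one, cross_two]; ring
lemma inner_cross_cross (u v w : E3) : ⟪cross u w, cross v w⟫ = ⟪u, v⟫ * ‖w‖ ^ 2 - ⟪u, w⟫ * ⟪v, w⟫ := by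
  simp only [inner_E3, normSq_E3, cross_zero, cross_one, cross_two]; ring

lemma gradient_comp_symm {f : E3 → ℝ} {x : E3} (hf : ContDiffAt ℝ 2 f x) (a b : E3) :
    ⟪fderiv ℝ (∇ f) x a, b⟫ = ⟪fderiv ℝ (∇ f) x b, a⟫ := by
  have hs : IsSymmSndFDerivAt ℝ f x := hf.isSymmSndFDerivAt (by simp)
  rw [inner_fderiv_gradient hf, inner_fderiv_gradient hf, hs.eq]

lemma differentiableAt_cross {u w : E3 → E3} {x : E3} (hu : DifferentiableAt ℝ u x)
    (hw : DifferentiableAt ℝ w x) : DifferentiableAt ℝ (fun z => cross (u z) (w z)) x := by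
  rw [differentiableAt_euclidean] at *
  intro i
  fin_cases i
  · simp only [Fin.zero_eta, cross_zero]; exact ((hu 1).mul (hw 2)).sub ((hu 2).mul (hw 1))
  · simp only [Fin.mk_one, cross_one]; exact ((hu 2).mul (hw 0)).sub ((hu 0).mul (hw 2))
  · simp only [Fin.reduceFinMk, cross_two]; exact ((hu 0).mul (hw 1)).sub ((hu 1).mul (hw 0))

/-- The field `∇f × x` is divergence-free. -/
lemma divergence_cross_gradient {f : E3 → ℝ} {x : E3} (hf : ContDiffAt ℝ 2 f x) :
    divergence (fun z => cross (∇ f z) z) x = 0 := by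
  have h2 := gradient_differentiableAt hf
  have hc : ∀ i, HasFDerivAt (fun z => (∇ f z) i)
      ((EuclideanSpace.proj i : E3 →L[ℝ] ℝ).comp (fderiv ℝ (∇ f) x)) x := fun i =>
    ((EuclideanSpace.proj i : E3 →L[ℝ] ℝ).hasFDerivAt).comp x h2.hasFDerivAt
  have hx : ∀ i, HasFDerivAt (fun z : E3 => z i) (EuclideanSpace.proj i : E3 →L[ℝ] ℝ) x := fun i =>
    (EuclideanSpace.proj i : E3 →L[ℝ] ℝ).hasFDerivAt
  rw [divergence_eq_coord (differentiableAt_cross h2 differentiableAt_fun_id)]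
  simp only [cross_zero, cross_one, cross_two]
  rw [(((hc 1).fun_mul (hx 2)).fun_sub ((hc 2).fun_mul (hx 1))).fderiv,
    (((hc 2).fun_mul (hx 0)).fun_sub ((hc 0).fun_mul (hx 2))).fderiv,
    (((hc 0).fun_mul (hx 1)).fun_sub ((hc 1).fun_mul (hx 0))).fderiv]
  -- Only off-diagonal second derivatives survive in the divergence, and they cancel in pairs by
  -- symmetry of the Hessian.
  have s01 := gradient_comp_symm hf (unitVec 0) (unitVec 1)
  have s02 := gradient_comp_symm hf (unitVec 0) (unitVec 2)
  have s12 := gradient_comp_symm hf (unitVec 1) (unitVec 2)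
  simp only [inner_unitVec] at s01 s02 s12
  simp
  linear_combination x 2 * s01 - x 1 * s02 + x 0 * s12

/-! ### Divergence theorem on spheres -/

/-- The generators x_i ∂_j - x_j ∂_i, applied to the components z_i w_j - z_j w_i of the moment of
w, recover the divergence up to radial terms. As each generator integrates to zero over spheres,
this identity replaces the divergence theorem on the sphere. -/
lemma rotation_divergence {w : E3 → E3} {x : E3} (hw : DifferentiableAt ℝ w x) :
    (fderiv ℝ (fun z => z 0 * w z 1 - z 1 * w z 0) x (x 0 • unitVec 1 - x 1 • unitVec 0))
    + (fderiv ℝ (fun z => z 0 * w z 2 - z 2 * w z 0) x (x 0 • unitVec 2 - x 2 • unitVec 0))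
    + (fderiv ℝ (fun z => z 1 * w z 2 - z 2 * w z 1) x (x 1 • unitVec 2 - x 2 • unitVec 1))
    = ‖x‖ ^ 2 * divergence w x - ⟪fderiv ℝ w x x, x⟫ - 2 * ⟪w x, x⟫ := by
  have hc : ∀ i, HasFDerivAt (fun z => (w z) i)
      ((EuclideanSpace.proj i : E3 →L[ℝ] ℝ).comp (fderiv ℝ w x)) x := fun i =>
    ((EuclideanSpace.proj i : E3 →L[ℝ] ℝ).hasFDerivAt).comp x hw.hasFDerivAt
  have hx : ∀ i, HasFDerivAt (fun z : E3 => z i) (EuclideanSpace.proj i : E3 →L[ℝ] ℝ) x := fun i =>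
    (EuclideanSpace.proj i : E3 →L[ℝ] ℝ).hasFDerivAt
  rw [(((hx 0).fun_mul (hc 1)).fun_sub ((hx 1).fun_mul (hc 0))).fderiv,
    (((hx 0).fun_mul (hc 2)).fun_sub ((hx 2).fun_mul (hc 0))).fderiv,
    (((hx 1).fun_mul (hc 2)).fun_sub ((hx 2).fun_mul (hc 1))).fderiv, normSq_E3]
  have hxx : fderiv ℝ w x x = x 0 • fderiv ℝ w x (unitVec 0) + x 1 • fderiv ℝ w x (unitVec 1)
      + x 2 • fderiv ℝ w x (unitVec 2) := by
    conv_lhs => rw [coord_sum x]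
    simp only [map_add, map_smul]
    rw [← coord_sum x]
  rw [hxx]
  simp [divergence, Fin.sum_univ_three, inner_E3]
  ring

lemma sphereIntegral_congr {f g : E3 → ℝ} {r : ℝ} (hr : 0 < r) (h : ∀ x, ‖x‖ = r → f x = g x) :
    sphereIntegral f r = sphereIntegral g r := by
  unfold sphereIntegral
  congr 1; ext n
  exact h _ (norm_smul_sphere hr.le n)

lemma sphereIntegral_add {f g : E3 → ℝ} {s : Set E3} (hf : ContinuousOn f s) (hg : ContinuousOn g s)
    {r : ℝ} (h : ∀ n : sphere (0 : E3) 1, r • (n : E3) ∈ s) :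
    sphereIntegral (fun x => f x + g x) r = sphereIntegral f r + sphereIntegral g r :=
  integral_add (continuous_sphere_integrable (continuous_on_sphere hf h))
    (continuous_sphere_integrable (continuous_on_sphere hg h))

lemma sphereIntegral_sub {f g : E3 → ℝ} {s : Set E3} (hf : ContinuousOn f s) (hg : ContinuousOn g s)
    {r : ℝ} (h : ∀ n : sphere (0 : E3) 1, r • (n : E3) ∈ s) :
    sphereIntegral (fun x => f x - g x) r = sphereIntegral f r - sphereIntegral g r :=
  integral_sub (continuous_sphere_integrable (continuous_on_sphere hf h))
    (continuous_sphere_integrable (continuous_on_sphere hg h))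

lemma sphereIntegral_const_mul (c : ℝ) (f : E3 → ℝ) (r : ℝ) :
    sphereIntegral (fun x => c * f x) r = c * sphereIntegral f r :=
  integral_const_mul c _

lemma sphereIntegral_neg (f : E3 → ℝ) (r : ℝ) :
    sphereIntegral (fun x => - f x) r = - sphereIntegral f r :=
  integral_neg _

lemma divergence_continuousOn {w : E3 → E3} {U : Set E3} (hU : IsOpen U) (hw : ContDiffOn ℝ 1 w U) :
    ContinuousOn (divergence w) U := by
  have h := contDiffOn_fderiv_continuousOn hU hw
  unfold divergence
  refine continuousOn_finsetSum _ fun i _ => ?_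
  exact (EuclideanSpace.proj i : E3 →L[ℝ] ℝ).continuous.comp_continuousOn (h.clm_apply continuousOn_const)

lemma shell_ne_zero {I : Set ℝ} (hI0 : I ⊆ Ioi 0) {x : E3} (hx : x ∈ shell I) : x ≠ 0 :=
  norm_pos_iff.1 (hI0 hx)

lemma unitRadial_contDiffOn {n : WithTop ℕ∞} {s : Set E3} (hs : ∀ x ∈ s, x ≠ 0) :
    ContDiffOn ℝ n (fun x : E3 => ‖x‖⁻¹ • x) s := fun x hx =>
  (((contDiffAt_norm ℝ (hs x hx)).inv (norm_ne_zero_iff.2 (hs x hx))).smul contDiffAt_id).contDiffWithinAt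

/-- The integrated divergence theorem: the surface part of a divergence has zero mean on spheres. -/
lemma sphereIntegral_divergence_eq {I : Set ℝ} (hI : IsOpen I) (hI0 : I ⊆ Ioi 0) {w : E3 → E3}
    (hw : ContDiffOn ℝ 1 w (shell I)) {r : ℝ} (hr : r ∈ I) :
    sphereIntegral (divergence w) r
      = r⁻¹ ^ 2 * sphereIntegral (fun x => ⟪fderiv ℝ w x x, x⟫) r
        + 2 * r⁻¹ ^ 2 * sphereIntegral (fun x => ⟪w x, x⟫) r := by
  have hU := isOpen_shell hI
  have h1 := contDiffOn_fderiv_continuousOn hU hw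
  have hr0 : 0 < r := hI0 hr
  have hm := smul_mem_shell hI0 hr
  have hwc := contDiffOn_euclidean.1 hw
  have hx : ∀ i : Fin 3, ContDiff ℝ 1 (fun z : E3 => z i) := fun i =>
    (EuclideanSpace.proj i : E3 →L[ℝ] ℝ).contDiff
  have hf : ∀ i j : Fin 3, ContDiffOn ℝ 1 (fun z => z i * w z j - z j * w z i) (shell I) := fun i j =>
    ((hx i).contDiffOn.mul (hwc j)).sub ((hx j).contDiffOn.mul (hwc i))
  have hL : ∀ i j : Fin 3, ContinuousOn (fun x => fderiv ℝ (fun z => z i * w z j - z j * w z i) x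
      (x i • unitVec j - x j • unitVec i)) (shell I) := fun i j =>
    (contDiffOn_fderiv_continuousOn hU (hf i j)).clm_apply (by fun_prop)
  have c1 : ContinuousOn (fun x => ⟪fderiv ℝ w x x, x⟫) (shell I) :=
    (h1.clm_apply continuousOn_id).inner (𝕜 := ℝ) continuousOn_id
  have c2 : ContinuousOn (fun x => ⟪w x, x⟫) (shell I) := hw.continuousOn.inner (𝕜 := ℝ) continuousOn_id
  have c3 := divergence_continuousOn hU hw
  have e := sphereIntegral_congr (r := r) hr0
    (f := fun x => ((fderiv ℝ (fun z => z 0 * w z 1 - z 1 * w z 0) x (x 0 • unitVec 1 - x 1 • unitVec 0))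
    + (fderiv ℝ (fun z => z 0 * w z 2 - z 2 * w z 0) x (x 0 • unitVec 2 - x 2 • unitVec 0)))
    + (fderiv ℝ (fun z => z 1 * w z 2 - z 2 * w z 1) x (x 1 • unitVec 2 - x 2 • unitVec 1)))
    (g := fun x => (r ^ 2 * divergence w x - ⟪fderiv ℝ w x x, x⟫) - 2 * ⟪w x, x⟫)
    (fun x hxr => by
      have hxI : x ∈ shell I := by simpa [shell, hxr] using hr
      rw [rotation_divergence ((hw.differentiableOn one_ne_zero).differentiableAt (hU.mem_nhds hxI)), hxr])
  rw [sphereIntegral_add (f := fun x => _ + _) ((hL 0 1).fun_add (hL 0 2)) (hL 1 2) hm, sphereIntegral_add (hL 0 1) (hL 0 2) hm,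
    sphereIntegral_rotation hI hI0 (hf 0 1) hr (by decide), sphereIntegral_rotation hI hI0 (hf 0 2) hr (by decide),
    sphereIntegral_rotation hI hI0 (hf 1 2) hr (by decide),
    sphereIntegral_sub ((continuousOn_const.fun_mul c3).fun_sub c1) (continuousOn_const.fun_mul c2) hm,
    sphereIntegral_sub (continuousOn_const.fun_mul c3) c1 hm, sphereIntegral_const_mul, sphereIntegral_const_mul] at e
  field_simp
  linarith

/-- The derivative of the flux of `w` through a sphere. -/
lemma sphereIntegral_flux_hasDerivAt {I : Set ℝ} (hI : IsOpen I) (hI0 : I ⊆ Ioi 0) {w : E3 → E3}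
    (hw : ContDiffOn ℝ 1 w (shell I)) {r : ℝ} (hr : r ∈ I) :
    HasDerivAt (sphereIntegral (fun x => ⟪w x, ‖x‖⁻¹ • x⟫))
      (sphereIntegral (divergence w) r
        - 2 / r * sphereIntegral (fun x => ⟪w x, ‖x‖⁻¹ • x⟫) r) r := by
  have hU := isOpen_shell hI
  have hr0 : 0 < r := hI0 hr
  have hn := unitRadial_contDiffOn (n := 1) (fun x (hx : x ∈ shell I) => shell_ne_zero hI0 hx)
  refine (sphereIntegral_hasDerivAt hI hI0 (hw.inner ℝ hn) hr).congr_deriv ?_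
  rw [sphereIntegral_divergence_eq hI hI0 hw hr]
  have e1 : sphereIntegral (fun x => ⟪w x, ‖x‖⁻¹ • x⟫) r = r⁻¹ * sphereIntegral (fun x => ⟪w x, x⟫) r := by
    rw [← sphereIntegral_const_mul]
    exact sphereIntegral_congr hr0 fun x hx => by rw [real_inner_smul_right, hx]
  have e2 : sphereIntegral (fun x => fderiv ℝ (fun x => ⟪w x, ‖x‖⁻¹ • x⟫) x (‖x‖⁻¹ • x)) r
      = r⁻¹ ^ 2 * sphereIntegral (fun x => ⟪fderiv ℝ w x x, x⟫) r := by
    rw [← sphereIntegral_const_mul]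
    refine sphereIntegral_congr hr0 fun x hx => ?_
    have hxI : x ∈ shell I := by simpa [shell, hx] using hr
    have hx0 := shell_ne_zero hI0 hxI
    have d1 : DifferentiableAt ℝ w x :=
      (hw.differentiableOn one_ne_zero).differentiableAt (hU.mem_nhds hxI)
    have d2 : DifferentiableAt ℝ (fun x : E3 => ‖x‖⁻¹ • x) x :=
      (hn.differentiableOn one_ne_zero).differentiableAt (hU.mem_nhds hxI)
    -- The unit radial field is constant along rays, so only w is differentiated in the radial
    -- direction.
    have d3 : fderiv ℝ (fun x : E3 => ‖x‖⁻¹ • x) x x = 0 := by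
      have h := d2.hasFDerivAt.comp_hasDerivAt_of_eq (1 : ℝ)
        ((hasDerivAt_id (1 : ℝ)).smul_const x) (by simp)
      have h' : (fun t : ℝ => ‖t • x‖⁻¹ • t • x) =ᶠ[𝓝 1] fun _ => ‖x‖⁻¹ • x := by
        filter_upwards [eventually_gt_nhds (show (0 : ℝ) < 1 by norm_num)] with t ht
        rw [norm_smul, Real.norm_of_nonneg ht.le, smul_smul]
        congr 1
        field_simp
      have h2 := (h.congr_of_eventuallyEq (EventuallyEq.symm (by simpa [Function.comp_def] using h'))).unique (hasDerivAt_const _ _)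
      simpa using h2
    rw [fderiv_inner_apply ℝ d1 d2]
    simp only [map_smul, d3, smul_zero, inner_zero_right, real_inner_smul_left, real_inner_smul_right, hx]
    ring
  rw [e1, e2]
  field_simp
  ring

/-- A tangential field has a divergence of zero mean on spheres. -/
lemma sphereIntegral_divergence_tangential {I : Set ℝ} (hI : IsOpen I) (hI0 : I ⊆ Ioi 0) {w : E3 → E3}
    (hw : ContDiffOn ℝ 1 w (shell I)) (ht : ∀ x ∈ shell I, ⟪w x, x⟫ = 0) {r : ℝ} (hr : r ∈ I) :
    sphereIntegral (divergence w) r = 0 := by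
  have h := sphereIntegral_flux_hasDerivAt hI hI0 hw hr
  -- A tangential field has zero flux at every radius; in the formula for the derivative of the flux
  -- only the mean of the divergence remains.
  have h0 : ∀ s ∈ I, sphereIntegral (fun x => ⟪w x, ‖x‖⁻¹ • x⟫) s = 0 := fun s hs => by
    rw [sphereIntegral_congr (g := fun _ => 0) (hI0 hs)]
    · simp [sphereIntegral]
    · intro x hx
      rw [real_inner_smul_right, ht x (by simpa [shell, hx] using hs), mul_zero]
  have h2 := (h.congr_of_eventuallyEq (f₁ := fun _ => 0) (by
    filter_upwards [hI.mem_nhds hr] with s hs using (h0 s hs).symm)).unique (hasDerivAt_const _ _)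
  rw [h0 r hr] at h2
  linarith

/-- The derivative of the flux of `w` weighted with `ψ`. -/
lemma sphereIntegral_weighted_flux {I : Set ℝ} (hI : IsOpen I) (hI0 : I ⊆ Ioi 0) {w : E3 → E3}
    {ψ : E3 → ℝ} (hψ : ContDiffOn ℝ 1 ψ (shell I))
    (hw : ContDiffOn ℝ 1 w (shell I)) {r : ℝ} (hr : r ∈ I) :
    HasDerivAt (sphereIntegral (fun x => ψ x * ⟪w x, ‖x‖⁻¹ • x⟫))
      (sphereIntegral (fun x => ψ x * divergence w x) r + sphereIntegral (fun x => ⟪∇ ψ x, w x⟫) r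
        - 2 / r * sphereIntegral (fun x => ψ x * ⟪w x, ‖x‖⁻¹ • x⟫) r) r := by
  have hU := isOpen_shell hI
  have h := sphereIntegral_flux_hasDerivAt hI hI0 (w := fun x => ψ x • w x) (hψ.smul hw) hr
  simp only [real_inner_smul_left] at h
  refine h.congr_deriv ?_
  congr 1
  rw [← sphereIntegral_add (s := shell I) (hψ.continuousOn.fun_mul (divergence_continuousOn hU hw)) ?_
    (smul_mem_shell hI0 hr)]
  · refine sphereIntegral_congr (hI0 hr) fun x hx => ?_
    have hxI : x ∈ shell I := by simpa [shell, hx] using hr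
    exact divergence_smul ((hψ.differentiableOn one_ne_zero).differentiableAt (hU.mem_nhds hxI))
      ((hw.differentiableOn one_ne_zero).differentiableAt (hU.mem_nhds hxI))
  · exact (gradient_contDiffOn (m := 0) hU hψ (by simp)).continuousOn.inner (𝕜 := ℝ) hw.continuousOn

/-- Integration by parts on spheres against a tangential field. -/
lemma sphereIntegral_inner_gradient {I : Set ℝ} (hI : IsOpen I) (hI0 : I ⊆ Ioi 0) {w : E3 → E3}
    {ψ : E3 → ℝ} (hψ : ContDiffOn ℝ 1 ψ (shell I))
    (hw : ContDiffOn ℝ 1 w (shell I)) (ht : ∀ x ∈ shell I, ⟪w x, x⟫ = 0) {r : ℝ} (hr : r ∈ I) :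
    sphereIntegral (fun x => ⟪∇ ψ x, w x⟫) r = - sphereIntegral (fun x => ψ x * divergence w x) r := by
  have hU := isOpen_shell hI
  have h := sphereIntegral_divergence_tangential hI hI0 (hψ.smul hw)
    (w := fun x => ψ x • w x) (fun x hx => by simp only [real_inner_smul_left, ht x hx, mul_zero]) hr
  have e : sphereIntegral (divergence (fun x => ψ x • w x)) r
      = sphereIntegral (fun x => ψ x * divergence w x + ⟪∇ ψ x, w x⟫) r := by
    refine sphereIntegral_congr (hI0 hr) fun x hx => ?_
    have hxI : x ∈ shell I := by simpa [shell, hx] using hr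
    exact divergence_smul ((hψ.differentiableOn one_ne_zero).differentiableAt (hU.mem_nhds hxI))
      ((hw.differentiableOn one_ne_zero).differentiableAt (hU.mem_nhds hxI))
  rw [e, sphereIntegral_add (s := shell I) (hψ.continuousOn.fun_mul (divergence_continuousOn hU hw)) ?_
    (smul_mem_shell hI0 hr)] at h
  · linarith
  · exact (gradient_contDiffOn (m := 0) hU hψ (by simp)).continuousOn.inner (𝕜 := ℝ) hw.continuousOn

/-! ### Homogeneous smooth functions and solid harmonics -/

/-- Smooth functions that are homogeneous of degree `l`, that is, homogeneous polynomials. -/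
structure IsHomog (l : ℕ) (f : E3 → ℝ) : Prop where
  smooth : ContDiff ℝ ∞ f
  homogeneous : ∀ (c : ℝ) (x : E3), f (c • x) = c ^ l * f x

lemma one_le_infty : (1 : WithTop ℕ∞) ≤ ∞ := WithTop.coe_le_coe.2 (le_top : (1 : ℕ∞) ≤ ⊤)
lemma two_le_infty : (2 : WithTop ℕ∞) ≤ ∞ := WithTop.coe_le_coe.2 (le_top : (2 : ℕ∞) ≤ ⊤)

lemma IsSolidHarmonic.isHomog {l : ℕ} {H : E3 → ℝ} (h : IsSolidHarmonic l H) : IsHomog l H :=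
  ⟨h.smooth, h.homogeneous⟩

lemma IsHomog.differentiable {l : ℕ} {f : E3 → ℝ} (h : IsHomog l f) : Differentiable ℝ f :=
  h.smooth.differentiable (by simp)

lemma IsHomog.contDiff_two {l : ℕ} {f : E3 → ℝ} (h : IsHomog l f) : ContDiff ℝ 2 f :=
  h.smooth.of_le two_le_infty

lemma IsHomog.add {l : ℕ} {f g : E3 → ℝ} (hf : IsHomog l f) (hg : IsHomog l g) :
    IsHomog l (fun x => f x + g x) :=
  ⟨hf.smooth.add hg.smooth, fun c x => by rw [hf.homogeneous, hg.homogeneous]; ring⟩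

lemma IsHomog.sub {l : ℕ} {f g : E3 → ℝ} (hf : IsHomog l f) (hg : IsHomog l g) :
    IsHomog l (fun x => f x - g x) :=
  ⟨hf.smooth.sub hg.smooth, fun c x => by rw [hf.homogeneous, hg.homogeneous]; ring⟩

lemma IsHomog.const_mul {l : ℕ} {f : E3 → ℝ} (hf : IsHomog l f) (a : ℝ) :
    IsHomog l (fun x => a * f x) :=
  ⟨contDiff_const.mul hf.smooth, fun c x => by rw [hf.homogeneous]; ring⟩

lemma IsHomog.mul {l m : ℕ} {f g : E3 → ℝ} (hf : IsHomog l f) (hg : IsHomog m g) :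
    IsHomog (l + m) (fun x => f x * g x) :=
  ⟨hf.smooth.mul hg.smooth, fun c x => by rw [hf.homogeneous, hg.homogeneous]; ring⟩

lemma IsHomog.zero (l : ℕ) : IsHomog l (fun _ => 0) := ⟨contDiff_const, fun c x => by simp⟩

lemma isHomog_const (a : ℝ) : IsHomog 0 (fun _ => a) := ⟨contDiff_const, fun c x => by simp⟩

lemma isHomog_inner (a : E3) : IsHomog 1 (fun x => ⟪a, x⟫) :=
  ⟨contDiff_const.inner ℝ contDiff_id, fun c x => by rw [real_inner_smul_right]; ring⟩

lemma isHomog_normSq : IsHomog 2 (fun x => ‖x‖ ^ 2) :=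
  ⟨contDiff_norm_sq ℝ, fun c x => by rw [norm_smul, mul_pow, Real.norm_eq_abs, sq_abs]⟩

/-- Euler's identity. -/
lemma IsHomog.euler {l : ℕ} {f : E3 → ℝ} (hf : IsHomog l f) (x : E3) :
    ⟪∇ f x, x⟫ = l * f x := by
  rw [inner_grad]
  have h := ((hf.differentiable x).hasFDerivAt).comp_hasDerivAt_of_eq (1 : ℝ)
    ((hasDerivAt_id (1 : ℝ)).smul_const x) (by simp)
  have h2 : HasDerivAt (fun c : ℝ => c ^ l * f x) (l * (1 : ℝ) ^ (l - 1) * f x) 1 :=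
    (hasDerivAt_pow l (1 : ℝ)).mul_const (f x)
  have e : (f ∘ fun c : ℝ => id c • x) = fun c : ℝ => c ^ l * f x := by
    ext c; exact hf.homogeneous c x
  rw [e] at h
  simpa using h.unique h2

lemma IsHomog.const_of_zero {f : E3 → ℝ} (hf : IsHomog 0 f) (x : E3) : f x = f 0 := by
  simpa using (hf.homogeneous 0 x).symm

lemma IsHomog.fderiv_apply {l : ℕ} {f : E3 → ℝ} (hf : IsHomog (l + 1) f) (v : E3) :
    IsHomog l (fun x => fderiv ℝ f x v) := by
  have hs : ContDiff ℝ ∞ (fun x => fderiv ℝ f x v) :=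
    (hf.smooth.fderiv_right (m := ∞) (by simp)).clm_apply contDiff_const
  refine ⟨hs, fun c x => ?_⟩
  have hc : ∀ c : ℝ, c ≠ 0 → fderiv ℝ f (c • x) v = c ^ l * fderiv ℝ f x v := by
    intro c hc
    have h1 : HasFDerivAt (fun y => f (c • y)) ((fderiv ℝ f (c • x)).comp
        (c • ContinuousLinearMap.id ℝ E3)) x :=
      (hf.differentiable (c • x)).hasFDerivAt.comp x
        ((c • ContinuousLinearMap.id ℝ E3).hasFDerivAt)
    have h2 : HasFDerivAt (fun y => f (c • y)) (c ^ (l + 1) • fderiv ℝ f x) x := by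
      simp only [hf.homogeneous]
      exact (hf.differentiable x).hasFDerivAt.const_mul _
    have h3 := congrArg (fun T : E3 →L[ℝ] ℝ => T v) (h1.unique h2)
    simp at h3
    apply mul_left_cancel₀ hc
    rw [h3]; ring
  -- The chain rule produced a factor c that could be cancelled only for c ≠ 0; the case c = 0
  -- follows by continuity.
  have hd : Dense ({0}ᶜ : Set ℝ) := dense_compl_singleton 0
  refine congrFun (Continuous.ext_on hd (f := fun c : ℝ => fderiv ℝ f (c • x) v)
    (g := fun c => c ^ l * fderiv ℝ f x v) ?_ (by fun_prop) fun c h => hc c h) c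
  exact hs.continuous.comp (by fun_prop : Continuous fun c : ℝ => c • x)

lemma laplacian_eq_sum {f : E3 → ℝ} (hf : ContDiff ℝ 2 f) (x : E3) :
    Δ f x = ∑ i, fderiv ℝ (fun z => fderiv ℝ f z (unitVec i)) x (unitVec i) := by
  rw [laplacian_eq_divergence hf.contDiffAt]
  refine Finset.sum_congr rfl fun i _ => ?_
  rw [← fderiv_coord (gradient_differentiableAt hf.contDiffAt)]
  simp only [gradient_coord]

lemma IsHomog.laplacian {l : ℕ} {f : E3 → ℝ} (hf : IsHomog (l + 2) f) :
    IsHomog l (fun x => Δ f x) := by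
  simp only [laplacian_eq_sum hf.contDiff_two, Fin.sum_univ_three]
  exact ((((hf.fderiv_apply _).fderiv_apply _).add ((hf.fderiv_apply _).fderiv_apply _)).add
    ((hf.fderiv_apply _).fderiv_apply _))

lemma IsHomog.fderiv_zero {f : E3 → ℝ} (hf : IsHomog 0 f) (x v : E3) : fderiv ℝ f x v = 0 := by
  have e : f = fun _ => f 0 := by ext y; exact hf.const_of_zero y
  rw [e]; simp

lemma IsHomog.laplacian_eq_zero {l : ℕ} {f : E3 → ℝ} (hf : IsHomog l f) (hl : l < 2) (x : E3) :
    Δ f x = 0 := by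
  rw [laplacian_eq_sum hf.contDiff_two]
  refine Finset.sum_eq_zero fun i _ => ?_
  interval_cases l
  · simp only [hf.fderiv_zero]
    simp
  · exact (hf.fderiv_apply (unitVec i)).fderiv_zero _ _

lemma hasGradientAt_normSq (x : E3) : HasGradientAt (fun z : E3 => ‖z‖ ^ 2) ((2 : ℝ) • x) x := by
  rw [hasGradientAt_iff_hasFDerivAt]
  refine (hasStrictFDerivAt_norm_sq x).hasFDerivAt.congr_fderiv ?_
  ext y
  simp

lemma gradient_mul {f g : E3 → ℝ} {x : E3} (hf : DifferentiableAt ℝ f x) (hg : DifferentiableAt ℝ g x) :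
    ∇ (fun z => f z * g z) x = f x • ∇ g x + g x • ∇ f x := by
  refine ext_inner_right ℝ fun v => ?_
  rw [inner_grad, inner_add_left, real_inner_smul_left, real_inner_smul_left, inner_grad, inner_grad,
    fderiv_fun_mul hf hg]
  simp

lemma laplacian_normSq_mul {f : E3 → ℝ} (hf : ContDiff ℝ 2 f) (x : E3) :
    Δ (fun z => ‖z‖ ^ 2 * f z) x = 6 * f x + 4 * ⟪∇ f x, x⟫ + ‖x‖ ^ 2 * Δ f x := by
  have hn : ContDiff ℝ 2 (fun z : E3 => ‖z‖ ^ 2) := contDiff_norm_sq ℝ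
  have hd : Differentiable ℝ f := hf.differentiable (by norm_num)
  have hnd : Differentiable ℝ (fun z : E3 => ‖z‖ ^ 2) := hn.differentiable (by norm_num)
  have hg := gradient_differentiableAt (hf.contDiffAt (x := x))
  rw [laplacian_eq_divergence (hn.mul hf).contDiffAt, laplacian_eq_divergence hf.contDiffAt]
  have e : ∇ (fun z => ‖z‖ ^ 2 * f z) = fun z => ‖z‖ ^ 2 • ∇ f z + (2 * f z) • z := by
    ext1 z
    rw [gradient_mul (hnd z) (hd z), (hasGradientAt_normSq z).gradient, smul_smul, mul_comm 2]
  rw [e, divergence_add ((hnd x).fun_smul hg) (((hd x).const_mul 2).fun_smul differentiableAt_fun_id),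
    divergence_smul (hnd x) hg, divergence_smul ((hd x).const_mul 2) differentiableAt_fun_id,
    divergence_id, (hasGradientAt_normSq x).gradient]
  have e2 : ∇ (fun z => 2 * f z) x = (2 : ℝ) • ∇ f x := by
    refine ext_inner_right ℝ fun v => ?_
    rw [inner_grad, real_inner_smul_left, inner_grad, fderiv_const_mul (hd x)]
    simp
  rw [e2, real_inner_smul_left, real_inner_smul_left, real_inner_comm (∇ f x) x]
  ring

lemma IsHomog.laplacian_normSq_mul {l : ℕ} {f : E3 → ℝ} (hf : IsHomog l f) (x : E3) :
    Δ (fun z => ‖z‖ ^ 2 * f z) x = (6 + 4 * l) * f x + ‖x‖ ^ 2 * Δ f x := by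
  rw [StellarModes.laplacian_normSq_mul hf.contDiff_two, hf.euler]; ring

lemma laplacian_sub' {f g : E3 → ℝ} (hf : ContDiff ℝ 2 f) (hg : ContDiff ℝ 2 g) (x : E3) :
    Δ (fun z => f z - g z) x = Δ f x - Δ g x :=
  hf.contDiffAt.laplacian_sub hg.contDiffAt

lemma laplacian_add' {f g : E3 → ℝ} (hf : ContDiff ℝ 2 f) (hg : ContDiff ℝ 2 g) (x : E3) :
    Δ (fun z => f z + g z) x = Δ f x + Δ g x :=
  hf.contDiffAt.laplacian_add hg.contDiffAt

lemma laplacian_const_mul' (a : ℝ) {f : E3 → ℝ} (hf : ContDiff ℝ 2 f) (x : E3) :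
    Δ (fun z => a * f z) x = a * Δ f x :=
  InnerProductSpace.laplacian_smul a hf.contDiffAt

/-- Homogeneous solutions of `c g + Δ (|x|² g) = f`. -/
lemma IsHomog.exists_laplacian_eq {n : ℕ} : ∀ {c : ℝ}, 0 ≤ c → ∀ {f : E3 → ℝ}, IsHomog n f →
    ∃ g, IsHomog n g ∧ ∀ x, c * g x + Δ (fun z => ‖z‖ ^ 2 * g z) x = f x := by
  induction n using Nat.strong_induction_on with
  | _ n ih =>
    intro c hc f hf
    have hc' : 0 < c + 6 + 4 * n := by positivity
    by_cases hn : n < 2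
    · refine ⟨fun x => (c + 6 + 4 * n)⁻¹ * f x, hf.const_mul _, fun x => ?_⟩
      rw [(hf.const_mul _).laplacian_normSq_mul, (hf.const_mul _).laplacian_eq_zero hn]
      field_simp
      ring
    · obtain ⟨m, rfl⟩ : ∃ m, n = m + 2 := ⟨n - 2, by omega⟩
      -- With C = c + 6 + 4n the equation reads C g + |x|² Δg = f. Its Laplacian is an equation of
      -- the same form for h = Δg, with constant C and right side Δf, two degrees lower; this is why
      -- c has to be arbitrary in the induction. Then g = (f - |x|² h)/C.
      obtain ⟨h, hh, hhe⟩ := ih m (by omega) hc'.le hf.laplacian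
      have h2 : IsHomog (m + 2) (fun x => ‖x‖ ^ 2 * h x) := by
        have := isHomog_normSq.mul hh
        rwa [add_comm] at this
      refine ⟨fun x => (c + 6 + 4 * (m + 2 : ℕ))⁻¹ * (f x - ‖x‖ ^ 2 * h x),
        (hf.sub h2).const_mul _, fun x => ?_⟩
      rw [((hf.sub h2).const_mul _).laplacian_normSq_mul,
        laplacian_const_mul' _ (hf.sub h2).contDiff_two, laplacian_sub' hf.contDiff_two h2.contDiff_two]
      have e := hhe x
      have e3 : Δ (fun z => ‖z‖ ^ 2 * h z) x = Δ f x - (c + 6 + 4 * (m + 2 : ℕ)) * h x := by linarith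
      rw [e3]
      field_simp
      ring

/-- The span of the solid harmonics of degree at most `N`. -/
def harmonicSpan (N : ℕ) : Submodule ℝ (E3 → ℝ) :=
  Submodule.span ℝ {H | ∃ l ≤ N, IsSolidHarmonic l H}

lemma harmonicSpan_mono {M N : ℕ} (h : M ≤ N) : harmonicSpan M ≤ harmonicSpan N :=
  Submodule.span_mono fun _ ⟨l, hl, hH⟩ => ⟨l, hl.trans h, hH⟩

/-- On the unit sphere, every homogeneous polynomial is a sum of solid harmonics. -/
lemma IsHomog.exists_harmonicSpan {n : ℕ} : ∀ {p : E3 → ℝ}, IsHomog n p →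
    ∃ q ∈ harmonicSpan n, ∀ x, ‖x‖ = 1 → p x = q x := by
  induction n using Nat.strong_induction_on with
  | _ n ih =>
    intro p hp
    by_cases hn : n < 2
    · exact ⟨p, Submodule.subset_span ⟨n, le_rfl, hp.smooth, hp.laplacian_eq_zero hn, hp.homogeneous⟩,
        fun _ _ => rfl⟩
    · obtain ⟨m, rfl⟩ : ∃ m, n = m + 2 := ⟨n - 2, by omega⟩
      -- Here c = 0, so Δ(|x|² g) = Δp and p - |x|² g is harmonic. On the unit sphere |x|² g equals
      -- g, which has degree two less.
      obtain ⟨g, hg, hge⟩ := IsHomog.exists_laplacian_eq le_rfl hp.laplacian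
      obtain ⟨q, hq, hqe⟩ := ih m (by omega) hg
      have h2 : IsHomog (m + 2) (fun x => ‖x‖ ^ 2 * g x) := by
        have := isHomog_normSq.mul hg
        rwa [add_comm] at this
      have hH : IsSolidHarmonic (m + 2) (fun x => p x - ‖x‖ ^ 2 * g x) := by
        refine ⟨(hp.sub h2).smooth, fun x => ?_, (hp.sub h2).homogeneous⟩
        rw [laplacian_sub' hp.contDiff_two h2.contDiff_two]
        have := hge x
        linarith
      refine ⟨_, add_mem (Submodule.subset_span ⟨m + 2, le_rfl, hH⟩)
        (harmonicSpan_mono (by omega) hq), fun x hx => ?_⟩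
      simp [hx, hqe x hx]

/-- Solid harmonics are dense in the continuous functions on the sphere. -/
lemma exists_harmonicSpan_approx (f : C(sphere (0 : E3) 1, ℝ)) {ε : ℝ} (hε : 0 < ε) :
    ∃ N, ∃ q ∈ harmonicSpan N, ∀ n : sphere (0 : E3) 1, |f n - q n| < ε := by
  let X : Fin 3 → C(sphere (0 : E3) 1, ℝ) := fun i => ⟨fun n => (n : E3) i, by fun_prop⟩
  let A := Algebra.adjoin ℝ (Set.range X)
  have hA : A.SeparatesPoints := by
    intro m n hmn
    have : ∃ i, (m : E3) i ≠ (n : E3) i := by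
      by_contra! h
      exact hmn (Subtype.ext (by ext i; exact h i))
    obtain ⟨i, hi⟩ := this
    exact ⟨X i, ⟨X i, Algebra.subset_adjoin ⟨i, rfl⟩, rfl⟩, hi⟩
  -- An element of the algebra generated by the coordinates is a linear combination of monomials.
  -- Each monomial is homogeneous, so on the sphere it is a sum of solid harmonics; the rest is
  -- Stone–Weierstrass.
  have hrep : ∀ g ∈ A, ∃ N, ∃ q ∈ harmonicSpan N, ∀ n : sphere (0 : E3) 1, g n = q n := by
    intro g hg
    have hg' : g ∈ Submodule.span ℝ (Submonoid.closure (Set.range X) : Set C(sphere (0 : E3) 1, ℝ)) := by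
      rw [← Algebra.adjoin_eq_span]; exact hg
    induction hg' using Submodule.span_induction with
    | mem g hg₁ =>
      have : ∃ n p, IsHomog n p ∧ ∀ m : sphere (0 : E3) 1, g m = p m := by
        change g ∈ Submonoid.closure (Set.range X) at hg₁
        clear hg
        induction hg₁ using Submonoid.closure_induction with
        | mem g hg =>
          obtain ⟨i, rfl⟩ := hg
          exact ⟨1, _, isHomog_inner (unitVec i), fun m => by
            rw [real_inner_comm, inner_unitVec]; rfl⟩
        | one => exact ⟨0, _, isHomog_const 1, fun m => rfl⟩
        | mul a b ha hb iha ihb =>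
          obtain ⟨n, p, hp, hpe⟩ := iha
          obtain ⟨n', p', hp', hpe'⟩ := ihb
          exact ⟨_, _, hp.mul hp', fun m => by simp [hpe, hpe']⟩
      obtain ⟨n, p, hp, hpe⟩ := this
      obtain ⟨q, hq, hqe⟩ := hp.exists_harmonicSpan
      exact ⟨n, q, hq, fun m => by rw [hpe, hqe _ (norm_sphere m)]⟩
    | zero => exact ⟨0, 0, zero_mem _, fun n => rfl⟩
    | add a b ha hb iha ihb =>
      obtain ⟨N, q, hq, hqe⟩ := iha (by rw [← Subalgebra.mem_toSubmodule, Algebra.adjoin_eq_span]; exact ha)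
      obtain ⟨N', q', hq', hqe'⟩ := ihb (by rw [← Subalgebra.mem_toSubmodule, Algebra.adjoin_eq_span]; exact hb)
      exact ⟨max N N', q + q', add_mem (harmonicSpan_mono (le_max_left _ _) hq)
        (harmonicSpan_mono (le_max_right _ _) hq'), fun n => by simp [hqe, hqe']⟩
    | smul c a ha iha =>
      obtain ⟨N, q, hq, hqe⟩ := iha (by rw [← Subalgebra.mem_toSubmodule, Algebra.adjoin_eq_span]; exact ha)
      exact ⟨N, c • q, Submodule.smul_mem _ _ hq, fun n => by simp [hqe]⟩
  obtain ⟨g, hg⟩ := ContinuousMap.exists_mem_subalgebra_near_continuousMap_of_separatesPoints A hA f ε hε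
  obtain ⟨N, q, hq, hqe⟩ := hrep g g.2
  refine ⟨N, q, hq, fun n => ?_⟩
  rw [← hqe n, abs_sub_comm]
  exact (ContinuousMap.norm_coe_le_norm ((g : C(sphere (0 : E3) 1, ℝ)) - f) n).trans_lt hg

/-! ### The angular part of a solid harmonic -/

lemma angular_smul (H : E3 → ℝ) {c : ℝ} (hc : 0 < c) (x : E3) : angular H (c • x) = angular H x := by
  unfold angular
  rw [norm_smul, Real.norm_of_nonneg hc.le, smul_smul]
  congr 2
  field_simp

lemma angular_sphere (H : E3 → ℝ) {r : ℝ} (hr : 0 < r) (n : sphere (0 : E3) 1) :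
    angular H (r • (n : E3)) = H n := by
  rw [angular_smul H hr, angular, norm_sphere, inv_one, one_smul]

lemma IsHomog.angular_eq {l : ℕ} {H : E3 → ℝ} (h : IsHomog l H) (x : E3) :
    angular H x = (‖x‖⁻¹) ^ l * H x := by
  rw [angular, h.homogeneous]

lemma IsHomog.angular_contDiffOn {l : ℕ} {H : E3 → ℝ} (h : IsHomog l H) :
    ContDiffOn ℝ ∞ (angular H) {0}ᶜ :=
  h.smooth.comp_contDiffOn (unitRadial_contDiffOn fun _ hx => hx)

lemma shell_Ioi : shell (Ioi 0) = {0}ᶜ := by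
  ext x; simp [shell]

lemma shell_subset_compl_zero {I : Set ℝ} (hI0 : I ⊆ Ioi 0) : shell I ⊆ {0}ᶜ :=
  fun _ hx => shell_ne_zero hI0 hx

lemma IsHomog.angular_contDiffAt {l : ℕ} {H : E3 → ℝ} (h : IsHomog l H) {x : E3} (hx : x ≠ 0) :
    ContDiffAt ℝ ∞ (angular H) x :=
  h.angular_contDiffOn.contDiffAt (isOpen_compl_singleton.mem_nhds hx)

lemma IsHomog.gradient_angular_contDiffOn {l : ℕ} {H : E3 → ℝ} (h : IsHomog l H) :
    ContDiffOn ℝ ∞ (∇ (angular H)) {0}ᶜ :=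
  gradient_contDiffOn isOpen_compl_singleton h.angular_contDiffOn (by simp)

lemma hasGradientAt_norm_inv_pow (l : ℕ) {x : E3} (hx : x ≠ 0) :
    HasGradientAt (fun z : E3 => (‖z‖⁻¹) ^ l) (-(l * (‖x‖⁻¹) ^ (l + 2)) • x) x := by
  have hx' : ‖x‖ ≠ 0 := norm_ne_zero_iff.2 hx
  have h1 : HasFDerivAt (fun z : E3 => ‖z‖) (‖x‖⁻¹ • innerSL ℝ x) x := by
    have h := (hasStrictFDerivAt_norm_sq x).hasFDerivAt
    have h2 := h.sqrt (by positivity)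
    simp only [Real.sqrt_sq (norm_nonneg _)] at h2
    refine h2.congr_fderiv ?_
    ext y
    simp
    field_simp
  have h2 := ((hasDerivAt_inv hx').pow l).comp_hasFDerivAt x h1
  rw [hasGradientAt_iff_hasFDerivAt]
  refine h2.congr_fderiv ?_
  ext y
  simp
  cases l with
  | zero => simp
  | succ k => simp; field_simp; ring

lemma IsHomog.gradient_angular {l : ℕ} {H : E3 → ℝ} (h : IsHomog l H) {x : E3} (hx : x ≠ 0) :
    ∇ (angular H) x = (‖x‖⁻¹) ^ l • ∇ H x - (l * (‖x‖⁻¹) ^ (l + 2) * H x) • x := by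
  have e : angular H = fun z => (‖z‖⁻¹) ^ l * H z := by ext z; exact h.angular_eq z
  rw [e, gradient_mul (hasGradientAt_norm_inv_pow l hx).differentiableAt (h.differentiable x),
    (hasGradientAt_norm_inv_pow l hx).gradient]
  module

lemma IsHomog.inner_gradient_angular {l : ℕ} {H : E3 → ℝ} (h : IsHomog l H) {x : E3} (hx : x ≠ 0) :
    ⟪∇ (angular H) x, x⟫ = 0 := by
  have hx' : ‖x‖ ≠ 0 := norm_ne_zero_iff.2 hx
  rw [h.gradient_angular hx, inner_sub_left, real_inner_smul_left, real_inner_smul_left, h.euler,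
    real_inner_self_eq_norm_sq]
  have h2 : ‖x‖⁻¹ ^ 2 * ‖x‖ ^ 2 = 1 := by field_simp
  linear_combination (-(l * H x * ‖x‖⁻¹ ^ l)) * h2

lemma IsHomog.gradient_angular_smul {l : ℕ} {H : E3 → ℝ} (h : IsHomog l H) {c : ℝ} (hc : 0 < c)
    {x : E3} (hx : x ≠ 0) : ∇ (angular H) (c • x) = c⁻¹ • ∇ (angular H) x := by
  have hcx : c • x ≠ 0 := smul_ne_zero hc.ne' hx
  refine ext_inner_right ℝ fun v => ?_
  rw [inner_grad, real_inner_smul_left, inner_grad]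
  have h1 : HasFDerivAt (fun y => angular H (c • y)) ((fderiv ℝ (angular H) (c • x)).comp
      (c • ContinuousLinearMap.id ℝ E3)) x :=
    ((h.angular_contDiffAt hcx).differentiableAt (by simp)).hasFDerivAt.comp x
      ((c • ContinuousLinearMap.id ℝ E3).hasFDerivAt)
  have e : (fun y => angular H (c • y)) = angular H := by
    ext y; exact angular_smul H hc y
  rw [e] at h1
  rw [h1.fderiv]
  simp
  field_simp

lemma IsHomog.divergence_gradient_angular {l : ℕ} {H : E3 → ℝ} (h : IsHomog l H) {x : E3} (hx : x ≠ 0) :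
    divergence (∇ (angular H)) x = (‖x‖⁻¹) ^ l * (Δ H x - l * (l + 1) * (‖x‖⁻¹) ^ 2 * H x) := by
  have hx' : ‖x‖ ≠ 0 := norm_ne_zero_iff.2 hx
  have e : ∇ (angular H) =ᶠ[𝓝 x] fun z => (‖z‖⁻¹) ^ l • ∇ H z
      + (-l : ℝ) • (((‖z‖⁻¹) ^ (l + 2) * H z) • z) := by
    filter_upwards [isOpen_compl_singleton.mem_nhds hx] with z hz
    rw [h.gradient_angular hz]
    module
  have d1 := (hasGradientAt_norm_inv_pow l hx).differentiableAt
  have d2 := (hasGradientAt_norm_inv_pow (l + 2) hx).differentiableAt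
  have d3 := gradient_differentiableAt (h.contDiff_two.contDiffAt (x := x))
  have d4 := h.differentiable x
  rw [divergence_congr e, divergence_add (d1.fun_smul d3)
    (((d2.fun_mul d4).fun_smul differentiableAt_fun_id).fun_const_smul (-l : ℝ)),
    divergence_smul d1 d3, divergence_const_smul _ ((d2.fun_mul d4).fun_smul differentiableAt_fun_id),
    divergence_smul (d2.fun_mul d4) differentiableAt_fun_id, divergence_id,
    ← laplacian_eq_divergence h.contDiff_two.contDiffAt, gradient_mul d2 d4,
    (hasGradientAt_norm_inv_pow l hx).gradient, (hasGradientAt_norm_inv_pow (l + 2) hx).gradient,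
    inner_add_left, real_inner_smul_left, real_inner_smul_left, real_inner_smul_left,
    real_inner_smul_left, real_inner_comm, h.euler, real_inner_self_eq_norm_sq]
  have h2 : ‖x‖⁻¹ ^ 2 * ‖x‖ ^ 2 = 1 := by field_simp
  push_cast
  linear_combination (l * (l + 2) * ‖x‖⁻¹ ^ (l + 2) * H x) * h2

/-- This is the eigenvalue equation of the spherical Laplacian, with eigenvalue -l(l+1), for the
extension of Y that is constant along rays. -/
lemma IsSolidHarmonic.divergence_gradient_angular {l : ℕ} {H : E3 → ℝ} (h : IsSolidHarmonic l H)
    {x : E3} (hx : x ≠ 0) :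
    divergence (∇ (angular H)) x = -(l * (l + 1) * (‖x‖⁻¹) ^ 2) * angular H x := by
  rw [h.isHomog.divergence_gradient_angular hx, h.harmonic, h.isHomog.angular_eq]; ring

/-- The axial field of a solid harmonic. -/
def axialField (H : E3 → ℝ) (x : E3) : E3 := cross (∇ (angular H) x) (‖x‖⁻¹ • x)

lemma IsHomog.axialField_contDiffOn {l : ℕ} {H : E3 → ℝ} (h : IsHomog l H) :
    ContDiffOn ℝ ∞ (axialField H) {0}ᶜ :=
  contDiffOn_cross h.gradient_angular_contDiffOn (unitRadial_contDiffOn fun _ hx => hx)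

lemma inner_axialField (H : E3 → ℝ) (x : E3) : ⟪axialField H x, x⟫ = 0 := by
  rw [axialField, cross_smul_right, real_inner_smul_left, inner_cross_self_right, mul_zero]

lemma IsHomog.axialField_smul {l : ℕ} {H : E3 → ℝ} (h : IsHomog l H) {c : ℝ} (hc : 0 < c)
    {x : E3} (hx : x ≠ 0) : axialField H (c • x) = c⁻¹ • axialField H x := by
  unfold axialField
  rw [h.gradient_angular_smul hc hx, cross_smul_left, norm_smul, Real.norm_of_nonneg hc.le, smul_smul]
  congr 3
  field_simp

/-- The field is |x|⁻¹ times ∇Y × x. The second factor has no divergence by symmetry of the Hessian,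
and the gradient of the first is radial while ∇Y × x is tangential. -/
lemma IsHomog.divergence_axialField {l : ℕ} {H : E3 → ℝ} (h : IsHomog l H) {x : E3} (hx : x ≠ 0) :
    divergence (axialField H) x = 0 := by
  have hc : ContDiffAt ℝ 2 (angular H) x := (h.angular_contDiffAt hx).of_le two_le_infty
  have e : axialField H = fun z => (‖z‖⁻¹) ^ 1 • cross (∇ (angular H) z) z := by
    ext1 z; rw [axialField, cross_smul_right, pow_one]
  rw [e, divergence_smul (hasGradientAt_norm_inv_pow 1 hx).differentiableAt
    (differentiableAt_cross (gradient_differentiableAt hc) differentiableAt_fun_id),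
    divergence_cross_gradient hc, (hasGradientAt_norm_inv_pow 1 hx).gradient, real_inner_smul_left,
    real_inner_comm, inner_cross_self_right]
  ring

/-- Pairing with the gradient of a spherical harmonic. -/
lemma sphereIntegral_inner_gradient_angular {I : Set ℝ} (hI : IsOpen I) (hI0 : I ⊆ Ioi 0) {ψ : E3 → ℝ}
    (hψ : ContDiffOn ℝ 1 ψ (shell I)) {l : ℕ} {H : E3 → ℝ} (h : IsSolidHarmonic l H) {r : ℝ} (hr : r ∈ I) :
    sphereIntegral (fun x => ⟪∇ ψ x, ∇ (angular H) x⟫) r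
      = l * (l + 1) / r ^ 2 * sphereIntegral (fun x => ψ x * angular H x) r := by
  have hs := shell_subset_compl_zero hI0
  rw [sphereIntegral_inner_gradient hI hI0 hψ
    ((h.isHomog.gradient_angular_contDiffOn.mono hs).of_le one_le_infty)
    (fun x hx => h.isHomog.inner_gradient_angular (hs hx)) hr, ← sphereIntegral_neg,
    ← sphereIntegral_const_mul]
  refine sphereIntegral_congr (hI0 hr) fun x hx => ?_
  have hx0 : x ≠ 0 := norm_pos_iff.1 (hx ▸ hI0 hr)
  rw [h.divergence_gradient_angular hx0, hx]
  field_simp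

/-- Gradients are orthogonal to axial fields. -/
lemma sphereIntegral_inner_gradient_axial {I : Set ℝ} (hI : IsOpen I) (hI0 : I ⊆ Ioi 0) {ψ : E3 → ℝ}
    (hψ : ContDiffOn ℝ 1 ψ (shell I)) {l : ℕ} {H : E3 → ℝ} (h : IsHomog l H) {r : ℝ} (hr : r ∈ I) :
    sphereIntegral (fun x => ⟪∇ ψ x, axialField H x⟫) r = 0 := by
  have hs := shell_subset_compl_zero hI0
  rw [sphereIntegral_inner_gradient hI hI0 hψ
    ((h.axialField_contDiffOn.mono hs).of_le one_le_infty)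
    (fun x hx => inner_axialField H x) hr, sphereIntegral_congr (g := fun _ => 0) (hI0 hr)]
  · simp [sphereIntegral]
  · intro x hx
    rw [h.divergence_axialField (norm_pos_iff.1 (hx ▸ hI0 hr)), mul_zero]

/-- Spherical harmonics of different degrees are orthogonal. -/
lemma sphereIntegral_angular_orthogonal {l m : ℕ} {H G : E3 → ℝ} (hH : IsSolidHarmonic l H)
    (hG : IsSolidHarmonic m G) (hlm : l ≠ m) {r : ℝ} (hr : 0 < r) :
    sphereIntegral (fun x => angular H x * angular G x) r = 0 := by
  have c1 := hH.isHomog.angular_contDiffOn.of_le (m := 1) one_le_infty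
  have c2 := hG.isHomog.angular_contDiffOn.of_le (m := 1) one_le_infty
  rw [← shell_Ioi] at c1 c2
  have e1 := sphereIntegral_inner_gradient_angular isOpen_Ioi subset_rfl c1 hG (show r ∈ Ioi 0 from hr)
  have e2 := sphereIntegral_inner_gradient_angular isOpen_Ioi subset_rfl c2 hH (show r ∈ Ioi 0 from hr)
  have e3 : (fun x => ⟪∇ (angular G) x, ∇ (angular H) x⟫) = fun x => ⟪∇ (angular H) x, ∇ (angular G) x⟫ := by
    ext x; exact real_inner_comm _ _
  have e4 : (fun x => angular G x * angular H x) = fun x => angular H x * angular G x := by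
    ext x; ring
  rw [e3, e4, e1] at e2
  have hr2 : 0 < r ^ 2 := by positivity
  -- The mean of ∇Y_H · ∇Y_G is evaluated by integrating by parts onto either factor; the
  -- eigenvalues l(l+1) and m(m+1) are distinct for l ≠ m.
  have h3 : ((m : ℝ) * (m + 1) - l * (l + 1)) * sphereIntegral (fun x => angular H x * angular G x) r = 0 := by
    field_simp at e2
    linarith
  rcases mul_eq_zero.1 h3 with h4 | h4
  · exfalso
    have : ((m : ℝ) - l) * (m + l + 1) = 0 := by linarith
    rcases mul_eq_zero.1 this with h5 | h5
    · exact hlm (by exact_mod_cast (sub_eq_zero.1 h5).symm)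
    · exact absurd h5 (by positivity)
  · exact h4

/-! ### Completeness of spherical harmonics -/

lemma harmonicSpan_contDiff {N : ℕ} {q : E3 → ℝ} (hq : q ∈ harmonicSpan N) : ContDiff ℝ ∞ q := by
  induction hq using Submodule.span_induction with
  | mem q hq => obtain ⟨l, _, h⟩ := hq; exact h.smooth
  | zero => exact contDiff_const
  | add a b _ _ ha hb => exact ha.add hb
  | smul c a _ ha => exact contDiff_const.smul ha

/-- A continuous function on a sphere that is orthogonal to all spherical harmonics vanishes. -/
lemma eq_zero_of_orthogonal_harmonics {f : E3 → ℝ} {r : ℝ} (hr : 0 < r)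
    (hf : Continuous fun n : sphere (0 : E3) 1 => f (r • (n : E3)))
    (h : ∀ l H, IsSolidHarmonic l H → sphereIntegral (fun x => f x * angular H x) r = 0)
    {x : E3} (hx : ‖x‖ = r) : f x = 0 := by
  set F : C(sphere (0 : E3) 1, ℝ) := ⟨fun n => f (r • (n : E3)), hf⟩ with hF
  have hq : ∀ N, ∀ q ∈ harmonicSpan N, ∫ n, F n * q n ∂sphereMeasure = 0 := by
    intro N q hq
    induction hq using Submodule.span_induction with
    | mem q hq =>
      obtain ⟨l, _, hH⟩ := hq
      have := h l q hH
      simp only [sphereIntegral, angular_sphere q hr] at this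
      exact this
    | zero => simp
    | add a b ha hb iha ihb =>
      have ca := (harmonicSpan_contDiff ha).continuous
      have cb := (harmonicSpan_contDiff hb).continuous
      have e : (fun n : sphere (0 : E3) 1 => F n * (a + b) n) = fun n => F n * a n + F n * b n := by
        ext n; simp [mul_add]
      rw [e, integral_add (continuous_sphere_integrable (by fun_prop))
        (continuous_sphere_integrable (by fun_prop)), iha, ihb, add_zero]
    | smul c a ha iha =>
      have e : (fun n : sphere (0 : E3) 1 => F n * (c • a) n) = fun n => c * (F n * a n) := by
        ext n; simp; ring
      rw [e, integral_const_mul, iha, mul_zero]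
  -- For q in the span within ε of F, orthogonality gives ∫ F² = ∫ F (F - q) ≤ ε ∫ |F|.
  have hle : ∀ ε > 0, ∫ n, F n * F n ∂sphereMeasure ≤ ε * ∫ n, |F n| ∂sphereMeasure := by
    intro ε hε
    obtain ⟨N, q, hqm, hqe⟩ := exists_harmonicSpan_approx F hε
    have cq := (harmonicSpan_contDiff hqm).continuous
    have e : ∫ n, F n * F n ∂sphereMeasure = ∫ n : sphere (0 : E3) 1, F n * (F n - q n) ∂sphereMeasure := by
      simp only [mul_sub]
      rw [integral_sub (continuous_sphere_integrable (by fun_prop))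
        (continuous_sphere_integrable (by fun_prop)), hq N q hqm, sub_zero]
    rw [e, ← integral_const_mul]
    refine integral_mono (continuous_sphere_integrable (by fun_prop))
      (continuous_sphere_integrable (by fun_prop)) fun n => ?_
    calc F n * (F n - q n) ≤ |F n| * |F n - q n| := by rw [← abs_mul]; exact le_abs_self _
      _ ≤ |F n| * ε := mul_le_mul_of_nonneg_left (hqe n).le (abs_nonneg _)
      _ = ε * |F n| := mul_comm _ _
  have h0 : ∫ n, F n * F n ∂sphereMeasure = 0 := by
    refine le_antisymm ?_ (integral_nonneg fun n => mul_self_nonneg _)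
    have ht : Tendsto (fun ε : ℝ => ε * ∫ n, |F n| ∂sphereMeasure) (𝓝[>] 0) (𝓝 0) := by
      have : Tendsto (fun ε : ℝ => ε * ∫ n, |F n| ∂sphereMeasure) (𝓝 0) (𝓝 (0 * ∫ n, |F n| ∂sphereMeasure)) :=
        tendsto_id.mul_const _
      rw [zero_mul] at this
      exact this.mono_left nhdsWithin_le_nhds
    refine ge_of_tendsto ht ?_
    filter_upwards [self_mem_nhdsWithin] with ε hε using hle ε hε
  have hFF : Continuous fun n => F n * F n := by fun_prop
  rw [integral_eq_zero_iff_of_nonneg (fun n => mul_self_nonneg _) (continuous_sphere_integrable hFF),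
    hFF.ae_eq_iff_eq sphereMeasure continuous_zero] at h0
  have hn : r⁻¹ • x ∈ sphere (0 : E3) 1 := by
    simp [norm_smul, hx, abs_of_pos hr, hr.ne']
  have h1 := congrFun h0 ⟨r⁻¹ • x, hn⟩
  have h2 : F ⟨r⁻¹ • x, hn⟩ = f x := by
    simp [hF, smul_smul, hr.ne']
  simpa [h2] using h1

/-! ### Orthonormal bases of spherical harmonics -/

/-- The space of smooth homogeneous functions of degree `l`. -/
def homogSubmodule (l : ℕ) : Submodule ℝ (E3 → ℝ) where
  carrier := {f | IsHomog l f}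
  add_mem' ha hb := ha.add hb
  zero_mem' := IsHomog.zero l
  smul_mem' c _ hf := hf.const_mul c

/-- The space of solid harmonics of degree `l`. -/
def solidSubmodule (l : ℕ) : Submodule ℝ (E3 → ℝ) where
  carrier := {f | IsSolidHarmonic l f}
  add_mem' {a b} ha hb := by
    have h := ha.isHomog.add hb.isHomog
    refine ⟨h.smooth, fun x => ?_, h.homogeneous⟩
    have := laplacian_add' ha.isHomog.contDiff_two hb.isHomog.contDiff_two x
    rw [ha.harmonic, hb.harmonic, add_zero] at this
    exact this
  zero_mem' := ⟨contDiff_const, fun x => (IsHomog.zero 0).laplacian_eq_zero (by norm_num) x,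
    (IsHomog.zero l).homogeneous⟩
  smul_mem' c f hf := by
    have h := hf.isHomog.const_mul c
    refine ⟨h.smooth, fun x => ?_, h.homogeneous⟩
    have := laplacian_const_mul' c hf.isHomog.contDiff_two x
    rw [hf.harmonic, mul_zero] at this
    exact this

/-- By Euler's identity a homogeneous function of positive degree is determined by its partial
derivatives, so degree l + 1 embeds into three copies of degree l. Degree 0 consists of constants.
-/
lemma homogSubmodule_finite (l : ℕ) : Module.Finite ℝ (homogSubmodule l) := by
  induction l with
  | zero =>
    let T : homogSubmodule 0 →ₗ[ℝ] ℝ :=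
      { toFun := fun f => f.1 0, map_add' := fun _ _ => rfl, map_smul' := fun _ _ => rfl }
    refine Module.Finite.of_injective T fun f g hfg => ?_
    ext x
    have hf : IsHomog 0 f.1 := f.2
    have hg : IsHomog 0 g.1 := g.2
    rw [hf.const_of_zero x, hg.const_of_zero x]
    exact hfg
  | succ l ih =>
    let T : homogSubmodule (l + 1) →ₗ[ℝ] (Fin 3 → homogSubmodule l) :=
      { toFun := fun f i => ⟨fun x => fderiv ℝ f.1 x (unitVec i), IsHomog.fderiv_apply f.2 _⟩
        map_add' := fun f g => by
          ext i x
          have hf : IsHomog (l + 1) f.1 := f.2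
          have hg : IsHomog (l + 1) g.1 := g.2
          simp [fderiv_add (hf.differentiable x) (hg.differentiable x)]
        map_smul' := fun c f => by
          ext i x
          have hf : IsHomog (l + 1) f.1 := f.2
          simp [fderiv_const_smul (hf.differentiable x)] }
    refine Module.Finite.of_injective T fun f g hfg => ?_
    have hf : IsHomog (l + 1) f.1 := f.2
    have hg : IsHomog (l + 1) g.1 := g.2
    ext x
    have e : ∇ f.1 x = ∇ g.1 x := by
      ext i
      rw [gradient_coord, gradient_coord]
      exact congrFun (congrArg Subtype.val (congrFun hfg i)) x
    have h1 := hf.euler x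
    rw [e, hg.euler x] at h1
    exact (mul_left_cancel₀ (by positivity) h1).symm

instance solidSubmodule_finite (l : ℕ) : Module.Finite ℝ (solidSubmodule l) := by
  have := homogSubmodule_finite l
  exact Submodule.finiteDimensional_of_le (S₂ := homogSubmodule l) fun f hf =>
    IsSolidHarmonic.isHomog hf

/-- Orthonormal bases of the spaces of spherical harmonics. -/
lemma exists_harmonic_basis (l : ℕ) : ∃ (d : ℕ) (Y : Fin d → E3 → ℝ),
    (∀ i, IsSolidHarmonic l (Y i)) ∧
    (∀ i j, ∫ n : sphere (0 : E3) 1, Y i n * Y j n ∂sphereMeasure = if i = j then 1 else 0) ∧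
    ∀ G, IsSolidHarmonic l G → ∀ x,
      G x = ∑ i, (∫ n : sphere (0 : E3) 1, Y i n * G n ∂sphereMeasure) * Y i x := by
  let ρ : solidSubmodule l →ₗ[ℝ] C(sphere (0 : E3) 1, ℝ) :=
    { toFun := fun f => ⟨fun n => f.1 n, f.2.smooth.continuous.comp continuous_subtype_val⟩
      map_add' := fun _ _ => rfl
      map_smul' := fun _ _ => rfl }
  let T : solidSubmodule l →ₗ[ℝ] Lp ℝ 2 sphereMeasure :=
    (ContinuousMap.toLp 2 sphereMeasure ℝ).toLinearMap ∘ₗ ρ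
  have hT : ∀ f g : solidSubmodule l, ⟪T f, T g⟫ = ∫ n : sphere (0 : E3) 1, f.1 n * g.1 n ∂sphereMeasure := by
    intro f g
    have := ContinuousMap.inner_toLp (𝕜 := ℝ) sphereMeasure (ρ f) (ρ g)
    rw [show ⟪T f, T g⟫ = _ from this]
    congr 1; ext n
    simp [ρ, mul_comm]
  -- Off the origin homogeneity recovers the function from its restriction to the sphere; the origin
  -- is treated separately according to whether the degree is zero.
  have hρ : Function.Injective ρ := by
    intro f g hfg
    ext x
    by_cases hx : x = 0
    · subst hx
      by_cases hl : l = 0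
      · subst hl
        have hn : ∃ n : E3, n ∈ sphere (0 : E3) 1 := ⟨unitVec 0, by simp⟩
        obtain ⟨n, hn⟩ := hn
        have := congrArg (fun F : C(sphere (0 : E3) 1, ℝ) => F ⟨n, hn⟩) hfg
        have hf := f.2.isHomog.const_of_zero n
        have hg := g.2.isHomog.const_of_zero n
        rw [← hf, ← hg]; exact this
      · have hf := f.2.homogeneous 0 0
        have hg := g.2.homogeneous 0 0
        simp only [zero_smul, zero_pow hl, zero_mul] at hf hg
        rw [hf, hg]
    · have hx' : ‖x‖ ≠ 0 := norm_ne_zero_iff.2 hx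
      have hn : ‖x‖⁻¹ • x ∈ sphere (0 : E3) 1 := by simp [norm_smul, hx']
      have h1 : f.1 (‖x‖⁻¹ • x) = g.1 (‖x‖⁻¹ • x) :=
        congrArg (fun F : C(sphere (0 : E3) 1, ℝ) => F ⟨_, hn⟩) hfg
      rw [f.2.homogeneous, g.2.homogeneous] at h1
      exact mul_left_cancel₀ (pow_ne_zero _ (inv_ne_zero hx')) h1
  have hTi : Function.Injective T := (ContinuousMap.toLp_injective sphereMeasure).comp hρ
  -- The solid harmonics embed in L² of the sphere. An orthonormal basis of the finite-dimensional
  -- image is pulled back, and its expansion formula then holds on the whole space by injectivity.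
  let b := stdOrthonormalBasis ℝ (LinearMap.range T)
  choose Y hY using fun i => (b i).2
  refine ⟨_, fun i => (Y i).1, fun i => (Y i).2, fun i j => ?_, fun G hG x => ?_⟩
  · rw [← hT, hY, hY, ← Submodule.coe_inner]
    exact orthonormal_iff_ite.1 b.orthonormal i j
  · let g : solidSubmodule l := ⟨G, hG⟩
    have h1 : g = ∑ i, (∫ n : sphere (0 : E3) 1, (Y i).1 n * G n ∂sphereMeasure) • Y i := by
      apply hTi
      have h2 := congrArg Subtype.val (b.sum_repr' ⟨T g, LinearMap.mem_range_self T g⟩)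
      rw [map_sum]
      simp only [map_smul, hY]
      rw [← show _ = T g from h2]
      simp only [Submodule.coe_sum, Submodule.coe_smul, Submodule.coe_inner, ← hY]
      simp only [hT]
      rfl
    have h3 := congrArg (fun f : solidSubmodule l => f.1 x) h1
    simpa [Submodule.coe_sum, Finset.sum_apply] using h3

/-! ### Completeness of vector spherical harmonics -/

lemma angular_congr {f g : E3 → ℝ} (h : ∀ x, ‖x‖ = 1 → f x = g x) {x : E3} (hx : x ≠ 0) :
    angular f x = angular g x :=
  h _ (by simp [norm_smul, hx])

lemma angular_eventuallyEq {f g : E3 → ℝ} (h : ∀ x, ‖x‖ = 1 → f x = g x) {x : E3} (hx : x ≠ 0) :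
    angular f =ᶠ[𝓝 x] angular g := by
  filter_upwards [isOpen_compl_singleton.mem_nhds hx] with z hz using angular_congr h hz

lemma sphere_ne_zero (n : sphere (0 : E3) 1) : (n : E3) ≠ 0 :=
  norm_ne_zero_iff.1 (by rw [norm_sphere]; exact one_ne_zero)

/-- The span of the vector spherical harmonics of degree at most `N`. -/
def vectorSpan (N : ℕ) : Submodule ℝ (sphere (0 : E3) 1 → E3) :=
  Submodule.span ℝ {X | ∃ l ≤ N, ∃ H, IsSolidHarmonic l H ∧
    ((X = fun n : sphere (0 : E3) 1 => H n • (n : E3)) ∨ (X = fun n : sphere (0 : E3) 1 => ∇ (angular H) n)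
      ∨ X = fun n : sphere (0 : E3) 1 => axialField H n)}

lemma vectorSpan_mono {M N : ℕ} (h : M ≤ N) : vectorSpan M ≤ vectorSpan N :=
  Submodule.span_mono fun _ ⟨l, hl, hH⟩ => ⟨l, hl.trans h, hH⟩

lemma angular_differentiableAt {f : E3 → ℝ} (hf : ContDiff ℝ ∞ f) {x : E3} (hx : x ≠ 0) :
    DifferentiableAt ℝ (angular f) x :=
  ((hf.comp_contDiffOn (unitRadial_contDiffOn (s := {0}ᶜ) fun _ h => h)).contDiffAt
    (isOpen_compl_singleton.mem_nhds hx)).differentiableAt (by simp)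

lemma gradient_add' {f g : E3 → ℝ} {x : E3} (hf : DifferentiableAt ℝ f x) (hg : DifferentiableAt ℝ g x) :
    ∇ (fun z => f z + g z) x = ∇ f x + ∇ g x := by
  refine ext_inner_right ℝ fun v => ?_
  rw [inner_add_left, inner_grad, inner_grad, inner_grad, fderiv_fun_add hf hg]
  rfl

lemma gradient_sub' {f g : E3 → ℝ} {x : E3} (hf : DifferentiableAt ℝ f x) (hg : DifferentiableAt ℝ g x) :
    ∇ (fun z => f z - g z) x = ∇ f x - ∇ g x := by
  refine ext_inner_right ℝ fun v => ?_
  rw [inner_sub_left, inner_grad, inner_grad, inner_grad, fderiv_fun_sub hf hg]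
  rfl

lemma gradient_const_mul' {f : E3 → ℝ} {x : E3} (c : ℝ) (hf : DifferentiableAt ℝ f x) :
    ∇ (fun z => c * f z) x = c • ∇ f x := by
  refine ext_inner_right ℝ fun v => ?_
  rw [real_inner_smul_left, inner_grad, inner_grad, fderiv_const_mul hf]
  rfl

lemma harmonicSpan_vectorSpan {N : ℕ} {q : E3 → ℝ} (hq : q ∈ harmonicSpan N) :
    (fun n : sphere (0 : E3) 1 => q n • (n : E3)) ∈ vectorSpan N ∧
    (fun n : sphere (0 : E3) 1 => ∇ (angular q) n) ∈ vectorSpan N ∧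
    (fun n : sphere (0 : E3) 1 => axialField q n) ∈ vectorSpan N := by
  induction hq using Submodule.span_induction with
  | mem q hq =>
    obtain ⟨l, hl, hH⟩ := hq
    exact ⟨Submodule.subset_span ⟨l, hl, q, hH, Or.inl rfl⟩,
      Submodule.subset_span ⟨l, hl, q, hH, Or.inr (Or.inl rfl)⟩,
      Submodule.subset_span ⟨l, hl, q, hH, Or.inr (Or.inr rfl)⟩⟩
  | zero =>
    have e : angular (0 : E3 → ℝ) = fun _ => 0 := rfl
    have e1 : (fun n : sphere (0 : E3) 1 => ∇ (angular (0 : E3 → ℝ)) n) = 0 := by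
      ext1 n; simp [e]
    have e2 : (fun n : sphere (0 : E3) 1 => axialField (0 : E3 → ℝ) n) = 0 := by
      ext1 n; simp [axialField, e, cross_zero_left]
    refine ⟨?_, ?_, ?_⟩
    · convert zero_mem (vectorSpan N) using 1; ext1 n; simp
    · rw [e1]; exact zero_mem _
    · rw [e2]; exact zero_mem _
  | add a b ha hb iha ihb =>
    have hab : ∀ n : sphere (0 : E3) 1, ∇ (angular (a + b)) n = ∇ (angular a) n + ∇ (angular b) n := fun n =>
      gradient_add' (angular_differentiableAt (harmonicSpan_contDiff ha) (sphere_ne_zero n))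
        (angular_differentiableAt (harmonicSpan_contDiff hb) (sphere_ne_zero n))
    refine ⟨?_, ?_, ?_⟩
    · convert add_mem iha.1 ihb.1 using 1; ext1 n; simp [add_smul]
    · convert add_mem iha.2.1 ihb.2.1 using 1; ext1 n; simp [hab]
    · convert add_mem iha.2.2 ihb.2.2 using 1; ext1 n; simp [axialField, hab, cross_add_left]
  | smul c a ha iha =>
    have hab : ∀ n : sphere (0 : E3) 1, ∇ (angular (c • a)) n = c • ∇ (angular a) n := fun n =>
      gradient_const_mul' c (angular_differentiableAt (harmonicSpan_contDiff ha) (sphere_ne_zero n))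
    refine ⟨?_, ?_, ?_⟩
    · convert Submodule.smul_mem _ c iha.1 using 1; ext1 n; simp [mul_smul]
    · convert Submodule.smul_mem _ c iha.2.1 using 1; ext1 n; simp [hab]
    · convert Submodule.smul_mem _ c iha.2.2 using 1; ext1 n; simp [axialField, hab, cross_smul_left]

/-- The angular part depends only on the values on the unit sphere, where f agrees with a sum of
solid harmonics near every direction. So the three fields built from any homogeneous f are vector
harmonics, although f need not be harmonic. -/
lemma IsHomog.mem_vectorSpan {l : ℕ} {f : E3 → ℝ} (hf : IsHomog l f) :
    (fun n : sphere (0 : E3) 1 => f n • (n : E3)) ∈ vectorSpan l ∧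
    (fun n : sphere (0 : E3) 1 => ∇ (angular f) n) ∈ vectorSpan l ∧
    (fun n : sphere (0 : E3) 1 => axialField f n) ∈ vectorSpan l := by
  obtain ⟨q, hq, hqe⟩ := hf.exists_harmonicSpan
  have h := harmonicSpan_vectorSpan hq
  have e : ∀ n : sphere (0 : E3) 1, ∇ (angular f) n = ∇ (angular q) n := fun n =>
    (angular_eventuallyEq hqe (sphere_ne_zero n)).gradient_eq
  refine ⟨?_, ?_, ?_⟩
  · convert h.1 using 3 with n; exact hqe _ (norm_sphere n)
  · convert h.2.1 using 2 with n; exact e n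
  · convert h.2.2 using 2 with n; simp only [axialField, e n]

/-- Pure linear algebra, to be applied to the Hessian of a solid harmonic: symmetry is that of
second derivatives, and zero trace is harmonicity. -/
lemma cross_symm_traceless {M : E3 →L[ℝ] E3} (hs : ∀ a b, ⟪M a, b⟫ = ⟪M b, a⟫)
    (ht : ∑ i, (M (unitVec i)) i = 0) (e x : E3) :
    cross (M (cross e x)) x = ⟪M x, x⟫ • e - ⟪e, x⟫ • M x - ⟪M x, e⟫ • x + ‖x‖ ^ 2 • M e := by
  have hM : ∀ v, M v = v 0 • M (unitVec 0) + v 1 • M (unitVec 1) + v 2 • M (unitVec 2) := by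
    intro v
    conv_lhs => rw [coord_sum v]
    simp only [map_add, map_smul]
  have s01 := hs (unitVec 0) (unitVec 1)
  have s02 := hs (unitVec 0) (unitVec 2)
  have s12 := hs (unitVec 1) (unitVec 2)
  simp only [inner_unitVec] at s01 s02 s12
  rw [Fin.sum_univ_three] at ht
  have h22 : (M (unitVec 2)) 2 = - (M (unitVec 0)) 0 - (M (unitVec 1)) 1 := by linarith
  rw [hM (cross e x), hM x, hM e, normSq_E3]
  ext i
  fin_cases i <;>
  simp only [Fin.zero_eta, Fin.mk_one, Fin.reduceFinMk, cross_zero, cross_one, cross_two, inner_E3,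
    PiLp.add_apply, PiLp.sub_apply, PiLp.smul_apply, smul_eq_mul, s01, s02, s12, h22] <;> ring

lemma hasFDerivAt_cross_const {u : E3 → E3} {u' : E3 →L[ℝ] E3} {x : E3} (hu : HasFDerivAt u u' x) (e : E3) :
    DifferentiableAt ℝ (fun z => cross (u z) e) x ∧ ∀ v, fderiv ℝ (fun z => cross (u z) e) x v = cross (u' v) e := by
  have hd := differentiableAt_cross hu.differentiableAt (differentiableAt_const e)
  refine ⟨hd, fun v => ?_⟩
  have hc : ∀ i, HasFDerivAt (fun z => (u z) i)
      ((EuclideanSpace.proj i : E3 →L[ℝ] ℝ).comp u') x := fun i =>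
    ((EuclideanSpace.proj i : E3 →L[ℝ] ℝ).hasFDerivAt).comp x hu
  ext i
  rw [← fderiv_coord hd]
  fin_cases i
  · simp only [Fin.zero_eta, cross_zero]
    rw [(((hc 1).mul_const (e 2)).fun_sub ((hc 2).mul_const (e 1))).fderiv]; simp; ring
  · simp only [Fin.mk_one, cross_one]
    rw [(((hc 2).mul_const (e 0)).fun_sub ((hc 0).mul_const (e 2))).fderiv]; simp; ring
  · simp only [Fin.reduceFinMk, cross_two]
    rw [(((hc 0).mul_const (e 1)).fun_sub ((hc 1).mul_const (e 0))).fderiv]; simp; ring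

/-- The decomposition of the vector field `H e`, with `H` a solid harmonic and `e` a constant vector, into
vector spherical harmonics. -/
lemma IsSolidHarmonic.smul_const_decomposition {k : ℕ} {H : E3 → ℝ} (h : IsSolidHarmonic (k + 1) H)
    (e x : E3) :
    ((k + 1 : ℝ) * (k + 2) * H x) • e = (k + 1 : ℝ) • ∇ (fun z => ⟪e, z⟫ * H z) x
      + cross (∇ (fun z => ⟪cross (∇ H z) e, z⟫) x) x + (k * fderiv ℝ H x e) • x
      - ‖x‖ ^ 2 • ∇ (fun z => fderiv ℝ H z e) x := by
  have hc := h.isHomog.contDiff_two.contDiffAt (x := x)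
  have hg := gradient_differentiableAt hc
  set M := fderiv ℝ (∇ H) x with hM
  have hs : ∀ a b, ⟪M a, b⟫ = ⟪M b, a⟫ := gradient_comp_symm hc
  have ht : ∑ i, (M (unitVec i)) i = 0 := by
    rw [← h.harmonic x, laplacian_eq_divergence hc]; rfl
  have hD : ∇ (fun z => fderiv ℝ H z e) x = M e := by
    refine ext_inner_right ℝ fun v => ?_
    rw [inner_grad, hs e v, inner_fderiv_gradient hc, fderiv_clm_apply
      ((hc.fderiv_right (m := 1) (by norm_num)).differentiableAt one_ne_zero) (differentiableAt_const _)]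
    simp
  have hC : ∇ (fun z => ⟪e, z⟫ * H z) x = ⟪e, x⟫ • ∇ H x + H x • e := by
    rw [gradient_mul ((isHomog_inner e).differentiable x) (h.isHomog.differentiable x)]
    congr 2
    refine ext_inner_right ℝ fun v => ?_
    rw [inner_grad, fderiv_inner_apply ℝ (differentiableAt_const _) differentiableAt_fun_id]
    simp
  have hZ : ∇ (fun z => ⟪cross (∇ H z) e, z⟫) x = M (cross e x) + cross (∇ H x) e := by
    obtain ⟨d1, d2⟩ := hasFDerivAt_cross_const hg.hasFDerivAt e
    refine ext_inner_right ℝ fun v => ?_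
    rw [inner_grad, fderiv_inner_apply ℝ d1 differentiableAt_fun_id, d2, inner_add_left, hs (cross e x) v]
    simp only [inner_E3, cross_zero, cross_one, cross_two]
    simp
    ring
  -- Euler's identity for the partial derivatives, which are homogeneous of degree k.
  have hMx : M x = (k : ℝ) • ∇ H x := by
    refine ext_inner_right ℝ fun v => ?_
    rw [hs x v, real_inner_smul_left, inner_grad]
    have := (h.isHomog.fderiv_apply v).euler x
    rw [inner_grad, fderiv_clm_apply
      ((hc.fderiv_right (m := 1) (by norm_num)).differentiableAt one_ne_zero) (differentiableAt_const _)] at this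
    rw [hs v x, inner_fderiv_gradient hc]
    simpa using this
  have hE := h.isHomog.euler x
  have key := cross_symm_traceless hs ht e x
  rw [hC, hZ, hD, cross_add_left, key, hMx, real_inner_smul_left, real_inner_smul_left, hE,
    ← inner_grad]
  have hcc : cross (cross (∇ H x) e) x = ⟪∇ H x, x⟫ • e - ⟪e, x⟫ • ∇ H x := by
    ext i
    fin_cases i <;>
    simp only [Fin.zero_eta, Fin.mk_one, Fin.reduceFinMk, cross_zero, cross_one, cross_two, inner_E3,
      PiLp.sub_apply, PiLp.smul_apply, smul_eq_mul] <;> ring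
  rw [hcc, hE]
  push_cast
  module

lemma IsHomog.gradient_sphere {l : ℕ} {f : E3 → ℝ} (hf : IsHomog l f) (n : sphere (0 : E3) 1) :
    ∇ f n = ∇ (angular f) n + (l * f n) • (n : E3) := by
  rw [hf.gradient_angular (sphere_ne_zero n), norm_sphere]
  simp

/-- This is the passage from scalar to vector density: approximating a field componentwise uses
products of harmonics with constant vectors, and these are finite sums of vector harmonics. -/
lemma IsSolidHarmonic.smul_const_mem_vectorSpan {k : ℕ} {H : E3 → ℝ} (h : IsSolidHarmonic k H) (e : E3) :
    (fun n : sphere (0 : E3) 1 => H n • e) ∈ vectorSpan (k + 1) := by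
  have hC : IsHomog (k + 1) (fun z => ⟪e, z⟫ * H z) := by
    have := (isHomog_inner e).mul h.isHomog
    rwa [add_comm] at this
  cases k with
  | zero =>
    convert add_mem hC.mem_vectorSpan.2.1 hC.mem_vectorSpan.1 using 1
    ext1 n
    have := hC.gradient_sphere n
    simp only [Nat.zero_add, Nat.cast_one, one_mul] at this
    simp only [Pi.add_apply]
    rw [← this, gradient_mul ((isHomog_inner e).differentiable _) (h.isHomog.differentiable _)]
    have e1 : ∇ H (n : E3) = 0 := by
      refine ext_inner_right ℝ fun v => ?_
      rw [inner_grad, h.isHomog.fderiv_zero, inner_zero_left]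
    have e2 : ∇ (fun z => ⟪e, z⟫) (n : E3) = e := by
      refine ext_inner_right ℝ fun v => ?_
      rw [inner_grad, fderiv_inner_apply ℝ (differentiableAt_const _) differentiableAt_fun_id]
      simp
    rw [e1, e2, smul_zero, zero_add]
  | succ k =>
    have hD := h.isHomog.fderiv_apply e
    have hZ : IsHomog (k + 1) (fun z => ⟪cross (∇ H z) e, z⟫) := by
      have e1 : (fun z => ⟪cross (∇ H z) e, z⟫) = fun z =>
          ((⟪unitVec 0, z⟫ * (e 2 * fderiv ℝ H z (unitVec 1) - e 1 * fderiv ℝ H z (unitVec 2)))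
          + (⟪unitVec 1, z⟫ * (e 0 * fderiv ℝ H z (unitVec 2) - e 2 * fderiv ℝ H z (unitVec 0))))
          + (⟪unitVec 2, z⟫ * (e 1 * fderiv ℝ H z (unitVec 0) - e 0 * fderiv ℝ H z (unitVec 1))) := by
        ext z
        rw [inner_E3 (cross (∇ H z) e), cross_zero, cross_one, cross_two, real_inner_comm, inner_unitVec,
          real_inner_comm, inner_unitVec, real_inner_comm, inner_unitVec]
        simp only [gradient_coord]
        ring
      rw [e1, add_comm k 1]
      have d := fun i => h.isHomog.fderiv_apply (unitVec i)
      exact ((((isHomog_inner _).mul (((d 1).const_mul _).sub ((d 2).const_mul _))).add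
        ((isHomog_inner _).mul (((d 2).const_mul _).sub ((d 0).const_mul _)))).add
        ((isHomog_inner _).mul (((d 0).const_mul _).sub ((d 1).const_mul _))))
    -- On the sphere the gradients in the decomposition split into angular gradient and radial part.
    -- The radial part of ∇(⟨e, z⟩ H), of degree k + 2, leaves the coefficient (k+1)(k+2); that of
    -- the derivative of H along e cancels the explicit radial term; the one under the vector
    -- product with x drops out.
    have hm := Submodule.smul_mem _ (((k + 1 : ℝ) * (k + 2))⁻¹)
      (sub_mem (add_mem (add_mem (Submodule.smul_mem _ (k + 1 : ℝ) hC.mem_vectorSpan.2.1)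
        (Submodule.smul_mem _ ((k + 1 : ℝ) * (k + 2)) hC.mem_vectorSpan.1))
        (vectorSpan_mono (by omega) hZ.mem_vectorSpan.2.2))
        (vectorSpan_mono (by omega) hD.mem_vectorSpan.2.1))
    convert hm using 1
    ext1 n
    have key := h.smul_const_decomposition e n
    have hpos : ((k + 1 : ℝ) * (k + 2)) ≠ 0 := by positivity
    simp only [Pi.smul_apply, Pi.sub_apply, Pi.add_apply]
    rw [hC.gradient_sphere, hZ.gradient_sphere, hD.gradient_sphere, cross_add_left, cross_smul_left,
      cross_self', norm_sphere] at key
    rw [eq_inv_smul_iff₀ hpos, smul_smul, key]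
    simp only [axialField, norm_sphere, inv_one, one_smul]
    push_cast
    module

/-- Vector spherical harmonics are dense in the continuous vector fields on the sphere. -/
lemma exists_vectorSpan_approx {v : sphere (0 : E3) 1 → E3} (hv : Continuous v) {ε : ℝ} (hε : 0 < ε) :
    ∃ N, ∃ p ∈ vectorSpan N, ∀ n, ‖v n - p n‖ ≤ ε := by
  have hcomp : ∀ i : Fin 3, ∃ N, ∃ q : E3 → ℝ, (fun n : sphere (0 : E3) 1 => q n • unitVec i) ∈ vectorSpan N ∧
      ∀ n : sphere (0 : E3) 1, |v n i - q n| < ε / 3 := by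
    intro i
    obtain ⟨N, q, hq, hqe⟩ := exists_harmonicSpan_approx ⟨fun n => v n i, by fun_prop⟩
      (show 0 < ε / 3 by positivity)
    refine ⟨N + 1, q, ?_, hqe⟩
    clear hqe
    induction hq using Submodule.span_induction with
    | mem q hq =>
      obtain ⟨l, hl, hH⟩ := hq
      exact vectorSpan_mono (by omega) (hH.smul_const_mem_vectorSpan _)
    | zero => convert zero_mem (vectorSpan (N + 1)) using 1; ext1 n; simp
    | add a b _ _ ha hb => convert add_mem ha hb using 1; ext1 n; simp [add_smul]
    | smul c a _ ha => convert Submodule.smul_mem _ c ha using 1; ext1 n; simp [mul_smul]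
  choose N q hq hqe using hcomp
  refine ⟨max (max (N 0) (N 1)) (N 2), _, add_mem (add_mem
    (vectorSpan_mono ((le_max_left _ _).trans (le_max_left _ _)) (hq 0))
    (vectorSpan_mono ((le_max_right _ _).trans (le_max_left _ _)) (hq 1)))
    (vectorSpan_mono (le_max_right _ _) (hq 2)), fun n => ?_⟩
  simp only [Pi.add_apply]
  have e : v n - (q 0 n • unitVec 0 + q 1 n • unitVec 1 + q 2 n • unitVec 2)
      = (v n 0 - q 0 n) • unitVec 0 + (v n 1 - q 1 n) • unitVec 1 + (v n 2 - q 2 n) • unitVec 2 := by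
    conv_lhs => rw [coord_sum (v n)]
    module
  rw [e]
  have hn : ∀ i, ‖(v n i - q i n) • unitVec i‖ ≤ ε / 3 := fun i => by
    have : ‖unitVec i‖ = 1 := by simp
    rw [norm_smul, this, mul_one]; exact (hqe i n).le
  calc _ ≤ ‖(v n 0 - q 0 n) • unitVec 0‖ + ‖(v n 1 - q 1 n) • unitVec 1‖
        + ‖(v n 2 - q 2 n) • unitVec 2‖ := norm_add₃_le
    _ ≤ ε := by linarith [hn 0, hn 1, hn 2]

/-! ### The radial equation -/

lemma eq_of_hasDerivAt_zero {s : Set ℝ} (hs : IsOpen s) (hc : Convex ℝ s) {f : ℝ → ℝ}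
    (hf : ∀ x ∈ s, HasDerivAt f 0 x) {x y : ℝ} (hx : x ∈ s) (hy : y ∈ s) : f x = f y :=
  hs.is_const_of_deriv_eq_zero hc.isPreconnected
    (fun z hz => (hf z hz).differentiableAt.differentiableWithinAt) (fun z hz => (hf z hz).deriv) hx hy

/-- Decaying solutions of the radial Laplace equation are multiples of `r ^ (-l - 1)`. -/
lemma radial_laplace_decay {R : ℝ} (hR : 0 < R) {l : ℕ} {f k : ℝ → ℝ}
    (hf : ∀ r ∈ Ioi R, HasDerivAt f (k r) r)
    (hk : ∀ r ∈ Ioi R, HasDerivAt k (l * (l + 1) / r ^ 2 * f r - 2 / r * k r) r)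
    (hinf : Tendsto f atTop (𝓝 0)) :
    (∀ r ∈ Ioi R, r * k r = -(l + 1) * f r) ∧ ∃ A, ∀ r ∈ Ioi R, r ^ (l + 1) * f r = A := by
  have hpos : ∀ r ∈ Ioi R, 0 < r := fun r hr => hR.trans hr
  -- The general solution combines r^l and r^(-l-1); this first integral measures the coefficient of
  -- the growing one.
  have hP : ∀ r ∈ Ioi R, HasDerivAt (fun r => (r * k r + (l + 1) * f r) / r ^ l) 0 r := by
    intro r hr
    have hr0 := hpos r hr
    have h := (((hasDerivAt_id r).fun_mul (hk r hr)).fun_add ((hf r hr).const_mul ((l : ℝ) + 1))).fun_div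
      (hasDerivAt_pow l r) (pow_ne_zero _ hr0.ne')
    refine h.congr_deriv ?_
    cases l with
    | zero => simp; field_simp; ring
    | succ m => simp only [id, Nat.add_sub_cancel]; field_simp; push_cast; ring
  obtain ⟨C, hC⟩ : ∃ C, ∀ r ∈ Ioi R, r * k r + (l + 1) * f r = C * r ^ l := by
    refine ⟨((R + 1) * k (R + 1) + (l + 1) * f (R + 1)) / (R + 1) ^ l, fun r hr => ?_⟩
    have := eq_of_hasDerivAt_zero isOpen_Ioi (convex_Ioi R) hP hr (show R + 1 ∈ Ioi R by simp)
    rw [div_eq_iff (pow_ne_zero _ (hpos r hr).ne')] at this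
    exact this
  have hF : ∀ r ∈ Ioi R, HasDerivAt (fun r => r ^ (l + 1) * f r - C / (2 * l + 1) * r ^ (2 * l + 1)) 0 r := by
    intro r hr
    have h := ((hasDerivAt_pow (l + 1) r).fun_mul (hf r hr)).fun_sub
      ((hasDerivAt_pow (2 * l + 1) r).const_mul (C / (2 * l + 1)))
    refine h.congr_deriv ?_
    have h2 : (2 * (l : ℝ) + 1) ≠ 0 := by positivity
    simp only [Nat.add_sub_cancel]
    push_cast
    field_simp
    have := hC r hr
    linear_combination r ^ l * this
  obtain ⟨A, hA⟩ : ∃ A, ∀ r ∈ Ioi R, r ^ (l + 1) * f r - C / (2 * l + 1) * r ^ (2 * l + 1) = A :=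
    ⟨_, fun r hr => eq_of_hasDerivAt_zero isOpen_Ioi (convex_Ioi R) hF hr (show R + 1 ∈ Ioi R by simp)⟩
  -- After division by r^(2l+1) the integrated relation tends to C/(2l+1) on one side, and to 0 on
  -- the other because f decays.
  have hC0 : C = 0 := by
    have hinv : Tendsto (fun r : ℝ => r⁻¹) atTop (𝓝 0) := tendsto_inv_atTop_zero
    have t1 : Tendsto (fun r => (r⁻¹) ^ l * f r) atTop (𝓝 ((0 : ℝ) ^ l * 0)) := (hinv.pow l).mul hinf
    have t2 : Tendsto (fun r => A * (r⁻¹) ^ (2 * l + 1) + C / (2 * l + 1)) atTop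
        (𝓝 (A * (0 : ℝ) ^ (2 * l + 1) + C / (2 * l + 1))) :=
      ((hinv.pow _).const_mul A).add_const _
    have e : (fun r => (r⁻¹) ^ l * f r) =ᶠ[atTop] fun r => A * (r⁻¹) ^ (2 * l + 1) + C / (2 * l + 1) := by
      filter_upwards [Ioi_mem_atTop R] with r hr
      have hr0 := (hpos r hr).ne'
      have h2 : (2 * (l : ℝ) + 1) ≠ 0 := by positivity
      rw [← hA r hr, inv_pow, inv_pow]
      field_simp
      ring
    have := tendsto_nhds_unique (t1.congr' e) t2
    have h2 : (2 * (l : ℝ) + 1) ≠ 0 := by positivity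
    simp only [mul_zero, ne_eq, Nat.add_eq_zero_iff, one_ne_zero, and_false, not_false_eq_true, zero_pow,
      zero_add] at this
    exact ((div_eq_zero_iff.1 this.symm).resolve_right h2)
  refine ⟨fun r hr => ?_, A, fun r hr => ?_⟩
  · have := hC r hr
    rw [hC0] at this
    linarith
  · have := hA r hr
    rw [hC0] at this
    simpa using this

/-- A nonradial solution of the radial equation of the perturbed potential is a multiple of the
gravity, and vanishes unless `l = 1`. -/
lemma radial_rigidity {R : ℝ} (hR : 0 < R) {l : ℕ} (hl : 1 ≤ l) {f k g ρ ρ' s : ℝ → ℝ}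
    {kin kout ρR : ℝ}
    (hf : ∀ r ∈ Ioo 0 R, HasDerivAt f (k r) r)
    (hk : ∀ r ∈ Ioo 0 R, HasDerivAt k (s r + l * (l + 1) / r ^ 2 * f r - 2 / r * k r) r)
    (hg : ∀ r ∈ Ioo 0 R, HasDerivAt g (4 * Real.pi * ρ r - 2 / r * g r) r)
    (hρ : ∀ r ∈ Ioo 0 R, HasDerivAt ρ (ρ' r) r)
    (hs : ∀ r ∈ Ioo 0 R, s r * g r = 4 * Real.pi * ρ' r * f r)
    (hf' : ∀ r ∈ Ioi R, HasDerivAt f (k r) r)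
    (hk' : ∀ r ∈ Ioi R, HasDerivAt k (l * (l + 1) / r ^ 2 * f r - 2 / r * k r) r)
    (hg' : ∀ r ∈ Ioi R, HasDerivAt g (-(2 / r * g r)) r)
    (hgpos : ∀ r ∈ Ioi 0, 0 < g r) (hfc : ContinuousAt f R) (hgc : ContinuousAt g R)
    (hinf : Tendsto f atTop (𝓝 0))
    (hE0 : Tendsto (fun r => (r ^ 2 * k r * g r - f r * (4 * Real.pi * r ^ 2 * ρ r - 2 * r * g r)) * (f r / g r))
      (𝓝[>] 0) (𝓝 0))
    (hkin : Tendsto k (𝓝[<] R) (𝓝 kin)) (hkout : Tendsto k (𝓝[>] R) (𝓝 kout))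
    (hρR : Tendsto ρ (𝓝[<] R) (𝓝 ρR))
    (hjump : (kout - kin) * g R = -(4 * Real.pi * ρR * f R)) :
    ∃ c, (∀ r ∈ Ioi 0, f r = c * g r) ∧ (2 ≤ l → c = 0) := by
  obtain ⟨hkf, A, hA⟩ := radial_laplace_decay hR hf' hk' hinf
  have hgR := hgpos R hR
  have hl1 : (1 : ℝ) ≤ l := by exact_mod_cast hl
  -- This is the weighted Wronskian r² g² (f/g)', with g' eliminated by its own equation, so that w
  -- contains ρ but neither g' nor ρ'.
  set w : ℝ → ℝ := fun r => r ^ 2 * k r * g r - f r * (4 * Real.pi * r ^ 2 * ρ r - 2 * r * g r) with hw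
  have hq : ∀ r ∈ Ioo 0 R, HasDerivAt (fun r => f r / g r) (w r / (r ^ 2 * g r ^ 2)) r := by
    intro r hr
    have hr0 := hr.1.ne'
    have hg0 := (hgpos r hr.1).ne'
    refine ((hf r hr).fun_div (hg r hr) hg0).congr_deriv ?_
    simp only [hw]
    field_simp
  -- Gravity solves the equation of f for l = 1: the terms with ρ' cancel through the relation for
  -- the source s, and only the difference of the eigenvalues l(l+1) and 2 is left.
  have hwd : ∀ r ∈ Ioo 0 R, HasDerivAt w ((l * (l + 1) - 2) * f r * g r) r := by
    intro r hr
    have hr0 := hr.1.ne'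
    have h := ((((hasDerivAt_pow 2 r).fun_mul (hk r hr)).fun_mul (hg r hr))).fun_sub ((hf r hr).fun_mul
      ((((hasDerivAt_pow 2 r).const_mul (4 * Real.pi)).fun_mul (hρ r hr)).fun_sub
        (((hasDerivAt_id r).const_mul 2).fun_mul (hg r hr))))
    refine h.congr_deriv ?_
    have := hs r hr
    simp only [id]
    field_simp
    push_cast
    linear_combination r ^ 2 * this
  -- The derivative of the energy w f/g is a sum of nonnegative terms since l(l+1) ≥ 2. Monotonicity
  -- together with the two boundary limits forces the energy to vanish.
  have hE : ∀ r ∈ Ioo 0 R, HasDerivAt (fun r => w r * (f r / g r))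
      ((l * (l + 1) - 2) * f r ^ 2 + w r ^ 2 / (r ^ 2 * g r ^ 2)) r := by
    intro r hr
    have hr0 := hr.1.ne'
    have hg0 := (hgpos r hr.1).ne'
    refine ((hwd r hr).fun_mul (hq r hr)).congr_deriv ?_
    field_simp
  have hlam : (0 : ℝ) ≤ l * (l + 1) - 2 := by nlinarith
  have hmono : MonotoneOn (fun r => w r * (f r / g r)) (Ioo 0 R) := by
    refine monotoneOn_of_deriv_nonneg (convex_Ioo 0 R)
      (fun r hr => (hE r hr).continuousAt.continuousWithinAt) ?_ ?_
    · rw [interior_Ioo]; exact fun r hr => (hE r hr).differentiableAt.differentiableWithinAt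
    · rw [interior_Ioo]
      intro r hr
      rw [(hE r hr).deriv]
      positivity
  have hnn : ∀ r ∈ Ioo 0 R, 0 ≤ w r * (f r / g r) := by
    intro r hr
    refine le_of_tendsto hE0 ?_
    filter_upwards [Ioo_mem_nhdsGT hr.1] with t ht
    exact hmono ⟨ht.1, ht.2.trans hr.2⟩ hr ht.2.le
  have tin : Tendsto (fun r => w r * (f r / g r)) (𝓝[<] R)
      (𝓝 ((R ^ 2 * kin * g R - f R * (4 * Real.pi * R ^ 2 * ρR - 2 * R * g R)) * (f R / g R))) := by
    have tr : Tendsto (fun r : ℝ => r) (𝓝[<] R) (𝓝 R) := tendsto_id.mono_left nhdsWithin_le_nhds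
    have tf : Tendsto f (𝓝[<] R) (𝓝 (f R)) := hfc.tendsto.mono_left nhdsWithin_le_nhds
    have tg : Tendsto g (𝓝[<] R) (𝓝 (g R)) := hgc.tendsto.mono_left nhdsWithin_le_nhds
    exact ((((tr.pow 2).mul hkin).mul tg).sub (tf.mul ((((tr.pow 2).const_mul (4 * Real.pi)).mul hρR).sub
      ((tr.const_mul 2).mul tg)))).mul (tf.div tg hgR.ne')
  have tout1 : Tendsto (fun r => r * k r) (𝓝[>] R) (𝓝 (R * kout)) :=
    (tendsto_id.mono_left nhdsWithin_le_nhds).mul hkout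
  have tout2 : Tendsto (fun r => r * k r) (𝓝[>] R) (𝓝 (-(l + 1) * f R)) := by
    have : Tendsto (fun r => -((l : ℝ) + 1) * f r) (𝓝[>] R) (𝓝 (-(l + 1) * f R)) :=
      (hfc.tendsto.mono_left nhdsWithin_le_nhds).const_mul _
    refine this.congr' ?_
    filter_upwards [self_mem_nhdsWithin] with r hr using (hkf r hr).symm
  have hko : R * kout = -(l + 1) * f R := tendsto_nhds_unique tout1 tout2
  -- The exterior solution gives R k_out = -(l+1) f(R). In passing to k_in the jump absorbs exactly
  -- the term with the surface density, so the limit is (1 - l) R f(R)², nonpositive for l ≥ 1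
  -- whether or not the density vanishes at the surface.
  have hlim : (R ^ 2 * kin * g R - f R * (4 * Real.pi * R ^ 2 * ρR - 2 * R * g R)) * (f R / g R)
      = (1 - l) * R * f R ^ 2 := by
    obtain ⟨u, hu⟩ : ∃ u, u = f R / g R := ⟨_, rfl⟩
    have hfu : f R = u * g R := by rw [hu]; field_simp
    rw [← hu]
    rw [hfu] at hjump hko ⊢
    linear_combination (-R ^ 2 * u) * hjump + R * g R * u * hko
  rw [hlim] at tin
  have hle : ∀ r ∈ Ioo 0 R, w r * (f r / g r) ≤ (1 - l) * R * f R ^ 2 := by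
    intro r hr
    refine ge_of_tendsto tin ?_
    filter_upwards [Ioo_mem_nhdsLT hr.2] with t ht
    exact hmono hr ⟨hr.1.trans ht.1, ht.2⟩ ht.1.le
  have hRneg : (1 - l) * R * f R ^ 2 ≤ 0 := by
    have : 0 ≤ (l - 1) * R * f R ^ 2 := by
      have : (0 : ℝ) ≤ l - 1 := by linarith
      positivity
    linarith
  have hmid : R / 2 ∈ Ioo 0 R := ⟨by linarith, by linarith⟩
  have hR0 : (1 - l) * R * f R ^ 2 = 0 :=
    le_antisymm hRneg ((hnn _ hmid).trans (hle _ hmid))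
  have hz : ∀ r ∈ Ioo 0 R, w r * (f r / g r) = 0 := fun r hr =>
    le_antisymm ((hle r hr).trans hRneg) (hnn r hr)
  have hz' : ∀ r ∈ Ioo 0 R, (l * (l + 1) - 2) * f r ^ 2 + w r ^ 2 / (r ^ 2 * g r ^ 2) = 0 := by
    intro r hr
    refine (hE r hr).unique ((hasDerivAt_const r (0 : ℝ)).congr_of_eventuallyEq ?_)
    filter_upwards [isOpen_Ioo.mem_nhds hr] with t ht using hz t ht
  have hw0 : ∀ r ∈ Ioo 0 R, w r = 0 := by
    intro r hr
    have h1 : 0 ≤ (l * (l + 1) - 2) * f r ^ 2 := by positivity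
    have h2 : 0 ≤ w r ^ 2 / (r ^ 2 * g r ^ 2) := by positivity
    have h3 : w r ^ 2 / (r ^ 2 * g r ^ 2) = 0 := by linarith [hz' r hr]
    have h4 : r ^ 2 * g r ^ 2 ≠ 0 := by
      have := hr.1; have := hgpos r hr.1; positivity
    simpa [h4, hr.1.ne', (hgpos r hr.1).ne'] using h3
  by_cases hl2 : 2 ≤ l
  · have hl2' : (2 : ℝ) ≤ l := by exact_mod_cast hl2
    have hfR : f R = 0 := by
      have : (1 - (l : ℝ)) * R ≠ 0 := mul_ne_zero (by linarith) hR.ne'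
      simpa [this] using hR0
    refine ⟨0, fun r hr => ?_, fun _ => rfl⟩
    rw [zero_mul]
    rcases lt_trichotomy r R with h | h | h
    · have h1 := hz' r ⟨hr, h⟩
      rw [hw0 r ⟨hr, h⟩] at h1
      have : (l * (l + 1) - 2 : ℝ) ≠ 0 := by nlinarith
      simpa [this] using h1
    · rw [h, hfR]
    · have hA0 : A = 0 := by
        have t1 : Tendsto (fun r => r ^ (l + 1) * f r) (𝓝[>] R) (𝓝 (R ^ (l + 1) * f R)) :=
          ((tendsto_id.mono_left nhdsWithin_le_nhds).pow _).mul (hfc.tendsto.mono_left nhdsWithin_le_nhds)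
        have t2 : Tendsto (fun r => r ^ (l + 1) * f r) (𝓝[>] R) (𝓝 A) := by
          refine tendsto_const_nhds.congr' ?_
          filter_upwards [self_mem_nhdsWithin] with r hr using (hA r hr).symm
        rw [← tendsto_nhds_unique t1 t2, hfR, mul_zero]
      have := hA r h
      rw [hA0] at this
      simpa [(show (0 : ℝ) < r from hr).ne'] using this
  · have hl1 : l = 1 := by omega
    subst hl1
    have hq0 : ∀ r ∈ Ioo 0 R, HasDerivAt (fun r => f r / g r) 0 r := fun r hr => by
      simpa [hw0 r hr] using hq r hr
    set c := f (R / 2) / g (R / 2) with hc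
    have hin : ∀ r ∈ Ioo 0 R, f r = c * g r := fun r hr => by
      have := eq_of_hasDerivAt_zero isOpen_Ioo (convex_Ioo 0 R) hq0 hr hmid
      rwa [div_eq_iff (hgpos r hr.1).ne'] at this
    have hfR : f R = c * g R := by
      have t1 : Tendsto f (𝓝[<] R) (𝓝 (f R)) := hfc.tendsto.mono_left nhdsWithin_le_nhds
      have t2 : Tendsto f (𝓝[<] R) (𝓝 (c * g R)) := by
        refine ((hgc.tendsto.mono_left nhdsWithin_le_nhds).const_mul c).congr' ?_
        filter_upwards [Ioo_mem_nhdsLT hR] with r hr using (hin r hr).symm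
      exact tendsto_nhds_unique t1 t2
    refine ⟨c, fun r hr => ?_, fun h => absurd h hl2⟩
    rcases lt_trichotomy r R with h | h | h
    · exact hin r ⟨hr, h⟩
    · rw [h, hfR]
    -- For l = 1 the decaying f and the exterior g are both multiples of r⁻², so r² (f - c g) is
    -- constant outside; by continuity it vanishes at R.
    · have hB : ∀ r ∈ Ioi R, HasDerivAt (fun r => r ^ 2 * (f r - c * g r)) 0 r := by
        intro r hr
        have hr0 : r ≠ 0 := (hR.trans hr).ne'
        refine ((hasDerivAt_pow 2 r).fun_mul ((hf' r hr).fun_sub ((hg' r hr).const_mul c))).congr_deriv ?_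
        have h1 := hkf r hr
        push_cast at h1 ⊢
        field_simp
        linear_combination r * h1
      have t1 : Tendsto (fun r => r ^ 2 * (f r - c * g r)) (𝓝[>] R) (𝓝 (R ^ 2 * (f R - c * g R))) :=
        ((tendsto_id.mono_left nhdsWithin_le_nhds).pow _).mul
          ((hfc.tendsto.mono_left nhdsWithin_le_nhds).sub ((hgc.tendsto.mono_left nhdsWithin_le_nhds).const_mul c))
      have t2 : Tendsto (fun r => r ^ 2 * (f r - c * g r)) (𝓝[>] R) (𝓝 (r ^ 2 * (f r - c * g r))) := by
        refine tendsto_const_nhds.congr' ?_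
        filter_upwards [self_mem_nhdsWithin] with t ht using eq_of_hasDerivAt_zero isOpen_Ioi (convex_Ioi R) hB h ht
      have h3 := tendsto_nhds_unique t1 t2
      rw [hfR, sub_self, mul_zero] at h3
      have hr2 : r ^ 2 ≠ 0 := pow_ne_zero _ (show (0 : ℝ) < r from hr).ne'
      have h4 := (mul_eq_zero.1 h3.symm).resolve_left hr2
      linarith

/-! ### Radial functions -/

/-- A radial function along the first axis. -/
def profile (f : E3 → ℝ) (r : ℝ) : ℝ := f (r • unitVec 0)

lemma norm_smul_unitVec {r : ℝ} (hr : 0 ≤ r) (i : Fin 3) : ‖r • unitVec i‖ = r := by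
  rw [norm_smul, Real.norm_of_nonneg hr]; simp

lemma eq_profile {f : E3 → ℝ} (hf : ∀ x y, ‖x‖ = ‖y‖ → f x = f y) (x : E3) : f x = profile f ‖x‖ :=
  hf _ _ (norm_smul_unitVec (norm_nonneg x) 0).symm

lemma profile_hasDerivAt {f : E3 → ℝ} {r : ℝ} (hd : DifferentiableAt ℝ f (r • unitVec 0)) :
    HasDerivAt (profile f) (fderiv ℝ f (r • unitVec 0) (unitVec 0)) r := by
  have h2 : HasDerivAt (fun s : ℝ => s • unitVec 0) (unitVec 0) r := by
    simpa using (hasDerivAt_id r).smul_const (unitVec 0)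
  exact hd.hasFDerivAt.comp_hasDerivAt r h2

lemma hasGradientAt_norm {x : E3} (hx : x ≠ 0) : HasGradientAt (fun z : E3 => ‖z‖) (‖x‖⁻¹ • x) x := by
  have h2 := (hasStrictFDerivAt_norm_sq x).hasFDerivAt.sqrt (by positivity)
  simp only [Real.sqrt_sq (norm_nonneg _)] at h2
  rw [hasGradientAt_iff_hasFDerivAt]
  refine h2.congr_fderiv ?_
  ext y
  simp
  field_simp

lemma hasGradientAt_comp_norm {φ : ℝ → ℝ} {φ' : ℝ} {x : E3} (hx : x ≠ 0) (h : HasDerivAt φ φ' ‖x‖) :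
    HasGradientAt (fun z : E3 => φ ‖z‖) (φ' • ‖x‖⁻¹ • x) x := by
  rw [hasGradientAt_iff_hasFDerivAt]
  refine (h.comp_hasFDerivAt x (hasGradientAt_norm hx).hasFDerivAt).congr_fderiv ?_
  ext y; simp

lemma gradient_radial {f : E3 → ℝ} (hf : ∀ x y, ‖x‖ = ‖y‖ → f x = f y) {x : E3} (hx : x ≠ 0)
    (hd : DifferentiableAt ℝ f (‖x‖ • unitVec 0)) :
    ∇ f x = fderiv ℝ f (‖x‖ • unitVec 0) (unitVec 0) • ‖x‖⁻¹ • x := by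
  have e : f = fun z => profile f ‖z‖ := by ext z; exact eq_profile hf z
  conv_lhs => rw [e]
  exact (hasGradientAt_comp_norm hx (profile_hasDerivAt hd)).gradient

/-- A radial function is even, so its derivative at the origin is its own negative. Where it is not
differentiable the gradient is 0 by convention. -/
lemma gradient_radial_zero {f : E3 → ℝ} (hf : ∀ x y, ‖x‖ = ‖y‖ → f x = f y) : ∇ f 0 = 0 := by
  by_cases hd : DifferentiableAt ℝ f 0
  · have h1 : HasFDerivAt (fun z : E3 => f (-z)) ((fderiv ℝ f 0).comp (-ContinuousLinearMap.id ℝ E3)) 0 := by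
      have hd' : HasFDerivAt f (fderiv ℝ f 0) (-(0 : E3)) := by rw [neg_zero]; exact hd.hasFDerivAt
      exact hd'.comp 0 ((hasFDerivAt_id (0 : E3)).neg)
    have e : (fun z : E3 => f (-z)) = f := by ext z; exact hf _ _ (norm_neg z)
    rw [e] at h1
    refine ext_inner_right ℝ fun v => ?_
    have h2 := congrArg (fun T : E3 →L[ℝ] ℝ => T v) (h1.fderiv)
    simp at h2
    rw [inner_grad, inner_zero_left]
    linarith
  · simp [gradient, fderiv_zero_of_not_differentiableAt hd]

/-! ### The structure of the star -/

namespace BarotropicStar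
variable (S : BarotropicStar)

/-- The gravity, `Φ'(r)`. -/
def grav (r : ℝ) : ℝ := fderiv ℝ S.Φ (r • unitVec 0) (unitVec 0)

lemma ball_eq_norm {x : E3} : x ∈ ball (0 : E3) S.R ↔ ‖x‖ < S.R := mem_ball_zero_iff

lemma mem_ball_of_Ioo {x : E3} (h : ‖x‖ ∈ Ioo 0 S.R) : x ∈ ball (0 : E3) S.R := S.ball_eq_norm.2 h.2

lemma shell_Ioo_subset : shell (Ioo 0 S.R) ⊆ ball 0 S.R := fun _ h => S.mem_ball_of_Ioo h

lemma shell_Ioi_eq : shell (Ioi S.R) = (closedBall 0 S.R)ᶜ := by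
  ext x; simp [shell]

lemma Ioi_R_subset : Ioi S.R ⊆ Ioi 0 := Ioi_subset_Ioi S.R_pos.le

lemma Φ_diff : Differentiable ℝ S.Φ := S.Φ_C1.differentiable one_ne_zero

lemma ρ_diffAt {x : E3} (hx : x ∈ ball (0 : E3) S.R) : DifferentiableAt ℝ S.ρ x :=
  (S.ρ_smooth.differentiableOn one_ne_zero).differentiableAt (isOpen_ball.mem_nhds hx)

lemma smul_unitVec_mem {r : ℝ} (hr : r ∈ Ioo 0 S.R) : r • unitVec 0 ∈ ball (0 : E3) S.R := by
  rw [S.ball_eq_norm, norm_smul_unitVec hr.1.le]; exact hr.2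

lemma grav_continuous : Continuous S.grav :=
  ((S.Φ_C1.continuous_fderiv one_ne_zero).comp (by fun_prop : Continuous fun r : ℝ => r • unitVec 0)).clm_apply
    continuous_const

lemma gradient_Φ {x : E3} (hx : x ≠ 0) : ∇ S.Φ x = S.grav ‖x‖ • ‖x‖⁻¹ • x :=
  gradient_radial S.Φ_radial hx (S.Φ_diff _)

lemma gradient_Φ_zero : ∇ S.Φ 0 = 0 := gradient_radial_zero S.Φ_radial

lemma gradient_Φ_continuous : Continuous (∇ S.Φ) :=
  continuousOn_univ.1 (gradient_contDiffOn (m := 0) isOpen_univ S.Φ_C1.contDiffOn (by simp)).continuousOn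

lemma gradient_p {x : E3} (hx : x ∈ ball (0 : E3) S.R) : ∇ S.p x = -(S.ρ x) • ∇ S.Φ x := by
  have h := S.equilibrium x hx
  have hρ := (S.ρ_pos x hx).ne'
  have h2 : S.ρ x • ((1 / S.ρ x) • ∇ S.p x + ∇ S.Φ x) = 0 := by rw [h, smul_zero]
  rw [smul_add, smul_smul, mul_one_div_cancel hρ, one_smul] at h2
  rw [neg_smul]
  exact eq_neg_of_add_eq_zero_left h2

/-- `ρ'(r)`. -/
def dρ (r : ℝ) : ℝ := fderiv ℝ S.ρ (r • unitVec 0) (unitVec 0)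

lemma ρ_profile_hasDerivAt {r : ℝ} (hr : r ∈ Ioo 0 S.R) : HasDerivAt (profile S.ρ) (S.dρ r) r :=
  profile_hasDerivAt (S.ρ_diffAt (S.smul_unitVec_mem hr))

lemma gradient_ρ {x : E3} (hx : x ≠ 0) (hxb : x ∈ ball (0 : E3) S.R) : ∇ S.ρ x = S.dρ ‖x‖ • ‖x‖⁻¹ • x :=
  gradient_radial S.ρ_radial hx (S.ρ_diffAt (S.smul_unitVec_mem ⟨norm_pos_iff.2 hx, S.ball_eq_norm.1 hxb⟩))

lemma ρ_profile_pos {r : ℝ} (hr : r ∈ Ico 0 S.R) : 0 < profile S.ρ r :=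
  S.ρ_pos _ (by rw [S.ball_eq_norm, norm_smul_unitVec hr.1]; exact hr.2)

lemma ρ_profile_continuousOn : ContinuousOn (profile S.ρ) (Icc 0 S.R) :=
  S.ρ_cont.comp (by fun_prop) fun r hr => by
    rw [mem_closedBall_zero_iff, norm_smul_unitVec hr.1]; exact hr.2

lemma sphereMeasure_pos : 0 < sphereMeasure.real univ := by
  rw [Measure.real, ENNReal.toReal_pos_iff]
  refine ⟨?_, measure_lt_top _ _⟩
  rw [pos_iff_ne_zero, Measure.measure_univ_ne_zero]
  exact Measure.toSphere_ne_zero _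

lemma flux_Φ {r : ℝ} (hr : 0 < r) :
    sphereIntegral (fun x => ⟪∇ S.Φ x, ‖x‖⁻¹ • x⟫) r = sphereMeasure.real univ * S.grav r := by
  rw [sphereIntegral_congr (g := fun _ => S.grav r) hr]
  · simp [sphereIntegral]
  · intro x hx
    have hx0 : x ≠ 0 := norm_pos_iff.1 (hx ▸ hr)
    rw [S.gradient_Φ hx0, real_inner_smul_left, real_inner_self_eq_norm_sq, norm_smul, norm_inv, norm_norm,
      inv_mul_cancel₀ (norm_ne_zero_iff.2 hx0), hx]
    ring

/-- The radial Poisson equation, read off from the derivative of the flux of ∇Φ through spheres. It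
is stated for a general source so as to serve both inside and outside the star. -/
lemma grav_hasDerivAt_aux {I : Set ℝ} (hI : IsOpen I) (hI0 : I ⊆ Ioi 0) {φ : ℝ → ℝ}
    (hΦ : ContDiffOn ℝ 2 S.Φ (shell I)) (hp : ∀ x ∈ shell I, Δ S.Φ x = φ ‖x‖) {r : ℝ} (hr : r ∈ I) :
    HasDerivAt S.grav (φ r - 2 / r * S.grav r) r := by
  have hU := isOpen_shell hI
  have h := sphereIntegral_flux_hasDerivAt hI hI0 (gradient_contDiffOn hU hΦ (by norm_num)) hr
  have hσ := sphereMeasure_pos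
  rw [S.flux_Φ (hI0 hr), sphereIntegral_congr (g := fun _ => φ r) (hI0 hr)] at h
  · have h2 := (h.congr_of_eventuallyEq (f₁ := fun r => sphereMeasure.real univ * S.grav r) (by
      filter_upwards [hI.mem_nhds hr] with t ht using (S.flux_Φ (hI0 ht)).symm)).const_mul
        (sphereMeasure.real univ)⁻¹
    simp only [inv_mul_cancel_left₀ hσ.ne'] at h2
    refine h2.congr_deriv ?_
    have e : sphereIntegral (fun _ => φ r) r = sphereMeasure.real univ * φ r := by simp [sphereIntegral]
    rw [e]
    generalize sphereMeasure.real univ = m at hσ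
    field_simp
  · intro x hx
    have hxI : x ∈ shell I := by simpa [shell, hx] using hr
    rw [← laplacian_eq_divergence (hΦ.contDiffAt (hU.mem_nhds hxI)), hp x hxI, hx]

lemma grav_hasDerivAt {r : ℝ} (hr : r ∈ Ioo 0 S.R) :
    HasDerivAt S.grav (4 * Real.pi * profile S.ρ r - 2 / r * S.grav r) r :=
  S.grav_hasDerivAt_aux isOpen_Ioo (fun _ h => h.1) (φ := fun r => 4 * Real.pi * profile S.ρ r)
    (S.Φ_inner.mono S.shell_Ioo_subset)
    (fun x hx => by rw [S.poisson_inner x (S.shell_Ioo_subset hx), eq_profile S.ρ_radial]) hr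

lemma grav_hasDerivAt_outer {r : ℝ} (hr : r ∈ Ioi S.R) :
    HasDerivAt S.grav (-(2 / r * S.grav r)) r := by
  have := S.grav_hasDerivAt_aux isOpen_Ioi S.Ioi_R_subset (φ := fun r => 0)
    (by rw [S.shell_Ioi_eq]; exact S.Φ_outer)
    (fun x hx => S.poisson_outer x (by rwa [← S.shell_Ioi_eq])) hr
  simpa using this

/-- The gravity grows at least linearly as long as the density is bounded below. -/
lemma grav_lower_bound {c δ : ℝ} (hδ : δ ≤ S.R) (hc : ∀ r ∈ Ioo 0 δ, c ≤ profile S.ρ r) {r : ℝ}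
    (hr : r ∈ Ioc 0 δ) : 4 * Real.pi / 3 * c * r ≤ S.grav r := by
  -- The derivative of t² g is 4π t² ρ; it is compared with the corresponding quantity for a ball of
  -- constant density c.
  have hmono : MonotoneOn (fun t => t ^ 2 * S.grav t - 4 * Real.pi / 3 * c * t ^ 3) (Icc 0 δ) := by
    have hd : ∀ t ∈ Ioo 0 δ, HasDerivAt (fun t => t ^ 2 * S.grav t - 4 * Real.pi / 3 * c * t ^ 3)
        (4 * Real.pi * t ^ 2 * (profile S.ρ t - c)) t := by
      intro t ht
      have ht0 := ht.1.ne'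
      refine (((hasDerivAt_pow 2 t).fun_mul (S.grav_hasDerivAt ⟨ht.1, ht.2.trans_le hδ⟩)).fun_sub
        ((hasDerivAt_pow 3 t).const_mul _)).congr_deriv ?_
      field_simp
      push_cast
      ring
    refine monotoneOn_of_deriv_nonneg (convex_Icc 0 δ) ?_ ?_ ?_
    · have := S.grav_continuous; fun_prop
    · rw [interior_Icc]; exact fun t ht => (hd t ht).differentiableAt.differentiableWithinAt
    · rw [interior_Icc]
      intro t ht
      rw [(hd t ht).deriv]
      have := hc t ht
      have : 0 ≤ profile S.ρ t - c := by linarith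
      positivity
  have h := hmono ⟨le_rfl, hr.1.le.trans hr.2⟩ ⟨hr.1.le, hr.2⟩ hr.1.le
  simp only [ne_eq, OfNat.ofNat_ne_zero, not_false_eq_true, zero_pow, zero_mul, mul_zero, sub_zero] at h
  have hr2 : 0 < r ^ 2 := by have := hr.1; positivity
  nlinarith

lemma exists_ρ_lower_bound {δ : ℝ} (hδ : δ ∈ Ico 0 S.R) : ∃ c > 0, ∀ r ∈ Icc 0 δ, c ≤ profile S.ρ r := by
  obtain ⟨r₀, hr₀, hmin⟩ := isCompact_Icc.exists_isMinOn (nonempty_Icc.2 hδ.1)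
    (S.ρ_profile_continuousOn.mono (Icc_subset_Icc_right hδ.2.le))
  exact ⟨_, S.ρ_profile_pos ⟨hr₀.1, hr₀.2.trans_lt hδ.2⟩, fun r hr => hmin hr⟩

lemma grav_pos_inner {r : ℝ} (hr : r ∈ Ioo 0 S.R) : 0 < S.grav r := by
  obtain ⟨c, hc, hcb⟩ := S.exists_ρ_lower_bound (δ := r) ⟨hr.1.le, hr.2⟩
  have h := S.grav_lower_bound hr.2.le (fun t ht => hcb t ⟨ht.1.le, ht.2.le⟩) (r := r) ⟨hr.1, le_rfl⟩
  have := hr.1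
  have : 0 < 4 * Real.pi / 3 * c * r := by positivity
  linarith

/-- The linear lower bound for g is not available at r = R, since the density may vanish there.
Instead, r² g increases strictly on [0, R] from the value 0. -/
lemma grav_R_pos : 0 < S.grav S.R := by
  have hmono : StrictMonoOn (fun t => t ^ 2 * S.grav t) (Icc 0 S.R) := by
    have hd : ∀ t ∈ Ioo 0 S.R, HasDerivAt (fun t => t ^ 2 * S.grav t)
        (4 * Real.pi * t ^ 2 * profile S.ρ t) t := by
      intro t ht
      have ht0 := ht.1.ne'
      refine ((hasDerivAt_pow 2 t).fun_mul (S.grav_hasDerivAt ht)).congr_deriv ?_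
      field_simp
      push_cast
      ring
    refine strictMonoOn_of_deriv_pos (convex_Icc 0 S.R) ?_ ?_
    · have := S.grav_continuous; fun_prop
    · rw [interior_Icc]
      intro t ht
      rw [(hd t ht).deriv]
      have := S.ρ_profile_pos ⟨ht.1.le, ht.2⟩
      have := ht.1
      positivity
  have h := hmono ⟨le_rfl, S.R_pos.le⟩ ⟨S.R_pos.le, le_rfl⟩ S.R_pos
  have hR := S.R_pos
  simp only [ne_eq, OfNat.ofNat_ne_zero, not_false_eq_true, zero_pow, zero_mul] at h
  exact (mul_pos_iff_of_pos_left (by positivity)).1 h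

/-- The inverse square law: r² g has zero derivative outside, and its constant value is fixed by
continuity at the surface. -/
lemma grav_outer {r : ℝ} (hr : r ∈ Ioi S.R) : r ^ 2 * S.grav r = S.R ^ 2 * S.grav S.R := by
  have hB : ∀ r ∈ Ioi S.R, HasDerivAt (fun r => r ^ 2 * S.grav r) 0 r := by
    intro r hr
    have hr0 : r ≠ 0 := (S.R_pos.trans hr).ne'
    refine ((hasDerivAt_pow 2 r).fun_mul (S.grav_hasDerivAt_outer hr)).congr_deriv ?_
    field_simp
    push_cast
    ring
  have hc : Continuous fun r => r ^ 2 * S.grav r := by have := S.grav_continuous; fun_prop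
  have t1 : Tendsto (fun r => r ^ 2 * S.grav r) (𝓝[>] S.R) (𝓝 (S.R ^ 2 * S.grav S.R)) :=
    (hc.tendsto S.R).mono_left nhdsWithin_le_nhds
  refine tendsto_nhds_unique (tendsto_const_nhds.congr' ?_) t1
  filter_upwards [self_mem_nhdsWithin] with t ht using eq_of_hasDerivAt_zero isOpen_Ioi (convex_Ioi S.R) hB hr ht

lemma grav_pos {r : ℝ} (hr : 0 < r) : 0 < S.grav r := by
  rcases lt_trichotomy r S.R with h | h | h
  · exact S.grav_pos_inner ⟨hr, h⟩
  · rw [h]; exact S.grav_R_pos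
  · have h1 := S.grav_outer h
    have h2 := S.grav_R_pos
    have h3 := S.R_pos
    have : 0 < r ^ 2 * S.grav r := by rw [h1]; positivity
    exact (mul_pos_iff_of_pos_left (by positivity)).1 this

lemma exists_ρ_upper_bound : ∃ C > 0, ∀ r ∈ Icc 0 S.R, |profile S.ρ r| ≤ C := by
  obtain ⟨C, hC⟩ := isCompact_Icc.exists_bound_of_continuousOn S.ρ_profile_continuousOn
  exact ⟨max C 1, by positivity, fun r hr => (hC r hr).trans (le_max_left _ _)⟩

/-- The gradient of Φ vanishes at the centre and is differentiable there. With the linear lower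
bound this makes g comparable to r near 0. -/
lemma exists_grav_upper_bound : ∃ C > 0, ∀ᶠ r in 𝓝[>] 0, S.grav r ≤ C * r := by
  have h0 : (0 : E3) ∈ ball (0 : E3) S.R := mem_ball_self S.R_pos
  have hd := (gradient_differentiableAt (S.Φ_inner.contDiffAt (isOpen_ball.mem_nhds h0))).hasFDerivAt.isBigO_sub
  obtain ⟨C, hC, hb⟩ := hd.exists_pos
  refine ⟨C, hC, ?_⟩
  have ht : Tendsto (fun r : ℝ => r • unitVec 0) (𝓝[>] 0) (𝓝 0) := by
    have : Continuous fun r : ℝ => r • unitVec 0 := by fun_prop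
    have := this.tendsto 0
    rw [zero_smul] at this
    exact this.mono_left nhdsWithin_le_nhds
  filter_upwards [ht.eventually hb.bound, self_mem_nhdsWithin] with r hr hr0
  rw [S.gradient_Φ_zero, sub_zero, sub_zero, norm_smul_unitVec (le_of_lt hr0)] at hr
  refine le_trans ?_ hr
  rw [grav, ← inner_grad]
  refine (real_inner_le_norm _ _).trans ?_
  have : ‖unitVec 0‖ = 1 := by simp
  rw [this, mul_one]

end BarotropicStar

/-! ### Stationary non-radial perturbations -/

lemma sphereIntegral_mul_angular_bound {φ H : E3 → ℝ} (hH : Continuous H) {r B : ℝ} (hr : 0 < r)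
    (hB : ∀ x, ‖x‖ = r → |φ x| ≤ B) :
    |sphereIntegral (fun x => φ x * angular H x) r| ≤ B * ∫ n : sphere (0 : E3) 1, |H n| ∂sphereMeasure := by
  rw [← integral_const_mul, ← Real.norm_eq_abs]
  refine norm_integral_le_of_norm_le (continuous_sphere_integrable (by fun_prop)) ?_
  refine Eventually.of_forall fun n => ?_
  change ‖φ (r • (n : E3)) * angular H (r • (n : E3))‖ ≤ _
  rw [angular_sphere H hr, norm_mul]
  exact mul_le_mul_of_nonneg_right (hB _ (norm_smul_sphere hr.le n)) (abs_nonneg _)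

lemma angular_const_of_degree_zero {H : E3 → ℝ} (hH : IsHomog 0 H) (x : E3) : angular H x = H 0 :=
  hH.const_of_zero _

/-- Equations for the projection of a potential on a spherical harmonic. -/
lemma mode_equations {I : Set ℝ} (hI : IsOpen I) (hI0 : I ⊆ Ioi 0) {φ : E3 → ℝ}
    (hφ : ContDiffOn ℝ 2 φ (shell I)) {l : ℕ} {H : E3 → ℝ} (hH : IsSolidHarmonic l H) {r : ℝ} (hr : r ∈ I) :
    HasDerivAt (sphereIntegral (fun x => φ x * angular H x))
      (sphereIntegral (fun x => angular H x * ⟪∇ φ x, ‖x‖⁻¹ • x⟫) r) r ∧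
    HasDerivAt (sphereIntegral (fun x => angular H x * ⟪∇ φ x, ‖x‖⁻¹ • x⟫))
      (sphereIntegral (fun x => angular H x * Δ φ x) r
        + l * (l + 1) / r ^ 2 * sphereIntegral (fun x => φ x * angular H x) r
        - 2 / r * sphereIntegral (fun x => angular H x * ⟪∇ φ x, ‖x‖⁻¹ • x⟫) r) r := by
  have hU := isOpen_shell hI
  have hs := shell_subset_compl_zero hI0
  have hφ1 : ContDiffOn ℝ 1 φ (shell I) := hφ.of_le (by norm_num)
  have hY : ContDiffOn ℝ 1 (angular H) (shell I) := (hH.isHomog.angular_contDiffOn.mono hs).of_le one_le_infty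
  have hmem : ∀ x, ‖x‖ = r → x ∈ shell I := fun x hx => by simpa [shell, hx] using hr
  constructor
  · refine (sphereIntegral_hasDerivAt hI hI0 (hφ1.mul hY) hr).congr_deriv ?_
    refine sphereIntegral_congr (hI0 hr) fun x hx => ?_
    have hx0 := hs (hmem x hx)
    have d1 := (hφ1.differentiableOn one_ne_zero).differentiableAt (hU.mem_nhds (hmem x hx))
    have d2 := (hY.differentiableOn one_ne_zero).differentiableAt (hU.mem_nhds (hmem x hx))
    change fderiv ℝ (fun x => φ x * angular H x) x _ = _
    rw [← inner_grad, gradient_mul d1 d2, inner_add_left, real_inner_smul_left, real_inner_smul_left,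
      real_inner_smul_right, hH.isHomog.inner_gradient_angular hx0]
    ring
  -- This is the flux of ∇φ weighted with Y: its divergence is Δφ, and the mean of ∇Y · ∇φ
  -- contributes the term with l(l+1)/r².
  · refine (sphereIntegral_weighted_flux hI hI0 hY (gradient_contDiffOn hU hφ (by norm_num)) hr).congr_deriv ?_
    congr 2
    · refine sphereIntegral_congr (hI0 hr) fun x hx => ?_
      rw [laplacian_eq_divergence (hφ.contDiffAt (hU.mem_nhds (hmem x hx)))]
    · rw [← sphereIntegral_inner_gradient_angular hI hI0 hφ1 hH hr]
      exact sphereIntegral_congr (hI0 hr) fun x _ => real_inner_comm _ _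

/-- The gradient of a function homogeneous of degree one is constant, so Euler's identity makes the
function linear. -/
lemma IsHomog.eq_inner_gradient {G : E3 → ℝ} (hG : IsHomog 1 G) (x : E3) : G x = ⟪∇ G 0, x⟫ := by
  have h1 := hG.euler x
  rw [inner_grad, (hG.fderiv_apply x).const_of_zero x] at h1
  rw [inner_grad, h1]; simp

section
variable {S : BarotropicStar} {q : Perturbation} {ξ : ℝ → E3 → E3}

lemma IsStationary.dΦ_diffAt (h : IsStationary S q ξ) {x : E3} (hx : x ∈ ball (0 : E3) S.R) :
    DifferentiableAt ℝ q.dΦ x :=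
  (h.dΦ_inner.differentiableOn (by norm_num)).differentiableAt (isOpen_ball.mem_nhds hx)

lemma IsStationary.dp_diffAt (h : IsStationary S q ξ) {x : E3} (hx : x ∈ ball (0 : E3) S.R) :
    DifferentiableAt ℝ q.dp x :=
  (h.dp_smooth.differentiableOn one_ne_zero).differentiableAt (isOpen_ball.mem_nhds hx)

/-- In this form the right side of the perturbed Euler equation is visibly radial, because ∇p has
been replaced by -ρ ∇Φ. -/
lemma IsStationary.euler_mul (h : IsStationary S q ξ) {x : E3} (hx : x ∈ ball (0 : E3) S.R) :
    ∇ q.dp x + S.ρ x • ∇ q.dΦ x = -(q.dρ x) • ∇ S.Φ x := by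
  have hρ := (S.ρ_pos x hx).ne'
  have h1 := h.euler x hx
  have h2 : S.ρ x • ((1 / S.ρ x) • ∇ q.dp x - (q.dρ x / S.ρ x ^ 2) • ∇ S.p x + ∇ q.dΦ x) = 0 := by
    rw [h1, smul_zero]
  rw [S.gradient_p hx, smul_add, smul_sub, smul_smul, smul_smul, smul_smul, mul_one_div_cancel hρ, one_smul] at h2
  have e : S.ρ x * (q.dρ x / S.ρ x ^ 2) * -S.ρ x = - q.dρ x := by field_simp
  rw [e] at h2
  rw [sub_add_eq_add_sub, sub_eq_zero] at h2
  exact h2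

/-- `δp = -ρ δΦ`. -/
lemma IsStationary.dp_eq_neg (h : IsStationary S q ξ) (hn : IsNonRadial S q) {x : E3}
    (hx : x ∈ ball (0 : E3) S.R) : q.dp x = -(S.ρ x * q.dΦ x) := by
  have hI0 : Ioo 0 S.R ⊆ Ioi 0 := fun _ h => h.1
  have hsb := S.shell_Ioo_subset
  set ψ : E3 → ℝ := fun x => q.dp x + S.ρ x * q.dΦ x with hψ
  have hψ1 : ContDiffOn ℝ 1 ψ (ball 0 S.R) :=
    h.dp_smooth.add (S.ρ_smooth.mul (h.dΦ_inner.of_le (by norm_num)))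
  have hgrad : ∀ x ∈ ball (0 : E3) S.R, ∇ ψ x = q.dΦ x • ∇ S.ρ x - q.dρ x • ∇ S.Φ x := by
    intro x hx
    rw [hψ, gradient_add' (h.dp_diffAt hx) ((S.ρ_diffAt hx).fun_mul (h.dΦ_diffAt hx)),
      gradient_mul (S.ρ_diffAt hx) (h.dΦ_diffAt hx), ← add_assoc, h.euler_mul hx]
    module
  -- The gradient of ψ is radial, hence orthogonal to every ∇Y. Integration by parts then removes
  -- all projections with l ≥ 1, and the one with l = 0 vanishes since the perturbation is
  -- non-radial.
  have hoff : ∀ x, x ≠ 0 → x ∈ ball (0 : E3) S.R → ψ x = 0 := by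
    intro x hx0 hxb
    have hr : ‖x‖ ∈ Ioo 0 S.R := ⟨norm_pos_iff.2 hx0, S.ball_eq_norm.1 hxb⟩
    refine eq_zero_of_orthogonal_harmonics hr.1
      (continuous_on_sphere (hψ1.continuousOn.mono hsb) (smul_mem_shell hI0 hr)) (fun l H hH => ?_) rfl
    rcases Nat.eq_zero_or_pos l with rfl | hl
    · simp only [angular_const_of_degree_zero hH.isHomog]
      have e : (fun x => ψ x * H 0) = fun x => H 0 * ψ x := by ext x; ring
      rw [e, sphereIntegral_const_mul, hψ,
        sphereIntegral_add (h.dp_smooth.continuousOn.mono hsb)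
          ((S.ρ_smooth.continuousOn.fun_mul h.dΦ_cont.continuousOn).mono hsb) (smul_mem_shell hI0 hr),
        hn.dp_mean _ hr, sphereIntegral_congr (g := fun x => profile S.ρ ‖x‖ * q.dΦ x) hr.1
          (fun z hz => by rw [eq_profile S.ρ_radial z]),
        sphereIntegral_congr (f := fun z => profile S.ρ ‖z‖ * q.dΦ z) (g := fun z => profile S.ρ ‖x‖ * q.dΦ z) hr.1
          (fun z hz => by rw [hz]),
        sphereIntegral_const_mul, hn.dΦ_mean _ hr.1]
      ring
    · have h1 := sphereIntegral_inner_gradient_angular isOpen_Ioo hI0 (hψ1.mono hsb) hH hr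
      rw [sphereIntegral_congr (g := fun _ => 0) hr.1] at h1
      · have h2 : (l * (l + 1) / ‖x‖ ^ 2 : ℝ) ≠ 0 := by
          have := hr.1; positivity
        have h3 : sphereIntegral (fun _ => (0 : ℝ)) ‖x‖ = 0 := by simp [sphereIntegral]
        rw [h3] at h1
        exact (mul_eq_zero.1 h1.symm).resolve_left h2
      · intro z hz
        have hz0 : z ≠ 0 := norm_pos_iff.1 (hz ▸ hr.1)
        have hzb : z ∈ ball (0 : E3) S.R := S.ball_eq_norm.2 (hz ▸ hr.2)
        have ht := hH.isHomog.inner_gradient_angular hz0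
        rw [real_inner_comm] at ht
        rw [hgrad z hzb, S.gradient_ρ hz0 hzb, S.gradient_Φ hz0, inner_sub_left]
        simp only [real_inner_smul_left, ht, mul_zero, sub_zero]
  suffices ψ x = 0 by simp only [hψ] at this; linarith
  by_cases hx0 : x = 0
  · subst hx0
    have hc : ContinuousAt ψ 0 := hψ1.continuousOn.continuousAt (isOpen_ball.mem_nhds hx)
    refine tendsto_nhds_unique (hc.tendsto.mono_left (nhdsWithin_le_nhds (s := {0}ᶜ))) ?_
    refine tendsto_const_nhds.congr' ?_
    filter_upwards [self_mem_nhdsWithin, mem_nhdsWithin_of_mem_nhds (isOpen_ball.mem_nhds hx)] with z hz hzb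
    exact (hoff z hz hzb).symm
  · exact hoff x hx0 hx

/-- `δρ ∇Φ = δΦ ∇ρ`. -/
lemma IsStationary.dρ_smul (h : IsStationary S q ξ) (hn : IsNonRadial S q) {x : E3}
    (hx : x ∈ ball (0 : E3) S.R) : q.dρ x • ∇ S.Φ x = q.dΦ x • ∇ S.ρ x := by
  have e : q.dp =ᶠ[𝓝 x] fun z => (-1) * (S.ρ z * q.dΦ z) := by
    filter_upwards [isOpen_ball.mem_nhds hx] with z hz
    rw [h.dp_eq_neg hn hz]; ring
  have h1 := h.euler_mul hx
  rw [e.gradient_eq, gradient_const_mul' _ ((S.ρ_diffAt hx).fun_mul (h.dΦ_diffAt hx)),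
    gradient_mul (S.ρ_diffAt hx) (h.dΦ_diffAt hx)] at h1
  have h2 : -(q.dρ x • ∇ S.Φ x) = -(q.dΦ x • ∇ S.ρ x) := by
    rw [← neg_smul, ← h1]; module
  exact neg_injective h2

/-- The radial form of this relation expresses δρ through δΦ, so that the Poisson equation becomes a
closed equation for δΦ. -/
lemma IsStationary.dρ_mul_grav (h : IsStationary S q ξ) (hn : IsNonRadial S q) {x : E3} (hx0 : x ≠ 0)
    (hx : x ∈ ball (0 : E3) S.R) : q.dρ x * S.grav ‖x‖ = S.dρ ‖x‖ * q.dΦ x := by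
  have h1 := h.dρ_smul hn hx
  rw [S.gradient_Φ hx0, S.gradient_ρ hx0 hx] at h1
  have h2 : (q.dρ x * S.grav ‖x‖) • (‖x‖⁻¹ • x) = (q.dΦ x * S.dρ ‖x‖) • (‖x‖⁻¹ • x) := by
    rw [mul_smul, mul_smul]; exact h1
  rw [smul_left_injective ℝ (smul_ne_zero (inv_ne_zero (norm_ne_zero_iff.2 hx0)) hx0) h2]; ring

/-- The surface density of the displaced layer. -/
lemma IsStationary.surface_layer (h : IsStationary S q ξ) (hn : IsNonRadial S q) {y : E3}
    (hy : ‖y‖ = S.R) : S.ρ y * ⟪ξ 0 y, ‖y‖⁻¹ • y⟫ * S.grav S.R = -(S.ρ y * q.dΦ y) := by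
  have hys : y ∈ sphere (0 : E3) S.R := by simpa using hy
  have hyc : y ∈ closedBall (0 : E3) S.R := sphere_subset_closedBall hys
  have hy0 : y ≠ 0 := norm_pos_iff.1 (hy ▸ S.R_pos)
  have hle : 𝓝[ball 0 S.R] y ≤ 𝓝[closedBall 0 S.R] y := nhdsWithin_mono _ ball_subset_closedBall
  -- Inside, the Lagrangian pressure change equals -ρ (δΦ + ξ · ∇Φ), which is continuous up to the
  -- surface. Its vanishing there fixes the product ρ ξ^r, which is all that the jump condition
  -- needs; ξ^r alone is undetermined if ρ(R) = 0.
  have t1 := h.surface_pressure 0 y hys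
  have t2 : Tendsto (fun x => -(S.ρ x * q.dΦ x) + -(S.ρ x) * ⟪ξ 0 x, ∇ S.Φ x⟫) (𝓝[ball 0 S.R] y)
      (𝓝 (-(S.ρ y * q.dΦ y) + -(S.ρ y) * ⟪ξ 0 y, ∇ S.Φ y⟫)) := by
    have c1 : Tendsto S.ρ (𝓝[ball 0 S.R] y) (𝓝 (S.ρ y)) := (S.ρ_cont y hyc).tendsto.mono_left hle
    have c2 : Tendsto q.dΦ (𝓝[ball 0 S.R] y) (𝓝 (q.dΦ y)) := h.dΦ_cont.tendsto y |>.mono_left nhdsWithin_le_nhds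
    have c3 : Tendsto (ξ 0) (𝓝[ball 0 S.R] y) (𝓝 (ξ 0 y)) := (h.ξ_cont 0 y hyc).tendsto.mono_left hle
    have c4 : Tendsto (∇ S.Φ) (𝓝[ball 0 S.R] y) (𝓝 (∇ S.Φ y)) :=
      S.gradient_Φ_continuous.tendsto y |>.mono_left nhdsWithin_le_nhds
    exact (c1.mul c2).neg.add (c1.neg.mul (c3.inner c4))
  have : (𝓝[ball (0 : E3) S.R] y).NeBot := by
    rw [← mem_closure_iff_nhdsWithin_neBot, closure_ball _ S.R_pos.ne']; exact hyc
  have h3 := tendsto_nhds_unique t1 (t2.congr' (by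
    filter_upwards [self_mem_nhdsWithin] with x hx
    rw [h.dp_eq_neg hn hx, S.gradient_p hx, real_inner_smul_right]))
  rw [S.gradient_Φ hy0, real_inner_smul_right, hy] at h3
  rw [hy]
  linarith

/-- Limits of ∇δΦ at the surface are given only point by point. The extension of a continuous field
by its limits is nevertheless continuous, and spherical means therefore converge as the radius
approaches the surface. -/
lemma extendFrom_sphereIntegral_continuousOn {A : Set E3} {J : Set ℝ} [LocallyCompactSpace J]
    (hJ0 : J ⊆ Ioi 0) {F : E3 → E3} (hJA : shell J ⊆ closure A)
    (hlim : ∀ x ∈ shell J, ∃ y, Tendsto F (𝓝[A] x) (𝓝 y)) {l : ℕ} {H : E3 → ℝ} (hH : IsHomog l H) :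
    ContinuousOn (fun x => angular H x * ⟪extendFrom A F x, ‖x‖⁻¹ • x⟫) (shell J) ∧
    ContinuousOn (sphereIntegral (fun x => angular H x * ⟪extendFrom A F x, ‖x‖⁻¹ • x⟫)) J := by
  have hs := shell_subset_compl_zero hJ0
  have c : ContinuousOn (fun x => angular H x * ⟪extendFrom A F x, ‖x‖⁻¹ • x⟫) (shell J) :=
    (hH.angular_contDiffOn.continuousOn.mono hs).fun_mul
      ((continuousOn_extendFrom hJA hlim).inner (𝕜 := ℝ)
        ((unitRadial_contDiffOn (n := 0) (s := {0}ᶜ) fun _ h => h).continuousOn.mono hs))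
  exact ⟨c, sphereIntegral_continuousOn c fun r hr n => smul_mem_shell hJ0 hr n⟩

/-- The one-sided limits of the projected radial derivative of `δΦ` at the surface. -/
lemma IsStationary.surface_jump (h : IsStationary S q ξ) (hn : IsNonRadial S q) {l : ℕ} {H : E3 → ℝ}
    (hH : IsSolidHarmonic l H) : ∃ kin kout,
    Tendsto (sphereIntegral (fun x => angular H x * ⟪∇ q.dΦ x, ‖x‖⁻¹ • x⟫)) (𝓝[<] S.R) (𝓝 kin) ∧
    Tendsto (sphereIntegral (fun x => angular H x * ⟪∇ q.dΦ x, ‖x‖⁻¹ • x⟫)) (𝓝[>] S.R) (𝓝 kout) ∧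
    (kout - kin) * S.grav S.R
      = -(4 * Real.pi * profile S.ρ S.R * sphereIntegral (fun x => q.dΦ x * angular H x) S.R) := by
  have hR := S.R_pos
  have hgin : ContinuousOn (∇ q.dΦ) (ball 0 S.R) :=
    (gradient_contDiffOn (m := 1) isOpen_ball h.dΦ_inner (by norm_num)).continuousOn
  have hgout : ContinuousOn (∇ q.dΦ) (closedBall 0 S.R)ᶜ :=
    (gradient_contDiffOn (m := 1) isClosed_closedBall.isOpen_compl h.dΦ_outer (by norm_num)).continuousOn
  -- The inner radius R/2 is arbitrary; it only keeps the shell away from the centre, where the unit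
  -- radial field is singular.
  have hlim1 : ∀ x ∈ shell (Icc (S.R / 2) S.R), ∃ y, Tendsto (∇ q.dΦ) (𝓝[ball 0 S.R] x) (𝓝 y) := by
    intro x hx
    rcases lt_or_eq_of_le hx.2 with h1 | h1
    · exact ⟨_, hgin x (S.ball_eq_norm.2 h1)⟩
    · obtain ⟨a, b, ha, -, -⟩ := h.surface_gravity 0 x (by simpa using h1)
      exact ⟨a, ha⟩
  have hlim2 : ∀ x ∈ shell (Ici S.R), ∃ y, Tendsto (∇ q.dΦ) (𝓝[(closedBall 0 S.R)ᶜ] x) (𝓝 y) := by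
    intro x hx
    rcases lt_or_eq_of_le (show S.R ≤ ‖x‖ from hx) with h1 | h1
    · exact ⟨_, hgout x (by simpa using h1)⟩
    · obtain ⟨a, b, -, hb, -⟩ := h.surface_gravity 0 x (by simpa using h1.symm)
      exact ⟨b, hb⟩
  have hJ1 : Icc (S.R / 2) S.R ⊆ Ioi 0 := fun r hr => show 0 < r by linarith [hr.1]
  have hJ2 : Ici S.R ⊆ Ioi 0 := fun r hr => lt_of_lt_of_le hR hr
  have hcl1 : shell (Icc (S.R / 2) S.R) ⊆ closure (ball 0 S.R) := fun x hx => by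
    rw [closure_ball _ hR.ne']; simpa using hx.2
  have hcl2 : shell (Ici S.R) ⊆ closure (closedBall (0 : E3) S.R)ᶜ := fun x hx => by
    rw [closure_compl, interior_closedBall _ hR.ne']; simpa [shell] using hx
  have : LocallyCompactSpace (Icc (S.R / 2) S.R) := isClosed_Icc.isClosedEmbedding_subtypeVal.locallyCompactSpace
  have : LocallyCompactSpace (Ici S.R) := isClosed_Ici.isClosedEmbedding_subtypeVal.locallyCompactSpace
  obtain ⟨s1, c1⟩ := extendFrom_sphereIntegral_continuousOn hJ1 hcl1 hlim1 hH.isHomog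
  obtain ⟨s2, c2⟩ := extendFrom_sphereIntegral_continuousOn hJ2 hcl2 hlim2 hH.isHomog
  have mR1 : S.R ∈ Icc (S.R / 2) S.R := ⟨by linarith, le_rfl⟩
  have mR2 : S.R ∈ Ici S.R := self_mem_Ici
  refine ⟨_, _, ((c1 _ mR1).tendsto.mono_left ?_).congr' ?_, ((c2 _ mR2).tendsto.mono_left ?_).congr' ?_, ?_⟩
  · rw [← nhdsWithin_Ioo_eq_nhdsLT (show S.R / 2 < S.R by linarith)]
    exact nhdsWithin_mono _ Ioo_subset_Icc_self
  · filter_upwards [Ioo_mem_nhdsLT (show S.R / 2 < S.R by linarith)] with r hr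
    refine sphereIntegral_congr (hJ1 ⟨hr.1.le, hr.2.le⟩) fun x hx => ?_
    have hxb : x ∈ ball (0 : E3) S.R := S.ball_eq_norm.2 (hx ▸ hr.2)
    rw [extendFrom_eq (subset_closure hxb) (hgin x hxb)]
  · exact nhdsWithin_mono _ Ioi_subset_Ici_self
  · filter_upwards [self_mem_nhdsWithin] with r hr
    refine sphereIntegral_congr (hJ2 (show S.R ≤ r from le_of_lt hr)) fun x hx => ?_
    have hxb : x ∈ (closedBall (0 : E3) S.R)ᶜ := by simpa [hx] using hr
    rw [extendFrom_eq (subset_closure hxb) (hgout x hxb)]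
  · have m1 := smul_mem_shell hJ1 mR1
    have m2 := smul_mem_shell hJ2 mR2
    have i1 := continuous_sphere_integrable (continuous_on_sphere s1 m1)
    have i2 := continuous_sphere_integrable (continuous_on_sphere s2 m2)
    unfold sphereIntegral
    rw [← integral_sub i2 i1, ← integral_mul_const, ← integral_const_mul, ← integral_neg]
    refine integral_congr_ae (Eventually.of_forall fun n => ?_)
    beta_reduce
    generalize hy : S.R • (n : E3) = y
    have hyR : ‖y‖ = S.R := hy ▸ norm_smul_sphere hR.le n
    obtain ⟨a, b, ha, hb, hab⟩ := h.surface_gravity 0 y (by simpa using hyR)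
    have e1 : extendFrom (ball 0 S.R) (∇ q.dΦ) y = a := extendFrom_eq (hcl1 (hy ▸ m1 n)) ha
    have e2 : extendFrom (closedBall 0 S.R)ᶜ (∇ q.dΦ) y = b := extendFrom_eq (hcl2 (hy ▸ m2 n)) hb
    have hl := h.surface_layer hn hyR
    have hu : ⟪‖y‖⁻¹ • y, ‖y‖⁻¹ • y⟫ = 1 := by
      rw [real_inner_self_eq_norm_sq, norm_smul, norm_inv, norm_norm, inv_mul_cancel₀ (by rw [hyR]; exact hR.ne')]
      norm_num
    have hab' := congrArg (fun z => ⟪z, ‖y‖⁻¹ • y⟫) hab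
    simp only [inner_sub_left, real_inner_smul_left _ _ (4 * Real.pi * S.ρ y * ⟪ξ 0 y, ‖y‖⁻¹ • y⟫), hu, mul_one] at hab'
    simp only [e1, e2]
    rw [eq_profile S.ρ_radial y, hyR] at hl hab'
    rw [hyR]
    -- The radial component of the jump contains ρ ξ^r, which the vanishing of the Lagrangian
    -- pressure change expresses through ρ δΦ.
    linear_combination (angular H y * S.grav S.R) * hab' + 4 * Real.pi * angular H y * hl

/-- The boundary term of the energy argument vanishes at the centre. -/
lemma IsStationary.centre_limit (h : IsStationary S q ξ) {l : ℕ} (hl : 1 ≤ l) {H : E3 → ℝ}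
    (hH : IsSolidHarmonic l H) {f k : ℝ → ℝ} (hf : f = sphereIntegral (fun x => q.dΦ x * angular H x))
    (hk : k = sphereIntegral (fun x => angular H x * ⟪∇ q.dΦ x, ‖x‖⁻¹ • x⟫)) :
    Tendsto (fun r => (r ^ 2 * k r * S.grav r - f r * (4 * Real.pi * r ^ 2 * profile S.ρ r - 2 * r * S.grav r))
      * (f r / S.grav r)) (𝓝[>] 0) (𝓝 0) := by
  have h0 : (0 : E3) ∈ ball (0 : E3) S.R := mem_ball_self S.R_pos
  set K := ∫ n : sphere (0 : E3) 1, |H n| ∂sphereMeasure with hK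
  have hK0 : 0 ≤ K := integral_nonneg fun n => abs_nonneg _
  have hHc := hH.smooth.continuous
  -- Since l ≥ 1, the constant δΦ(0) does not contribute to the projection, so f = O(r). Together
  -- with k = O(1) and g comparable to r, the bracket is O(r³) and f/g is bounded.
  obtain ⟨Cf, hCf, hfb⟩ : ∃ C ≥ 0, ∀ᶠ r in 𝓝[>] 0, |f r| ≤ C * r := by
    obtain ⟨C, hC, hb⟩ := (h.dΦ_diffAt h0).hasFDerivAt.isBigO_sub.exists_pos
    obtain ⟨ε, hε, hεb⟩ := Metric.eventually_nhds_iff.1 hb.bound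
    refine ⟨C * K, by positivity, ?_⟩
    filter_upwards [Ioo_mem_nhdsGT hε] with r hr
    have hr0 : 0 < r := hr.1
    have e : f r = sphereIntegral (fun x => (q.dΦ x - q.dΦ 0) * angular H x) r := by
      have h1 := sphereIntegral_angular_orthogonal (l := 0) (H := fun _ => 1)
        ⟨contDiff_const, fun x => (isHomog_const 1).laplacian_eq_zero (by norm_num) x, (isHomog_const 1).homogeneous⟩
        hH (by omega) hr0
      have e1 : angular (fun _ => (1 : ℝ)) = fun _ => 1 := rfl
      simp only [e1, one_mul] at h1
      simp only [sub_mul]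
      have hYc : ContinuousOn (angular H) (shell (Ioi 0)) := by
        rw [shell_Ioi]; exact hH.isHomog.angular_contDiffOn.continuousOn
      rw [sphereIntegral_sub (s := shell (Ioi 0)) (h.dΦ_cont.continuousOn.fun_mul hYc) (continuousOn_const.fun_mul hYc)
        (smul_mem_shell subset_rfl hr0), sphereIntegral_const_mul, h1, hf]
      ring
    rw [e]
    refine (sphereIntegral_mul_angular_bound (B := C * r) hHc hr0 fun x hx => ?_).trans (by rw [← hK]; linarith)
    have := hεb (y := x) (by simpa [hx] using hr.2)
    simpa [hx] using this
  obtain ⟨Ck, hCk, hkb⟩ : ∃ C ≥ 0, ∀ᶠ r in 𝓝[>] 0, |k r| ≤ C := by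
    have hc : ContinuousAt (∇ q.dΦ) 0 :=
      (gradient_contDiffOn (m := 1) isOpen_ball h.dΦ_inner (by norm_num)).continuousOn.continuousAt (isOpen_ball.mem_nhds h0)
    have hev : ∀ᶠ x in 𝓝 (0 : E3), ‖∇ q.dΦ x‖ < ‖∇ q.dΦ 0‖ + 1 :=
      hc.norm.eventually_lt continuousAt_const (by linarith)
    obtain ⟨ε, hε, hεb⟩ := Metric.eventually_nhds_iff.1 hev
    refine ⟨(‖∇ q.dΦ 0‖ + 1) * K, by positivity, ?_⟩
    filter_upwards [Ioo_mem_nhdsGT hε] with r hr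
    have hr0 : 0 < r := hr.1
    have e : k r = sphereIntegral (fun x => ⟪∇ q.dΦ x, ‖x‖⁻¹ • x⟫ * angular H x) r := by
      rw [hk]; exact sphereIntegral_congr hr0 fun x _ => mul_comm _ _
    rw [e]
    refine sphereIntegral_mul_angular_bound hHc hr0 fun x hx => ?_
    have := hεb (y := x) (by simpa [hx] using hr.2)
    refine (abs_real_inner_le_norm _ _).trans ?_
    rw [norm_smul, norm_inv, norm_norm, hx, inv_mul_cancel₀ hr0.ne', mul_one]
    exact this.le
  obtain ⟨Cρ, hCρ, hρb⟩ := S.exists_ρ_upper_bound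
  obtain ⟨Cg, hCg, hgb⟩ := S.exists_grav_upper_bound
  -- The density is bounded below on [0, R/2], away from the surface where it may vanish; this
  -- yields g ≥ c' r and bounds f/g.
  obtain ⟨c, hc, hcb⟩ := S.exists_ρ_lower_bound (δ := S.R / 2) ⟨by linarith [S.R_pos], by linarith [S.R_pos]⟩
  set c' := 4 * Real.pi / 3 * c with hc'
  have hc'0 : 0 < c' := by positivity
  set D := (Ck * Cg + Cf * (4 * Real.pi * Cρ + 2 * Cg)) * (Cf / c') with hD
  have hlim : Tendsto (fun r : ℝ => D * r ^ 3) (𝓝[>] 0) (𝓝 0) := by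
    have : Continuous fun r : ℝ => D * r ^ 3 := by fun_prop
    have := this.tendsto 0
    simp only [ne_eq, OfNat.ofNat_ne_zero, not_false_eq_true, zero_pow, mul_zero] at this
    exact this.mono_left nhdsWithin_le_nhds
  refine squeeze_zero_norm' ?_ hlim
  filter_upwards [hfb, hkb, hgb, Ioo_mem_nhdsGT (show 0 < S.R / 2 by linarith [S.R_pos])] with r h1 h2 h3 h4
  have hr0 : 0 < r := h4.1
  have hg0 := S.grav_pos hr0
  have h5 : c' * r ≤ S.grav r := S.grav_lower_bound (δ := S.R / 2) (by linarith [S.R_pos])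
    (fun t ht => hcb t ⟨ht.1.le, ht.2.le⟩) ⟨h4.1, h4.2.le⟩
  have h6 := hρb r ⟨hr0.le, by linarith [h4.2, S.R_pos]⟩
  rw [Real.norm_eq_abs, abs_mul, abs_div, abs_of_pos hg0]
  have b1 : |f r| / S.grav r ≤ Cf / c' := by
    rw [div_le_div_iff₀ hg0 hc'0]
    calc |f r| * c' ≤ Cf * r * c' := mul_le_mul_of_nonneg_right h1 hc'0.le
      _ = Cf * (c' * r) := by ring
      _ ≤ Cf * S.grav r := mul_le_mul_of_nonneg_left h5 hCf
  have b2 : |r ^ 2 * k r * S.grav r| ≤ Ck * Cg * r ^ 3 := by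
    rw [abs_mul, abs_mul, abs_of_pos hg0, abs_of_nonneg (by positivity : (0 : ℝ) ≤ r ^ 2)]
    calc r ^ 2 * |k r| * S.grav r ≤ r ^ 2 * Ck * (Cg * r) := by gcongr
      _ = _ := by ring
  have b3 : |f r * (4 * Real.pi * r ^ 2 * profile S.ρ r - 2 * r * S.grav r)|
      ≤ Cf * (4 * Real.pi * Cρ + 2 * Cg) * r ^ 3 := by
    rw [abs_mul]
    have : |4 * Real.pi * r ^ 2 * profile S.ρ r - 2 * r * S.grav r| ≤ (4 * Real.pi * Cρ + 2 * Cg) * r ^ 2 := by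
      refine (abs_sub _ _).trans ?_
      rw [abs_mul, abs_of_nonneg (by positivity : (0 : ℝ) ≤ 4 * Real.pi * r ^ 2),
        abs_of_nonneg (by positivity : (0 : ℝ) ≤ 2 * r * S.grav r)]
      calc 4 * Real.pi * r ^ 2 * |profile S.ρ r| + 2 * r * S.grav r
          ≤ 4 * Real.pi * r ^ 2 * Cρ + 2 * r * (Cg * r) := by gcongr
        _ = _ := by ring
    calc _ ≤ Cf * r * ((4 * Real.pi * Cρ + 2 * Cg) * r ^ 2) := by gcongr
      _ = _ := by ring
  have b4 := (abs_sub _ _).trans (add_le_add b2 b3)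
  calc _ ≤ (Ck * Cg * r ^ 3 + Cf * (4 * Real.pi * Cρ + 2 * Cg) * r ^ 3) * (Cf / c') := by gcongr
    _ = D * r ^ 3 := by rw [hD]; ring

/-- The projections of `δΦ` on spherical harmonics. -/
lemma IsStationary.mode_eq (h : IsStationary S q ξ) (hn : IsNonRadial S q) {l : ℕ} (hl : 1 ≤ l)
    {H : E3 → ℝ} (hH : IsSolidHarmonic l H) :
    ∃ c, (∀ r ∈ Ioi 0, sphereIntegral (fun x => q.dΦ x * angular H x) r = c * S.grav r) ∧ (2 ≤ l → c = 0) := by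
  obtain ⟨kin, kout, hkin, hkout, hj⟩ := h.surface_jump hn hH
  have hI0 : Ioo 0 S.R ⊆ Ioi 0 := fun _ h => h.1
  have in1 := fun r (hr : r ∈ Ioo 0 S.R) =>
    mode_equations isOpen_Ioo hI0 (h.dΦ_inner.mono S.shell_Ioo_subset) hH hr
  have out1 := fun r (hr : r ∈ Ioi S.R) =>
    mode_equations isOpen_Ioi S.Ioi_R_subset (φ := q.dΦ) (by rw [S.shell_Ioi_eq]; exact h.dΦ_outer) hH hr
  have hYc : ContinuousOn (angular H) (shell (Ioi 0)) := by
    rw [shell_Ioi]; exact hH.isHomog.angular_contDiffOn.continuousOn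
  have hfc : ContinuousAt (sphereIntegral (fun x => q.dΦ x * angular H x)) S.R := by
    have : LocallyCompactSpace (Ioi (0 : ℝ)) := isOpen_Ioi.isOpenEmbedding_subtypeVal.locallyCompactSpace
    exact (sphereIntegral_continuousOn (I := Ioi 0) (h.dΦ_cont.continuousOn.fun_mul hYc)
      (fun r hr n => smul_mem_shell subset_rfl hr n)).continuousAt (Ioi_mem_nhds S.R_pos)
  -- The source s is the projection of ΔδΦ = 4π δρ. Its required relation to ρ' f is the closure
  -- relation between δρ and δΦ, integrated against the harmonic.
  refine radial_rigidity S.R_pos hl (s := sphereIntegral (fun x => angular H x * Δ q.dΦ x))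
    (fun r hr => (in1 r hr).1) (fun r hr => (in1 r hr).2) (fun r hr => S.grav_hasDerivAt hr)
    (fun r hr => S.ρ_profile_hasDerivAt hr) ?_ (fun r hr => (out1 r hr).1) (fun r hr => ?_)
    (fun r hr => S.grav_hasDerivAt_outer hr) (fun r hr => S.grav_pos hr) hfc S.grav_continuous.continuousAt
    ?_ (h.centre_limit hl hH rfl rfl) hkin hkout ?_ hj
  · intro r hr
    rw [mul_comm, ← sphereIntegral_const_mul, ← sphereIntegral_const_mul]
    refine sphereIntegral_congr hr.1 fun x hx => ?_
    have hx0 : x ≠ 0 := norm_pos_iff.1 (hx ▸ hr.1)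
    have hxb : x ∈ ball (0 : E3) S.R := S.ball_eq_norm.2 (hx ▸ hr.2)
    have := h.dρ_mul_grav hn hx0 hxb
    rw [hx] at this
    rw [h.poisson_inner x hxb]
    linear_combination (4 * Real.pi * angular H x) * this
  · refine (out1 r hr).2.congr_deriv ?_
    rw [sphereIntegral_congr (f := fun x => angular H x * Δ q.dΦ x) (g := fun _ => 0) (S.R_pos.trans hr)]
    · simp [sphereIntegral]
    · intro x hx
      rw [h.poisson_outer x (by rw [← S.shell_Ioi_eq]; simpa [shell, hx] using hr), mul_zero]
  -- The projection is bounded by the supremum of |δΦ| on the sphere times a constant, so it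
  -- inherits the decay of δΦ. Adding 1 to K avoids division by zero.
  · rw [Metric.tendsto_atTop]
    intro ε hε
    set K := ∫ n : sphere (0 : E3) 1, |H n| ∂sphereMeasure with hK
    have hK0 : 0 ≤ K := integral_nonneg fun n => abs_nonneg _
    have hev := h.dΦ_infinity.eventually (Metric.ball_mem_nhds 0 (show 0 < ε / (K + 1) by positivity))
    rw [← Metric.cobounded_eq_cocompact, ← comap_norm_atTop, eventually_comap] at hev
    obtain ⟨N, hN⟩ := eventually_atTop.1 hev
    refine ⟨max N 1, fun r hr => ?_⟩
    have hr0 : 0 < r := lt_of_lt_of_le one_pos ((le_max_right _ _).trans hr)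
    rw [dist_zero_right, Real.norm_eq_abs]
    refine (sphereIntegral_mul_angular_bound (B := ε / (K + 1)) hH.smooth.continuous hr0 fun x hx => ?_).trans_lt ?_
    · have := hN r ((le_max_left _ _).trans hr) x hx
      simpa using (mem_ball.1 this).le
    · rw [← hK, div_mul_eq_mul_div, div_lt_iff₀ (by positivity)]
      nlinarith
  · have := (S.ρ_profile_continuousOn S.R ⟨S.R_pos.le, le_rfl⟩).tendsto
    refine this.mono_left ?_
    rw [← nhdsWithin_Ioo_eq_nhdsLT S.R_pos]
    exact nhdsWithin_mono _ Ioo_subset_Icc_self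

/-- `δΦ` is the change of the potential in a rigid translation. -/
lemma IsStationary.exists_dΦ_eq (h : IsStationary S q ξ) (hn : IsNonRadial S q) :
    ∃ c : E3, ∀ x, q.dΦ x = ⟪c, ∇ S.Φ x⟫ := by
  -- The constants of proportionality for an orthonormal basis of degree-one harmonics are the
  -- coefficients of a linear function G; the translation vector is its gradient.
  obtain ⟨d, Y, hY, hYo, hYs⟩ := exists_harmonic_basis 1
  choose c hc _ using fun i => h.mode_eq hn le_rfl (hY i)
  have hGm : (∑ i, c i • Y i) ∈ solidSubmodule 1 := Submodule.sum_mem _ fun i _ => Submodule.smul_mem _ _ (hY i)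
  set G : E3 → ℝ := ∑ i, c i • Y i with hG
  have hGs : IsSolidHarmonic 1 G := hGm
  have hGe : ∀ x, G x = ∑ i, c i * Y i x := fun x => by simp [hG, Finset.sum_apply]
  refine ⟨∇ G 0, fun x => ?_⟩
  have hoff : ∀ x ∈ ({0}ᶜ : Set E3), q.dΦ x = ⟪∇ G 0, ∇ S.Φ x⟫ := by
    intro x hx0
    have hr : 0 < ‖x‖ := norm_pos_iff.2 hx0
    have hcont : ContinuousOn (fun z => q.dΦ z - S.grav ‖z‖ * angular G z) {0}ᶜ :=
      h.dΦ_cont.continuousOn.sub ((S.grav_continuous.comp continuous_norm).continuousOn.fun_mul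
        hGs.isHomog.angular_contDiffOn.continuousOn)
    have hm : ∀ n : sphere (0 : E3) 1, ‖x‖ • (n : E3) ∈ ({0}ᶜ : Set E3) := fun n =>
      smul_ne_zero hr.ne' (sphere_ne_zero n)
    -- All projections of δΦ - g Y_G vanish: in degree 0 because δΦ has no mean, in degree 1 by the
    -- choice of G, in higher degrees because both terms have zero projection.
    have hz := eq_zero_of_orthogonal_harmonics (f := fun z => q.dΦ z - S.grav ‖z‖ * angular G z) hr
      (continuous_on_sphere hcont hm) (fun l H hH => ?_) (x := x) rfl
    · rw [sub_eq_zero] at hz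
      rw [hz, S.gradient_Φ hx0, real_inner_smul_right, ← hGs.isHomog.eq_inner_gradient]
      rfl
    · have hHc := hH.isHomog.angular_contDiffOn.continuousOn
      have e : sphereIntegral (fun z => (q.dΦ z - S.grav ‖z‖ * angular G z) * angular H z) ‖x‖
          = sphereIntegral (fun z => q.dΦ z * angular H z) ‖x‖
            - S.grav ‖x‖ * sphereIntegral (fun z => angular G z * angular H z) ‖x‖ := by
        rw [← sphereIntegral_const_mul, ← sphereIntegral_sub (s := {0}ᶜ) (h.dΦ_cont.continuousOn.fun_mul hHc)
          (continuousOn_const.fun_mul (hGs.isHomog.angular_contDiffOn.continuousOn.fun_mul hHc)) hm]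
        exact sphereIntegral_congr hr fun z hz => by rw [hz]; ring
      rw [e]
      rcases lt_trichotomy l 1 with hl | hl | hl
      · obtain rfl : l = 0 := by omega
        rw [sphereIntegral_angular_orthogonal hGs hH (by norm_num) hr]
        simp only [angular_const_of_degree_zero hH.isHomog, mul_comm _ (H 0)]
        rw [sphereIntegral_const_mul, hn.dΦ_mean _ hr]
        ring
      · subst hl
        have e1 : sphereIntegral (fun z => q.dΦ z * angular H z) ‖x‖
            = ∑ i, (∫ n : sphere (0 : E3) 1, Y i n * H n ∂sphereMeasure) * (c i * S.grav ‖x‖) := by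
          have : ∀ z, q.dΦ z * angular H z
              = ∑ i, (∫ n : sphere (0 : E3) 1, Y i n * H n ∂sphereMeasure) * (q.dΦ z * angular (Y i) z) := by
            intro z
            rw [angular, hYs H hH, Finset.mul_sum]
            refine Finset.sum_congr rfl fun i _ => ?_
            rw [angular]; ring
          simp only [this]
          unfold sphereIntegral
          rw [integral_finsetSum]
          · refine Finset.sum_congr rfl fun i _ => ?_
            rw [integral_const_mul]
            congr 1
            exact hc i _ hr
          · intro i _
            exact (continuous_sphere_integrable (continuous_on_sphere (h.dΦ_cont.continuousOn.fun_mul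
              (hY i).isHomog.angular_contDiffOn.continuousOn) hm)).const_mul _
        have e2 : sphereIntegral (fun z => angular G z * angular H z) ‖x‖
            = ∑ i, c i * ∫ n : sphere (0 : E3) 1, Y i n * H n ∂sphereMeasure := by
          unfold sphereIntegral
          simp only [angular_sphere _ hr, hGe, Finset.sum_mul, mul_assoc]
          rw [integral_finsetSum]
          · simp only [integral_const_mul]
          · intro i _
            have c1 := (hY i).smooth.continuous
            have c2 := hH.smooth.continuous
            exact (continuous_sphere_integrable (by fun_prop)).const_mul _
        rw [e1, e2, Finset.mul_sum, sub_eq_zero]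
        exact Finset.sum_congr rfl fun i _ => by ring
      · obtain ⟨c', hc', hc'0⟩ := h.mode_eq hn (by omega) hH
        rw [hc' _ hr, hc'0 (by omega), sphereIntegral_angular_orthogonal hGs hH (by omega) hr]
        ring
  exact congrFun (Continuous.ext_on (dense_compl_singleton 0) h.dΦ_cont
    (continuous_const.inner S.gradient_Φ_continuous) hoff) x

/-- Once δΦ is known, δp and δρ follow algebraically. For δρ one divides by g, which is nonzero off
the centre only, and the centre is filled in by continuity. -/
lemma IsStationary.exists_translation (h : IsStationary S q ξ) (hn : IsNonRadial S q) :
    ∃ c : E3, IsTranslation S c q := by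
  obtain ⟨c, hc⟩ := h.exists_dΦ_eq hn
  refine ⟨c, ?_, fun x hx => ?_, hc⟩
  · have hoff : ∀ x, x ≠ 0 → x ∈ ball (0 : E3) S.R → q.dρ x = ⟪c, ∇ S.ρ x⟫ := by
      intro x hx0 hx
      have h1 := h.dρ_mul_grav hn hx0 hx
      have hg := (S.grav_pos (norm_pos_iff.2 hx0)).ne'
      rw [hc, S.gradient_Φ hx0, real_inner_smul_right] at h1
      rw [S.gradient_ρ hx0 hx, real_inner_smul_right]
      apply mul_right_cancel₀ hg
      rw [h1]; ring
    intro x hx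
    by_cases hx0 : x = 0
    · subst hx0
      have hc1 : ContinuousAt q.dρ 0 := h.dρ_cont.continuousAt (isOpen_ball.mem_nhds hx)
      have hc2 : ContinuousAt (∇ S.ρ) 0 :=
        (gradient_contDiffOn (m := 0) isOpen_ball S.ρ_smooth (by simp)).continuousOn.continuousAt (isOpen_ball.mem_nhds hx)
      refine tendsto_nhds_unique (hc1.tendsto.mono_left (nhdsWithin_le_nhds (s := {0}ᶜ)))
        (((continuousAt_const.inner (𝕜 := ℝ) hc2).tendsto.mono_left nhdsWithin_le_nhds).congr' ?_)
      filter_upwards [self_mem_nhdsWithin, mem_nhdsWithin_of_mem_nhds (isOpen_ball.mem_nhds hx)] with z hz hzb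
      exact (hoff z hz hzb).symm
    · exact hoff x hx0 hx
  · rw [h.dp_eq_neg hn hx, hc, S.gradient_p hx, real_inner_smul_right]; ring

/-- Along the ray t c, outside the star, |x|² δΦ has the constant value R² g(R) |c| by the inverse
square law, so the absence of a dipole term forces c = 0. -/
lemma IsTranslation.scalarsVanish {c : E3} (h : IsTranslation S c q) (hq : IsCentred q) : ScalarsVanish S q := by
  have hc0 : c = 0 := by
    by_contra hc
    have hcn : 0 < ‖c‖ := norm_pos_iff.2 hc
    have ht : Tendsto (fun t : ℝ => t • c) atTop (cocompact E3) := by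
      rw [← Metric.cobounded_eq_cocompact, ← tendsto_norm_atTop_iff_cobounded]
      refine (tendsto_id.atTop_mul_const hcn).congr' ?_
      filter_upwards [eventually_ge_atTop 0] with t ht
      rw [norm_smul, Real.norm_of_nonneg ht, id]
    have h1 := hq.comp ht
    have h2 : Tendsto ((fun x => ‖x‖ ^ 2 * q.dΦ x) ∘ fun t : ℝ => t • c) atTop
        (𝓝 (S.R ^ 2 * S.grav S.R * ‖c‖)) := by
      refine tendsto_const_nhds.congr' ?_
      filter_upwards [eventually_gt_atTop 0, eventually_gt_atTop (S.R / ‖c‖)] with t ht0 ht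
      have hn : ‖t • c‖ = t * ‖c‖ := by rw [norm_smul, Real.norm_of_nonneg ht0.le]
      have hx0 : t • c ≠ 0 := smul_ne_zero ht0.ne' hc
      have hR : t * ‖c‖ ∈ Ioi S.R := (div_lt_iff₀ hcn).1 ht
      rw [← S.grav_outer hR]
      simp only [Function.comp]
      rw [h.dΦ_eq, S.gradient_Φ hx0, real_inner_smul_right, real_inner_smul_right, real_inner_smul_right,
        real_inner_self_eq_norm_sq, hn]
      field_simp
    have h3 := tendsto_nhds_unique h1 h2
    have := S.R_pos
    have := S.grav_R_pos
    have : 0 < S.R ^ 2 * S.grav S.R * ‖c‖ := by positivity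
    linarith
  subst hc0
  exact ⟨fun x hx => by rw [h.dρ_eq x hx, inner_zero_left], fun x hx => by rw [h.dp_eq x hx, inner_zero_left],
    fun x => by rw [h.dΦ_eq x, inner_zero_left]⟩

end

/-! ### Currents -/

/-- The conditions on the velocity field of a stationary perturbation. -/
structure IsCurrent (S : BarotropicStar) (v : E3 → E3) : Prop where
  smooth : ContDiffOn ℝ 1 v (closedBall 0 S.R)
  mass : ∀ x ∈ ball (0 : E3) S.R, divergence (fun z => S.ρ z • v z) x = 0
  surface : ∀ y ∈ sphere (0 : E3) S.R, S.ρ y * ⟪v y, y⟫ = 0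

section
variable {S : BarotropicStar} {γ : ℝ → ℝ} {q : Perturbation} {ξ : ℝ → E3 → E3} {v : E3 → E3}

/-- The velocity is independent of time, so ξ is affine in t. Comparing the conditions at times 0
and 1 therefore isolates their linear part, a condition on δv alone. -/
lemma IsStationary.displacement_eq (h : IsStationary S q ξ) (t : ℝ) {x : E3} (hx : x ∈ closedBall (0 : E3) S.R) :
    ξ t x = ξ 0 x + t • q.dv x := by
  have hd : ∀ s, HasDerivAt (fun s => ξ s x - s • q.dv x) 0 s := fun s => by
    simpa using (h.ξ_velocity s x hx).fun_sub ((hasDerivAt_id s).smul_const (q.dv x))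
  have := is_const_of_deriv_eq_zero (fun s => (hd s).differentiableAt) (fun s => (hd s).deriv) t 0
  rw [zero_smul, sub_zero] at this
  rw [← this]; abel

lemma neBot_nhdsWithin_ball {y : E3} {R : ℝ} (hR : 0 < R) (hy : y ∈ closedBall (0 : E3) R) :
    (𝓝[ball (0 : E3) R] y).NeBot := by
  rw [← mem_closure_iff_nhdsWithin_neBot, closure_ball _ hR.ne']; exact hy

/-- No continuity of ∇p up to the surface is assumed; it is replaced by -ρ ∇Φ, whose factors are
continuous there. -/
lemma BarotropicStar.tendsto_inner_gradient_p (hv : ContinuousOn v (closedBall 0 S.R)) {y : E3}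
    (hy : y ∈ sphere (0 : E3) S.R) :
    Tendsto (fun x => ⟪v x, ∇ S.p x⟫) (𝓝[ball 0 S.R] y) (𝓝 (-(S.grav S.R * ‖y‖⁻¹) * (S.ρ y * ⟪v y, y⟫))) := by
  have hyc : y ∈ closedBall (0 : E3) S.R := sphere_subset_closedBall hy
  have hyR : ‖y‖ = S.R := by simpa using hy
  have hy0 : y ≠ 0 := norm_pos_iff.1 (hyR ▸ S.R_pos)
  have hle : 𝓝[ball 0 S.R] y ≤ 𝓝[closedBall 0 S.R] y := nhdsWithin_mono _ ball_subset_closedBall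
  have c1 : Tendsto S.ρ (𝓝[ball 0 S.R] y) (𝓝 (S.ρ y)) := (S.ρ_cont y hyc).tendsto.mono_left hle
  have c3 : Tendsto v (𝓝[ball 0 S.R] y) (𝓝 (v y)) := (hv y hyc).tendsto.mono_left hle
  have c4 : Tendsto (∇ S.Φ) (𝓝[ball 0 S.R] y) (𝓝 (∇ S.Φ y)) :=
    S.gradient_Φ_continuous.tendsto y |>.mono_left nhdsWithin_le_nhds
  have h := c1.neg.mul (c3.inner (𝕜 := ℝ) c4)
  have e : -(S.grav S.R * ‖y‖⁻¹) * (S.ρ y * ⟪v y, y⟫) = -(S.ρ y) * ⟪v y, ∇ S.Φ y⟫ := by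
    rw [S.gradient_Φ hy0, real_inner_smul_right, real_inner_smul_right, hyR]; ring
  rw [e]
  refine h.congr' ?_
  filter_upwards [self_mem_nhdsWithin] with x hx
  rw [S.gradient_p hx, real_inner_smul_right]

/-- Subtracting the pressure conditions at times 1 and 0 eliminates δp and the initial displacement
and leaves δv · ∇p → 0 at the surface. Since g(R) > 0 this says ρ v^r = 0. -/
lemma IsStationary.isCurrent (h : IsStationary S q ξ) : IsCurrent S q.dv := by
  refine ⟨h.dv_smooth, h.mass, fun y hy => ?_⟩
  have hyc : y ∈ closedBall (0 : E3) S.R := sphere_subset_closedBall hy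
  have hyR : ‖y‖ = S.R := by simpa using hy
  have := neBot_nhdsWithin_ball S.R_pos hyc
  have t := (h.surface_pressure 1 y hy).sub (h.surface_pressure 0 y hy)
  have t2 := tendsto_nhds_unique (S.tendsto_inner_gradient_p h.dv_smooth.continuousOn hy) (t.congr' (by
    filter_upwards [self_mem_nhdsWithin] with x hx
    rw [h.displacement_eq 1 (ball_subset_closedBall hx), inner_add_left, one_smul]
    ring))
  have h1 : S.grav S.R * ‖y‖⁻¹ ≠ 0 := by
    rw [hyR]; exact (mul_pos S.grav_R_pos (inv_pos.2 S.R_pos)).ne'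
  rw [sub_self] at t2
  exact (mul_eq_zero.1 t2).resolve_left (neg_ne_zero.2 h1)

lemma IsCurrent.isStationary (h : IsCurrent S v) : IsStationary S (current v) (fun t => t • v) where
  dρ_cont := continuousOn_const
  dp_smooth := contDiffOn_const
  dΦ_cont := continuous_const
  dΦ_inner := contDiffOn_const
  dΦ_outer := contDiffOn_const
  dv_smooth := h.smooth
  mass := h.mass
  euler x _ := by simp [current]
  poisson_inner x _ := by
    simp only [current, mul_zero]
    exact (isHomog_const 0).laplacian_eq_zero (by norm_num) x
  poisson_outer x _ := (isHomog_const 0).laplacian_eq_zero (by norm_num) x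
  dΦ_infinity := tendsto_const_nhds
  ξ_cont t := h.smooth.continuousOn.const_smul t
  ξ_velocity t x _ := by simpa [current] using (hasDerivAt_id t).smul_const (v x)
  surface_pressure t y hy := by
    have := (S.tendsto_inner_gradient_p h.smooth.continuousOn hy).const_mul t
    rw [h.surface y hy, mul_zero, mul_zero] at this
    refine this.congr fun x => ?_
    simp [current]
  surface_gravity t y hy := by
    refine ⟨0, 0, ?_, ?_, ?_⟩
    · simpa [current] using tendsto_const_nhds
    · simpa [current] using tendsto_const_nhds
    · have e : 4 * Real.pi * S.ρ y * ⟪(t • v) y, ‖y‖⁻¹ • y⟫ = 4 * Real.pi * t * ‖y‖⁻¹ * (S.ρ y * ⟪v y, y⟫) := by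
        rw [Pi.smul_apply, real_inner_smul_left, real_inner_smul_right]; ring
      rw [e, h.surface y hy]; simp

/-- In one direction the adiabatic relations at times 0 and 1 are subtracted. In the other, the
displacement t v works: every condition is linear in it. -/
lemma isZeroFrequency_current_iff : IsZeroFrequency S γ (current v) ↔ IsCurrent S v ∧
    ∀ x ∈ ball (0 : E3) S.R, ⟪v x, ∇ S.ρ x⟫ / S.ρ x - ⟪v x, ∇ S.p x⟫ / (γ ‖x‖ * S.p x) = 0 := by
  constructor
  · rintro ⟨ξ, h, ha⟩
    refine ⟨h.isCurrent, fun x hx => ?_⟩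
    have h1 := ha 1 x hx
    have h0 := ha 0 x hx
    rw [h.displacement_eq 1 (ball_subset_closedBall hx)] at h1
    simp only [current, one_smul, inner_add_left, zero_div, zero_add, add_div] at h0 h1
    linarith
  · rintro ⟨h, ha⟩
    refine ⟨_, h.isStationary, fun t x hx => ?_⟩
    have := ha x hx
    simp only [current, Pi.smul_apply, real_inner_smul_left, mul_div_assoc, zero_div, zero_add]
    rw [← mul_sub, this, mul_zero]

/-! ### Isentropic stars -/

lemma BarotropicStar.gradient_p_eq_deriv_eos {x : E3} (hx0 : x ≠ 0) (hx : x ∈ ball (0 : E3) S.R) :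
    ∇ S.p x = deriv S.eos (S.ρ x) • ∇ S.ρ x := by
  have h1 : HasFDerivAt (fun z => S.eos (S.ρ z)) (deriv S.eos (S.ρ x) • fderiv ℝ S.ρ x) x :=
    (S.eos_diff x hx hx0).hasDerivAt.comp_hasFDerivAt x (S.ρ_diffAt hx).hasFDerivAt
  have e : S.p =ᶠ[𝓝 x] fun z => S.eos (S.ρ z) := by
    filter_upwards [isOpen_ball.mem_nhds hx] with z hz using S.eos_eq z hz
  refine ext_inner_right ℝ fun y => ?_
  rw [real_inner_smul_left, inner_grad, inner_grad, e.fderiv_eq, h1.fderiv]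
  rfl

/-- For γ = Γ the bracket ρ'/ρ - p'/(γ p) vanishes by the chain rule for the equation of state, so
the adiabatic relation puts no constraint on the displacement. Positivity of γ rules out dp/dρ = 0.
At the centre both gradients vanish. -/
lemma BarotropicStar.IsIsentropic.adiabatic (hS : S.IsIsentropic γ) (hγ : ∀ r ∈ Ico 0 S.R, 0 < γ r) (w : E3)
    {x : E3} (hx : x ∈ ball (0 : E3) S.R) :
    ⟪w, ∇ S.ρ x⟫ / S.ρ x - ⟪w, ∇ S.p x⟫ / (γ ‖x‖ * S.p x) = 0 := by
  by_cases hx0 : x = 0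
  · subst hx0
    rw [gradient_radial_zero S.ρ_radial, gradient_radial_zero S.p_radial]; simp
  · have hp := (S.p_pos x hx).ne'
    have hρ := (S.ρ_pos x hx).ne'
    have hg := hγ ‖x‖ ⟨norm_nonneg x, S.ball_eq_norm.1 hx⟩
    have e := hS x hx hx0
    rw [e] at hg
    rw [e, BarotropicStar.Gam, S.gradient_p_eq_deriv_eos hx0 hx, real_inner_smul_right]
    have hd : deriv S.eos (S.ρ x) ≠ 0 := by
      intro h0
      rw [BarotropicStar.Gam, h0, mul_zero] at hg
      exact lt_irrefl _ hg
    field_simp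
    ring

/-- The bracket f depends on the radius only and is continuous. If it were nonzero at some radius,
it would be so on a whole shell, where the radial component of v would then have to vanish. -/
lemma isIsentropic_of_adiabatic (hγ : ContinuousOn γ (Ico 0 S.R)) (hγ0 : ∀ r ∈ Ico 0 S.R, 0 < γ r)
    (hv : RadialNonvanishing S.R v)
    (ha : ∀ x ∈ ball (0 : E3) S.R, ⟪v x, ∇ S.ρ x⟫ / S.ρ x - ⟪v x, ∇ S.p x⟫ / (γ ‖x‖ * S.p x) = 0) :
    S.IsIsentropic γ := by
  set f : ℝ → ℝ := fun r => S.dρ r / profile S.ρ r + profile S.ρ r * S.grav r / (γ r * profile S.p r) with hf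
  have hmaps : MapsTo (fun r : ℝ => r • unitVec 0) (Ioo 0 S.R) (ball 0 S.R) := fun r hr => S.smul_unitVec_mem hr
  have hlin : ContinuousOn (fun r : ℝ => r • unitVec 0) (Ioo 0 S.R) := by fun_prop
  have hppos : ∀ r ∈ Ioo 0 S.R, 0 < profile S.p r := fun r hr => S.p_pos _ (S.smul_unitVec_mem hr)
  have hfc : ContinuousOn f (Ioo 0 S.R) := by
    have c1 : ContinuousOn S.dρ (Ioo 0 S.R) :=
      ((contDiffOn_fderiv_continuousOn isOpen_ball S.ρ_smooth).comp hlin hmaps).clm_apply continuousOn_const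
    have c2 : ContinuousOn (profile S.ρ) (Ioo 0 S.R) := S.ρ_profile_continuousOn.mono Ioo_subset_Icc_self
    have c3 : ContinuousOn (profile S.p) (Ioo 0 S.R) := S.p_cont.comp_continuousOn hlin
    have c4 : ContinuousOn γ (Ioo 0 S.R) := hγ.mono Ioo_subset_Ico_self
    refine (c1.div c2 fun r hr => (S.ρ_profile_pos (Ioo_subset_Ico_self hr)).ne').add
      ((c2.mul S.grav_continuous.continuousOn).div (c4.mul c3) fun r hr => ?_)
    exact (mul_pos (hγ0 r (Ioo_subset_Ico_self hr)) (hppos r hr)).ne'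
  have hzero : ∀ x, ‖x‖ ∈ Ioo 0 S.R → ⟪v x, x⟫ ≠ 0 → f ‖x‖ = 0 := by
    intro x hr hvx
    have hx := S.mem_ball_of_Ioo hr
    have hx0 : x ≠ 0 := norm_pos_iff.1 hr.1
    have h1 := ha x hx
    rw [S.gradient_p hx, S.gradient_ρ hx0 hx, S.gradient_Φ hx0, eq_profile S.ρ_radial x,
      eq_profile S.p_radial x] at h1
    simp only [real_inner_smul_right] at h1
    have e : f ‖x‖ * (‖x‖⁻¹ * ⟪v x, x⟫) = 0 := by
      rw [hf, ← h1]; ring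
    exact (mul_eq_zero.1 e).resolve_right (mul_ne_zero (inv_ne_zero hr.1.ne') hvx)
  intro x hx hx0
  have hr : ‖x‖ ∈ Ioo 0 S.R := ⟨norm_pos_iff.2 hx0, S.ball_eq_norm.1 hx⟩
  have hfx : f ‖x‖ = 0 := by
    by_contra hne
    have hev := (hfc.continuousAt (isOpen_Ioo.mem_nhds hr)).eventually_ne hne
    obtain ⟨a, b, hab, hs⟩ := mem_nhds_iff_exists_Ioo_subset.1 (hev.and (isOpen_Ioo.mem_nhds hr))
    have h1 : a < b := hab.1.trans hab.2
    obtain ⟨z, hz1, hz2, hz3⟩ := hv (max a 0) (min b S.R) (le_max_right _ _)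
      (max_lt (lt_min h1 (lt_of_le_of_lt (le_of_lt (hab.1)) hr.2))
        (lt_min (hr.1.trans hab.2) S.R_pos)) (min_le_right _ _)
    have := hs ⟨(le_max_left _ _).trans_lt hz1, hz2.trans_le (min_le_left _ _)⟩
    exact this.1 (hzero z this.2 hz3)
  have hp := hppos _ hr
  have hρ := S.ρ_profile_pos (Ioo_subset_Ico_self hr)
  have hg := S.grav_pos hr.1
  have hγx := hγ0 _ (Ioo_subset_Ico_self hr)
  have h2 := S.gradient_p_eq_deriv_eos hx0 hx
  rw [S.gradient_p hx, S.gradient_Φ hx0, S.gradient_ρ hx0 hx, ← mul_smul, ← mul_smul _ (S.dρ ‖x‖)] at h2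
  have h3 := smul_left_injective ℝ (smul_ne_zero (inv_ne_zero (norm_ne_zero_iff.2 hx0)) hx0) h2
  rw [BarotropicStar.Gam]
  rw [eq_profile S.ρ_radial x] at h3 ⊢
  rw [eq_profile S.p_radial x]
  simp only [hf] at hfx
  -- The pressure gradient -ρ g is nonzero off the centre and equals (dp/dρ) ρ', so ρ' cannot vanish
  -- and may be cancelled.
  have hd : S.dρ ‖x‖ ≠ 0 := by
    intro h0
    rw [h0, mul_zero] at h3
    have := mul_pos hρ hg
    linarith
  field_simp at hfx ⊢
  have e : S.dρ ‖x‖ * (γ ‖x‖ * profile S.p ‖x‖ - profile S.ρ ‖x‖ * deriv S.eos (profile S.ρ ‖x‖)) = 0 := by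
    linear_combination hfx + profile S.ρ ‖x‖ * h3
  exact sub_eq_zero.1 ((mul_eq_zero.1 e).resolve_left hd)

end

/-! ### Sectoral harmonics -/

/-- The map `x ↦ x₀ + i x₁`. -/
def complexCoord : E3 →L[ℝ] ℂ :=
  LinearMap.toContinuousLinearMap
    { toFun := fun x => ⟨x 0, x 1⟩
      map_add' := fun x y => by apply Complex.ext <;> simp
      map_smul' := fun c x => by apply Complex.ext <;> simp }

lemma complexCoord_apply (x : E3) : complexCoord x = ⟨x 0, x 1⟩ := rfl

lemma hasFDerivAt_re_complexCoord_pow (c : ℂ) (n : ℕ) (x : E3) :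
    HasFDerivAt (fun z => (c * complexCoord z ^ n).re)
      (Complex.reCLM.comp ((c * (n * complexCoord x ^ (n - 1))) • complexCoord)) x := by
  have h1 : HasFDerivAt (fun z => complexCoord z ^ n) ((n * complexCoord x ^ (n - 1)) • complexCoord) x :=
    (hasDerivAt_pow n (complexCoord x)).comp_hasFDerivAt x complexCoord.hasFDerivAt
  refine (Complex.reCLM.hasFDerivAt.comp x (h1.const_mul c)).congr_fderiv ?_
  rw [smul_smul]

/-- The real part of a holomorphic function of x₀ + i x₁ is harmonic: the second derivatives along
the two axes carry the factors 1 and i². -/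
lemma isSolidHarmonic_sectoral (l : ℕ) : IsSolidHarmonic l (fun x => (complexCoord x ^ l).re) := by
  have hs : ContDiff ℝ ∞ (fun x : E3 => (complexCoord x ^ l).re) :=
    Complex.reCLM.contDiff.comp (complexCoord.contDiff.pow l)
  refine ⟨hs, fun x => ?_, fun c x => ?_⟩
  · rw [laplacian_eq_sum (hs.of_le two_le_infty)]
    have h1 : ∀ z v, fderiv ℝ (fun x : E3 => (complexCoord x ^ l).re) z v
        = ((l * complexCoord v) * complexCoord z ^ (l - 1)).re := by
      intro z v
      have := (hasFDerivAt_re_complexCoord_pow 1 l z).fderiv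
      simp only [one_mul] at this
      rw [this]
      simp only [ContinuousLinearMap.comp_apply, smul_apply, smul_eq_mul, Complex.reCLM_apply]
      congr 1; ring
    simp only [h1, (hasFDerivAt_re_complexCoord_pow _ (l - 1) x).fderiv]
    simp only [Fin.sum_univ_three, ContinuousLinearMap.comp_apply, smul_apply, smul_eq_mul,
      Complex.reCLM_apply, ← Complex.add_re]
    have e0 : complexCoord (unitVec 0) = 1 := by apply Complex.ext <;> simp [complexCoord_apply, unitVec]
    have e1 : complexCoord (unitVec 1) = Complex.I := by apply Complex.ext <;> simp [complexCoord_apply, unitVec]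
    have e2 : complexCoord (unitVec 2) = 0 := by apply Complex.ext <;> simp [complexCoord_apply, unitVec]
    rw [e0, e1, e2]
    have : ∀ a b : ℂ, a * 1 * b * 1 + a * Complex.I * b * Complex.I + a * 0 * b * 0 = 0 := by
      intro a b
      linear_combination a * b * Complex.I_mul_I
    rw [this]; rfl
  · simp only [map_smul, Complex.real_smul, mul_pow]
    rw [← Complex.ofReal_pow, Complex.re_ofReal_mul]

/-- The current `∇H × x`. -/
lemma cross_gradient_eq_axialField {l : ℕ} {H : E3 → ℝ} (hH : IsHomog l H) {x : E3} (hx : x ≠ 0) :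
    cross (∇ H x) x = ‖x‖ ^ (l + 1) • axialField H x := by
  have hn := norm_ne_zero_iff.2 hx
  rw [axialField, hH.gradient_angular hx, cross_sub_left, cross_smul_left, cross_smul_left, cross_smul_right,
    cross_smul_right, cross_self', smul_zero, smul_zero, sub_zero, smul_smul, smul_smul]
  conv_lhs => rw [← one_smul ℝ (cross (∇ H x) x)]
  congr 1
  rw [inv_pow]
  field_simp
  ring

lemma exists_cross_gradient_ne_zero {l : ℕ} (hl : 1 ≤ l) {R : ℝ} (hR : 0 < R) :
    ∃ H, IsSolidHarmonic l H ∧ ∃ x ∈ ball (0 : E3) R, cross (∇ H x) x ≠ 0 := by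
  -- At this point x₀ + i x₁ is the positive number R/4, so the gradient has a positive first and a
  -- zero third component. As the third coordinate is also R/4, the second component of the vector
  -- product is nonzero.
  refine ⟨_, isSolidHarmonic_sectoral l, (R / 4) • (unitVec 0 + unitVec 2), ?_, fun h => ?_⟩
  · rw [mem_ball_zero_iff, norm_smul, Real.norm_of_nonneg (by positivity)]
    have : ‖unitVec 0 + unitVec 2‖ ≤ 2 := (norm_add_le _ _).trans (by simp [unitVec]; norm_num)
    nlinarith
  · have h1 := congrArg (fun z : E3 => z 1) h
    simp only [cross_one, gradient_coord] at h1
    have h2 := fun z => (hasFDerivAt_re_complexCoord_pow 1 l z).fderiv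
    simp only [one_mul] at h2
    have e : complexCoord ((R / 4) • (unitVec 0 + unitVec 2)) = ((R / 4 : ℝ) : ℂ) := by
      apply Complex.ext <;> simp [complexCoord_apply, unitVec]
    have e0 : complexCoord (unitVec 0) = 1 := by apply Complex.ext <;> simp [complexCoord_apply, unitVec]
    have e2 : complexCoord (unitVec 2) = 0 := by apply Complex.ext <;> simp [complexCoord_apply, unitVec]
    simp only [h2, ContinuousLinearMap.comp_apply, smul_apply, smul_eq_mul,
      Complex.reCLM_apply, e, e0, e2, mul_zero, mul_one] at h1
    rw [← Complex.ofReal_pow, ← Complex.ofReal_natCast, ← Complex.ofReal_mul, Complex.ofReal_re] at h1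
    have h3 : ((R / 4) • (unitVec 0 + unitVec 2)) 2 = R / 4 := by simp [unitVec]
    rw [h3] at h1
    have h4 : 0 < (l : ℝ) * (R / 4) ^ (l - 1) * (R / 4) := by
      have : (0 : ℝ) < l := by exact_mod_cast hl
      positivity
    simp only [Complex.zero_re, zero_mul, PiLp.zero_apply] at h1
    linarith

/-! ### Axial currents -/

section
variable {S : BarotropicStar} {γ : ℝ → ℝ} {v : E3 → E3}

lemma continuousOn_eq_zero_of_punctured {f : E3 → ℝ} {R : ℝ} (hf : ContinuousOn f (ball 0 R))
    (h : ∀ x ∈ ball (0 : E3) R, x ≠ 0 → f x = 0) {x : E3} (hx : x ∈ ball (0 : E3) R) : f x = 0 := by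
  by_cases hx0 : x = 0
  · subst hx0
    have hc := hf.continuousAt (isOpen_ball.mem_nhds hx)
    refine tendsto_nhds_unique (hc.tendsto.mono_left (nhdsWithin_le_nhds (s := {0}ᶜ))) ?_
    refine tendsto_const_nhds.congr' ?_
    filter_upwards [self_mem_nhdsWithin, mem_nhdsWithin_of_mem_nhds (isOpen_ball.mem_nhds hx)] with z hz hzb
    exact (h z hzb hz).symm
  · exact h x hx hx0

/-- The divergence of ρ v is continuous, so the centre, where spherical harmonics are singular, may
be left out of computations. -/
lemma BarotropicStar.mass_of_punctured (hv : ContDiffOn ℝ 1 v (closedBall 0 S.R))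
    (h : ∀ x ∈ ball (0 : E3) S.R, x ≠ 0 → divergence (fun z => S.ρ z • v z) x = 0) :
    ∀ x ∈ ball (0 : E3) S.R, divergence (fun z => S.ρ z • v z) x = 0 := fun _ hx =>
  continuousOn_eq_zero_of_punctured
    (divergence_continuousOn isOpen_ball (S.ρ_smooth.smul (hv.mono ball_subset_closedBall))) h hx

lemma divergence_axial {U : ℝ → ℝ} {l : ℕ} {H : E3 → ℝ} (hH : IsHomog l H) {x : E3} (hx : x ≠ 0)
    (hU : DifferentiableAt ℝ U ‖x‖) : divergence (fun z => U ‖z‖ • axialField H z) x = 0 := by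
  have hg := hasGradientAt_comp_norm hx hU.hasDerivAt
  have hd : DifferentiableAt ℝ (axialField H) x :=
    (hH.axialField_contDiffOn.contDiffAt (isOpen_compl_singleton.mem_nhds hx)).differentiableAt (by simp)
  rw [divergence_smul hg.differentiableAt hd, hH.divergence_axialField hx, hg.gradient, real_inner_smul_left,
    real_inner_smul_left, real_inner_comm, inner_axialField]
  ring

lemma IsAxial.inner_eq_zero {R : ℝ} {l : ℕ} (hv : IsAxial R l v) {x : E3} (hx : x ∈ closedBall (0 : E3) R) :
    ⟪v x, x⟫ = 0 := by
  obtain ⟨H, U, -, h⟩ := hv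
  by_cases hx0 : x = 0
  · rw [hx0, inner_zero_right]
  · rw [h x hx hx0, real_inner_smul_left]
    exact mul_eq_zero_of_right _ (inner_axialField H x)

/-- Both v · ∇ρ and the divergence of v vanish. The second needs U to be differentiable, which is
not assumed: it is recovered from v along a ray on which the axial field is nonzero. If there is
none, v vanishes off the centre. -/
lemma IsAxial.isCurrent {l : ℕ} (hs : ContDiffOn ℝ 1 v (closedBall 0 S.R)) (hv : IsAxial S.R l v) :
    IsCurrent S v := by
  have hin := fun x hx => hv.inner_eq_zero (x := x) hx
  obtain ⟨H, U, hH, h⟩ := hv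
  have hdv : ∀ x ∈ ball (0 : E3) S.R, DifferentiableAt ℝ v x := fun x hx =>
    (hs.contDiffAt (closedBall_mem_nhds_of_mem hx)).differentiableAt one_ne_zero
  refine ⟨hs, S.mass_of_punctured hs fun x hx hx0 => ?_,
    fun y hy => by rw [hin y (sphere_subset_closedBall hy), mul_zero]⟩
  have hr : ‖x‖ ∈ Ioo 0 S.R := ⟨norm_pos_iff.2 hx0, S.ball_eq_norm.1 hx⟩
  have hev : v =ᶠ[𝓝 x] fun z => U ‖z‖ • axialField H z := by
    filter_upwards [isOpen_ball.mem_nhds hx, isOpen_compl_singleton.mem_nhds hx0] with z hz hz0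
    exact h z (ball_subset_closedBall hz) hz0
  rw [divergence_smul (S.ρ_diffAt hx) (hdv x hx), S.gradient_ρ hx0 hx, real_inner_smul_left, real_inner_smul_left,
    real_inner_comm, hin x (ball_subset_closedBall hx), mul_zero, mul_zero, add_zero]
  refine mul_eq_zero_of_right _ ?_
  by_cases hA : ∃ n : E3, ‖n‖ = 1 ∧ axialField H n ≠ 0
  · obtain ⟨n, hn, hAn⟩ := hA
    have hn0 : n ≠ 0 := norm_pos_iff.1 (by rw [hn]; exact one_pos)
    have hUd : DifferentiableAt ℝ U ‖x‖ := by
      have hm : ‖x‖ • n ∈ ball (0 : E3) S.R := by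
        rw [S.ball_eq_norm, norm_smul, norm_norm, hn, mul_one]; exact hr.2
      -- The axial field is homogeneous of degree -1, so v(s n) = U(s) s⁻¹ times its value at n.
      -- Projecting on that value gives U.
      have h1 : DifferentiableAt ℝ (fun s : ℝ => s * (⟪v (s • n), axialField H n⟫ / ‖axialField H n‖ ^ 2)) ‖x‖ := by
        have h2 : DifferentiableAt ℝ (fun s : ℝ => v (s • n)) ‖x‖ :=
          (hdv _ hm).comp ‖x‖ (by fun_prop : DifferentiableAt ℝ (fun s : ℝ => s • n) ‖x‖)
        exact differentiableAt_fun_id.fun_mul ((h2.inner ℝ (differentiableAt_const _)).div_const _)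
      refine h1.congr_of_eventuallyEq ?_
      filter_upwards [isOpen_Ioo.mem_nhds hr] with s hs
      have e : ‖s • n‖ = s := by rw [norm_smul, hn, mul_one, Real.norm_of_nonneg hs.1.le]
      have hs0 := hs.1.ne'
      have hAn' := norm_ne_zero_iff.2 hAn
      have e2 := h (s • n) (by rw [mem_closedBall_zero_iff, e]; exact hs.2.le) (smul_ne_zero hs0 hn0)
      change v (s • n) = U ‖s • n‖ • axialField H (s • n) at e2
      rw [e2, e, hH.isHomog.axialField_smul hs.1 hn0, real_inner_smul_left, real_inner_smul_left,
        real_inner_self_eq_norm_sq]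
      field_simp
    rw [divergence_congr hev]
    exact divergence_axial hH.isHomog hx0 hUd
  · push Not at hA
    have hev0 : v =ᶠ[𝓝 x] fun _ => 0 := by
      filter_upwards [hev, isOpen_compl_singleton.mem_nhds hx0] with z hz hz0
      have hz0' : z ≠ 0 := hz0
      have e : axialField H z = 0 := by
        have h1 := hH.isHomog.axialField_smul (inv_pos.2 (norm_pos_iff.2 hz0')) hz0'
        rw [hA _ (by rw [norm_smul, norm_inv, norm_norm, inv_mul_cancel₀ (norm_ne_zero_iff.2 hz0')])] at h1
        exact (smul_eq_zero.1 h1.symm).resolve_left (by simpa using hz0')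
      rw [hz, e, smul_zero]
    rw [divergence_congr hev0, divergence_zero]

/-- The gradients of ρ and p are radial and v is tangential, so the adiabatic relation is trivial
for every γ. -/
lemma IsAxial.isRMode {l : ℕ} (hl : 1 ≤ l) (hs : ContDiffOn ℝ 1 v (closedBall 0 S.R)) (hv : IsAxial S.R l v) :
    IsRMode S γ l v := by
  refine ⟨hl, hv, isZeroFrequency_current_iff.2 ⟨hv.isCurrent hs, fun x hx => ?_⟩⟩
  by_cases hx0 : x = 0
  · subst hx0
    rw [gradient_radial_zero S.ρ_radial, gradient_radial_zero S.p_radial]; simp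
  · rw [S.gradient_p hx, S.gradient_ρ hx0 hx, S.gradient_Φ hx0]
    simp only [real_inner_smul_right, hv.inner_eq_zero (ball_subset_closedBall hx)]
    ring

lemma exists_rMode {l : ℕ} (hl : 1 ≤ l) : ∃ v, IsRMode S γ l v ∧ ∃ x ∈ ball (0 : E3) S.R, v x ≠ 0 := by
  obtain ⟨H, hH, x, hx, hne⟩ := exists_cross_gradient_ne_zero hl S.R_pos
  refine ⟨fun x => cross (∇ H x) x, IsAxial.isRMode hl ?_ ⟨H, fun r => r ^ (l + 1), hH, fun z _ hz0 =>
    cross_gradient_eq_axialField hH.isHomog hz0⟩, x, hx, hne⟩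
  exact contDiffOn_cross ((gradient_contDiff hH.smooth).of_le one_le_infty).contDiffOn contDiffOn_id

/-! ### Polar currents -/

/-- The polar field with radial amplitude `A` and tangential amplitude `B`. -/
def polarField (H : E3 → ℝ) (A B : ℝ → ℝ) (x : E3) : E3 :=
  (A ‖x‖ * angular H x) • (‖x‖⁻¹ • x) + B ‖x‖ • (‖x‖ • ∇ (angular H) x)

/-- The radial part contributes A' + 2A/r, and the tangential part the eigenvalue of the spherical
Laplacian. The result turns conservation of mass into an ordinary differential equation for the
amplitudes. -/
lemma divergence_polarField {l : ℕ} {H : E3 → ℝ} (hH : IsSolidHarmonic l H) {A B : ℝ → ℝ} {A' : ℝ} {x : E3}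
    (hx : x ≠ 0) (hA : HasDerivAt A A' ‖x‖) (hB : DifferentiableAt ℝ B ‖x‖) :
    divergence (polarField H A B) x = (A' + 2 / ‖x‖ * A ‖x‖ - l * (l + 1) / ‖x‖ * B ‖x‖) * angular H x := by
  have hn := norm_ne_zero_iff.2 hx
  have hY : DifferentiableAt ℝ (angular H) x := angular_differentiableAt hH.smooth hx
  have hYt : ⟪x, ∇ (angular H) x⟫ = 0 := by rw [real_inner_comm]; exact hH.isHomog.inner_gradient_angular hx
  have hgY : DifferentiableAt ℝ (∇ (angular H)) x :=
    (hH.isHomog.gradient_angular_contDiffOn.contDiffAt (isOpen_compl_singleton.mem_nhds hx)).differentiableAt (by simp)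
  have hA1 : HasDerivAt (fun r => A r * r⁻¹) (A' * ‖x‖⁻¹ + A ‖x‖ * (-(‖x‖ ^ 2)⁻¹)) ‖x‖ :=
    hA.fun_mul (hasDerivAt_inv hn)
  have hB1 : DifferentiableAt ℝ (fun r => B r * r) ‖x‖ := hB.fun_mul differentiableAt_fun_id
  have gA := hasGradientAt_comp_norm hx hA1
  have gB := hasGradientAt_comp_norm hx hB1.hasDerivAt
  have e : polarField H A B = fun z => ((A ‖z‖ * ‖z‖⁻¹) * angular H z) • z + (B ‖z‖ * ‖z‖) • ∇ (angular H) z := by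
    ext1 z
    rw [polarField, smul_smul, smul_smul]
    congr 2; ring
  have d1 := gA.differentiableAt.fun_mul hY
  rw [e, divergence_add (d1.fun_smul differentiableAt_fun_id) (gB.differentiableAt.fun_smul hgY),
    divergence_smul d1 differentiableAt_fun_id, divergence_smul gB.differentiableAt hgY, divergence_id,
    gradient_mul gA.differentiableAt hY, gA.gradient, gB.gradient, hH.divergence_gradient_angular hx]
  simp only [inner_add_left, real_inner_smul_left, hYt, hH.isHomog.inner_gradient_angular hx,
    real_inner_self_eq_norm_sq]
  field_simp
  ring

lemma isPolar_of_eq {R : ℝ} {l : ℕ} {H : E3 → ℝ} (hH : IsSolidHarmonic l H) {A B : ℝ → ℝ}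
    (h : ∀ x ∈ closedBall (0 : E3) R, x ≠ 0 → v x = polarField H A B x) : IsPolar R l v := by
  refine ⟨H, fun r => A r * r, fun r => B r * r, hH, fun x hx hx0 => ?_⟩
  rw [h x hx hx0, polarField, smul_smul (B ‖x‖), mul_div_cancel_right₀ _ (norm_ne_zero_iff.2 hx0)]

lemma inner_polarField {l : ℕ} {H : E3 → ℝ} (hH : IsHomog l H) (A B : ℝ → ℝ) {x : E3} (hx : x ≠ 0) :
    ⟪polarField H A B x, x⟫ = A ‖x‖ * angular H x * ‖x‖ := by
  have hn := norm_ne_zero_iff.2 hx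
  rw [polarField, inner_add_left, real_inner_smul_left, real_inner_smul_left, real_inner_smul_left,
    real_inner_smul_left, hH.inner_gradient_angular hx, real_inner_self_eq_norm_sq]
  field_simp
  ring

/-- A regular polar field is a current if its amplitudes satisfy the equation of continuity. -/
lemma isCurrent_of_polarField {l : ℕ} {H : E3 → ℝ} (hH : IsSolidHarmonic l H) {A B : ℝ → ℝ}
    (hs : ContDiffOn ℝ 1 v (closedBall 0 S.R))
    (h : ∀ x ∈ closedBall (0 : E3) S.R, x ≠ 0 → v x = polarField H A B x)
    (hB : ∀ r ∈ Ioo 0 S.R, DifferentiableAt ℝ B r)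
    (hA : ∀ r ∈ Ioo 0 S.R, HasDerivAt (fun r => profile S.ρ r * A r)
      (l * (l + 1) / r * (profile S.ρ r * B r) - 2 / r * (profile S.ρ r * A r)) r)
    (hR : profile S.ρ S.R * A S.R = 0) : IsCurrent S v := by
  refine ⟨hs, S.mass_of_punctured hs fun x hx hx0 => ?_, fun y hy => ?_⟩
  · have hr : ‖x‖ ∈ Ioo 0 S.R := ⟨norm_pos_iff.2 hx0, S.ball_eq_norm.1 hx⟩
    have hev : (fun z => S.ρ z • v z) =ᶠ[𝓝 x]
        polarField H (fun r => profile S.ρ r * A r) (fun r => profile S.ρ r * B r) := by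
      filter_upwards [isOpen_ball.mem_nhds hx, isOpen_compl_singleton.mem_nhds hx0] with z hz hz0
      rw [h z (ball_subset_closedBall hz) hz0, polarField, polarField, eq_profile S.ρ_radial z]
      module
    rw [divergence_congr hev, divergence_polarField hH hx0 (hA _ hr)
      ((S.ρ_profile_hasDerivAt hr).differentiableAt.fun_mul (hB _ hr))]
    ring
  · have hyR : ‖y‖ = S.R := by simpa using hy
    have hy0 : y ≠ 0 := norm_pos_iff.1 (hyR ▸ S.R_pos)
    rw [h y (sphere_subset_closedBall hy) hy0, inner_polarField hH.isHomog _ _ hy0, eq_profile S.ρ_radial y, hyR]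
    linear_combination (angular H y * S.R) * hR

end

/-! ### Regularity at the centre -/

lemma exists_bound_of_homogeneous {F : Type*} [NormedAddCommGroup F] {X : E3 → F} (hX : ContinuousOn X {0}ᶜ) :
    ∃ C ≥ 0, ∀ x, ‖x‖ = 1 → ‖X x‖ ≤ C := by
  obtain ⟨C, hC⟩ := (isCompact_sphere (0 : E3) 1).exists_bound_of_continuousOn
    (hX.mono fun x hx => norm_pos_iff.1 (by rw [mem_sphere_zero_iff_norm.1 hx]; exact one_pos))
  exact ⟨max C 0, le_max_right _ _, fun x hx => (hC x (by simpa using hx)).trans (le_max_left _ _)⟩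

/-- A field X that is constant along rays is in general discontinuous at the origin. A factor φ with
φ = o(r) and φ' → 0 outweighs this: X is bounded and DX = O(1/r). -/
lemma contDiff_radial_smul {F : Type*} [NormedAddCommGroup F] [NormedSpace ℝ F] {X : E3 → F}
    (hX : ContDiffOn ℝ 1 X {0}ᶜ) (hh : ∀ c : ℝ, 0 < c → ∀ x, x ≠ 0 → X (c • x) = X x) {φ : ℝ → ℝ}
    (hφ : ContDiff ℝ 1 φ) (h0 : φ 0 = 0) (h0' : deriv φ 0 = 0) : ContDiff ℝ 1 (fun x : E3 => φ ‖x‖ • X x) := by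
  have hop : IsOpen ({0}ᶜ : Set E3) := isOpen_compl_singleton
  have hXd : ∀ x : E3, x ≠ 0 → HasFDerivAt X (fderiv ℝ X x) x := fun x hx =>
    ((hX.contDiffAt (hop.mem_nhds hx)).differentiableAt one_ne_zero).hasFDerivAt
  have hunit : ∀ x : E3, x ≠ 0 → ‖‖x‖⁻¹ • x‖ = 1 := fun x hx => by
    rw [norm_smul, norm_inv, norm_norm, inv_mul_cancel₀ (norm_ne_zero_iff.2 hx)]
  have hXe : ∀ x : E3, x ≠ 0 → X x = X (‖x‖⁻¹ • x) := fun x hx => (hh _ (inv_pos.2 (norm_pos_iff.2 hx)) x hx).symm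
  -- The derivative of X is homogeneous of degree -1, so its size is controlled by its values on the
  -- unit sphere.
  have hDe : ∀ x : E3, x ≠ 0 → fderiv ℝ X x = ‖x‖⁻¹ • fderiv ℝ X (‖x‖⁻¹ • x) := by
    intro x hx
    have hc := inv_pos.2 (norm_pos_iff.2 hx)
    have h1 : HasFDerivAt (fun z => X (‖x‖⁻¹ • z))
        ((fderiv ℝ X (‖x‖⁻¹ • x)).comp (‖x‖⁻¹ • ContinuousLinearMap.id ℝ E3)) x :=
      (hXd _ (smul_ne_zero hc.ne' hx)).comp x ((hasFDerivAt_id x).const_smul ‖x‖⁻¹)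
    have h2 : (fun z => X (‖x‖⁻¹ • z)) =ᶠ[𝓝 x] X := by
      filter_upwards [hop.mem_nhds hx] with z hz using hh _ hc z hz
    rw [← h2.fderiv_eq, h1.fderiv]
    ext y; simp
  obtain ⟨C, hC, hCb⟩ := exists_bound_of_homogeneous hX.continuousOn
  obtain ⟨D, hD, hDb⟩ := exists_bound_of_homogeneous (contDiffOn_fderiv_continuousOn hop hX)
  have hφd : ∀ r, HasDerivAt φ (deriv φ r) r := fun r => (hφ.differentiable one_ne_zero r).hasDerivAt
  set f : E3 → F := fun x => φ ‖x‖ • X x with hf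
  set f' : E3 → E3 →L[ℝ] F := fun x =>
    φ ‖x‖ • fderiv ℝ X x + (innerSL ℝ (deriv φ ‖x‖ • ‖x‖⁻¹ • x)).smulRight (X x) with hf'
  have hoff : ∀ x : E3, x ≠ 0 → HasFDerivAt f (f' x) x := fun x hx =>
    (hasGradientAt_comp_norm hx (hφd ‖x‖)).hasFDerivAt.smul (hXd x hx)
  have hlim : Tendsto (fun x : E3 => φ ‖x‖ * ‖x‖⁻¹) (𝓝[≠] 0) (𝓝 0) := by
    have h1 := (hφd 0)
    rw [h0', hasDerivAt_iff_tendsto_slope] at h1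
    have h2 : Tendsto (fun x : E3 => ‖x‖) (𝓝[≠] 0) (𝓝[≠] 0) := by
      refine tendsto_nhdsWithin_iff.2 ⟨?_, ?_⟩
      · simpa using (continuous_norm.tendsto (0 : E3)).mono_left nhdsWithin_le_nhds
      · filter_upwards [self_mem_nhdsWithin] with x hx using norm_ne_zero_iff.2 hx
    refine (h1.comp h2).congr fun x => ?_
    simp [slope_def_field, h0, div_eq_mul_inv]
  have hf0 : f 0 = 0 := by simp [hf, h0]
  have hat0 : HasFDerivAt f (0 : E3 →L[ℝ] F) 0 := by
    rw [hasFDerivAt_iff_tendsto]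
    simp only [sub_zero, hf0, zero_apply]
    rw [← nhdsNE_sup_pure, tendsto_sup]
    refine ⟨?_, ?_⟩
    · refine squeeze_zero_norm' (a := fun x => |φ ‖x‖ * ‖x‖⁻¹| * C) ?_ (by simpa using hlim.abs.mul_const C)
      filter_upwards [self_mem_nhdsWithin] with x hx
      have hx' : x ≠ 0 := hx
      rw [norm_mul, norm_norm, norm_inv, norm_norm, hf, norm_smul, abs_mul, abs_of_pos (inv_pos.2 (norm_pos_iff.2 hx')),
        Real.norm_eq_abs]
      have := hCb _ (hunit x hx')
      rw [← hXe x hx'] at this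
      calc ‖x‖⁻¹ * (|φ ‖x‖| * ‖X x‖) ≤ ‖x‖⁻¹ * (|φ ‖x‖| * C) := by gcongr
        _ = _ := by ring
    · rw [tendsto_pure_left]
      intro s hs
      simpa using mem_of_mem_nhds hs
  have hdiff : Differentiable ℝ f := fun x => by
    by_cases hx : x = 0
    · rw [hx]; exact hat0.differentiableAt
    · exact (hoff x hx).differentiableAt
  rw [contDiff_one_iff_fderiv]
  refine ⟨hdiff, continuous_iff_continuousAt.2 fun x => ?_⟩
  by_cases hx : x = 0
  · subst hx
    rw [ContinuousAt, hat0.fderiv, ← nhdsNE_sup_pure, tendsto_sup]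
    refine ⟨?_, ?_⟩
    · have hb : Tendsto (fun x : E3 => |φ ‖x‖ * ‖x‖⁻¹| * D + |deriv φ ‖x‖| * C) (𝓝[≠] 0) (𝓝 0) := by
        have h1 : Continuous fun x : E3 => |deriv φ ‖x‖| * C :=
          ((hφ.continuous_deriv le_rfl).comp continuous_norm).abs.mul continuous_const
        have h2 := (h1.tendsto 0).mono_left (nhdsWithin_le_nhds (s := {0}ᶜ))
        simp only [norm_zero, h0', abs_zero, zero_mul] at h2
        simpa using (hlim.abs.mul_const D).add h2
      refine squeeze_zero_norm' ?_ hb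
      filter_upwards [self_mem_nhdsWithin] with x hx
      have hx' : x ≠ 0 := hx
      rw [(hoff x hx').fderiv, hf']
      refine (norm_add_le _ _).trans (add_le_add ?_ ?_)
      · rw [norm_smul, hDe x hx', norm_smul, norm_inv, norm_norm, abs_mul,
          abs_of_pos (inv_pos.2 (norm_pos_iff.2 hx')), Real.norm_eq_abs, mul_assoc]
        have := hDb _ (hunit x hx')
        gcongr
      · rw [ContinuousLinearMap.norm_smulRight_apply, innerSL_apply_norm, norm_smul, hunit x hx', mul_one,
          Real.norm_eq_abs, hXe x hx']
        have := hCb _ (hunit x hx')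
        gcongr
    · rw [tendsto_pure_left]
      intro s hs
      rw [hat0.fderiv]
      exact mem_of_mem_nhds hs
  · have hfs : ContDiffOn ℝ 1 f {0}ᶜ := by
      have h1 : ContDiffOn ℝ 1 (fun x : E3 => φ ‖x‖) {0}ᶜ := fun z hz =>
        (hφ.contDiffAt.comp z (contDiffAt_norm ℝ hz)).contDiffWithinAt
      exact h1.smul hX
    exact (contDiffOn_fderiv_continuousOn hop hfs).continuousAt (hop.mem_nhds hx)

lemma contDiff_polarField {l : ℕ} {H : E3 → ℝ} (hH : IsHomog l H) {A B : ℝ → ℝ} (hA : ContDiff ℝ 1 A)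
    (hB : ContDiff ℝ 1 B) (hA0 : A 0 = 0) (hA0' : deriv A 0 = 0) (hB0 : B 0 = 0) (hB0' : deriv B 0 = 0) :
    ContDiff ℝ 1 (polarField H A B) := by
  have hc : ContDiffOn ℝ 1 (angular H) {0}ᶜ := hH.angular_contDiffOn.of_le one_le_infty
  have hu : ContDiffOn ℝ 1 (fun x : E3 => ‖x‖⁻¹ • x) {0}ᶜ := unitRadial_contDiffOn fun _ h => h
  have hn : ContDiffOn ℝ 1 (fun x : E3 => ‖x‖) {0}ᶜ := fun z hz => (contDiffAt_norm ℝ hz).contDiffWithinAt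
  have hg : ContDiffOn ℝ 1 (∇ (angular H)) {0}ᶜ := hH.gradient_angular_contDiffOn.of_le one_le_infty
  have h1 := contDiff_radial_smul (X := fun x => angular H x • (‖x‖⁻¹ • x)) (hc.smul hu)
    (fun c hc x hx => by
      have := norm_ne_zero_iff.2 hx
      rw [angular_smul H hc, norm_smul, Real.norm_of_nonneg hc.le, smul_smul (c * ‖x‖)⁻¹, mul_inv,
        mul_right_comm, inv_mul_cancel₀ hc.ne', one_mul]) hA hA0 hA0'
  have h2 := contDiff_radial_smul (X := fun x => ‖x‖ • ∇ (angular H) x) (hn.smul hg)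
    (fun c hc x hx => by
      rw [hH.gradient_angular_smul hc hx, norm_smul, Real.norm_of_nonneg hc.le, smul_smul]
      congr 1
      field_simp) hB hB0 hB0'
  have e : polarField H A B
      = fun x => A ‖x‖ • (angular H x • (‖x‖⁻¹ • x)) + B ‖x‖ • (‖x‖ • ∇ (angular H) x) := by
    ext1 x; rw [polarField, mul_smul]
  rw [e]
  exact h1.add h2

lemma contDiff_axialField {l : ℕ} {H : E3 → ℝ} (hH : IsHomog l H) {U : ℝ → ℝ} (hU : ContDiff ℝ 1 U)
    (hU0 : U 0 = 0) (hU0' : deriv U 0 = 0) : ContDiff ℝ 1 (fun x => U ‖x‖ • (‖x‖ • axialField H x)) := by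
  have hn : ContDiffOn ℝ 1 (fun x : E3 => ‖x‖) {0}ᶜ := fun z hz => (contDiffAt_norm ℝ hz).contDiffWithinAt
  exact contDiff_radial_smul (X := fun x => ‖x‖ • axialField H x)
    (hn.smul (hH.axialField_contDiffOn.of_le one_le_infty)) (fun c hc x hx => by
      rw [hH.axialField_smul hc hx, norm_smul, Real.norm_of_nonneg hc.le, smul_smul]
      congr 1
      field_simp) hU hU0 hU0'

/-! ### A polar current whose radial component vanishes on no shell -/

/-- Functions with compact support can be summed with small positive weights. -/
lemma exists_summable_weights {E : Type*} [NormedAddCommGroup E] [NormedSpace ℝ E] [CompleteSpace E]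
    (c : ℕ → ℝ → E) (hc : ∀ n, ContDiff ℝ 1 (c n)) (hs : ∀ n, HasCompactSupport (c n)) :
    ∃ ε : ℕ → ℝ, (∀ n, 0 < ε n) ∧ ∃ f : ℝ → E, ContDiff ℝ 1 f ∧ (∀ r, HasSum (fun n => ε n • c n r) (f r)) ∧
      ∀ r, HasSum (fun n => ε n • deriv (c n) r) (deriv f r) := by
  have hb : ∀ n, ∃ C ≥ 0, ∀ r, ‖c n r‖ ≤ C ∧ ‖deriv (c n) r‖ ≤ C := fun n => by
    obtain ⟨C, hC⟩ := (hs n).exists_bound_of_continuous (hc n).continuous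
    obtain ⟨D, hD⟩ := (hs n).deriv.exists_bound_of_continuous ((hc n).continuous_deriv le_rfl)
    exact ⟨max C D, ((norm_nonneg _).trans (hC 0)).trans (le_max_left _ _),
      fun r => ⟨(hC r).trans (le_max_left _ _), (hD r).trans (le_max_right _ _)⟩⟩
  choose M hM0 hM using hb
  -- Here M n bounds both the n-th function and its derivative, so the series and its derivative are
  -- dominated by a geometric one. The added 1 avoids division by zero.
  set ε : ℕ → ℝ := fun n => (1 / 2) ^ n / (1 + M n) with hε
  have hε0 : ∀ n, 0 < ε n := fun n => by have := hM0 n; positivity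
  have hu : Summable (fun n : ℕ => ((1 : ℝ) / 2) ^ n) := summable_geometric_two
  have hle : ∀ n (y : E), ‖y‖ ≤ M n → ‖ε n • y‖ ≤ (1 / 2) ^ n := fun n y hy => by
    have := hM0 n
    rw [norm_smul, Real.norm_of_nonneg (hε0 n).le, hε]
    simp only
    rw [div_mul_eq_mul_div, div_le_iff₀ (by positivity)]
    gcongr
    linarith
  have hsum : ∀ r, Summable (fun n => ε n • c n r) := fun r =>
    Summable.of_norm_bounded hu fun n => hle n _ (hM n r).1
  have hsum' : ∀ r, Summable (fun n => ε n • deriv (c n) r) := fun r =>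
    Summable.of_norm_bounded hu fun n => hle n _ (hM n r).2
  have hd : ∀ r, HasDerivAt (fun r => ∑' n, ε n • c n r) (∑' n, ε n • deriv (c n) r) r := fun r =>
    hasDerivAt_tsum hu (fun n r => ((hc n).differentiable one_ne_zero r).hasDerivAt.fun_const_smul (ε n))
      (fun n r => hle n _ (hM n r).2) (hsum 0) r
  have hde : deriv (fun r => ∑' n, ε n • c n r) = fun r => ∑' n, ε n • deriv (c n) r := by
    ext1 r; exact (hd r).deriv
  refine ⟨ε, hε0, fun r => ∑' n, ε n • c n r, ?_, fun r => (hsum r).hasSum, fun r => ?_⟩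
  · rw [contDiff_one_iff_deriv, hde]
    exact ⟨fun r => (hd r).differentiableAt, continuous_tsum
      (fun n => ((hc n).continuous_deriv le_rfl).const_smul (ε n)) hu fun n r => hle n _ (hM n r).2⟩
  · rw [hde]; exact (hsum' r).hasSum

/-- Bump functions exhausting the interval `(0, R)`. -/
lemma exists_exhausting_bumps {R : ℝ} (hR : 0 < R) : ∃ Q : ℕ → ℝ → ℝ, (∀ n, ContDiff ℝ ∞ (Q n)) ∧
    (∀ n, HasCompactSupport (Q n)) ∧ (∀ n, tsupport (Q n) ⊆ Ioo 0 R) ∧ (∀ n r, 0 ≤ Q n r) ∧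
    ∀ r ∈ Ioo 0 R, ∃ n, 0 < Q n r := by
  -- The shift by 3 makes the inner radius positive already for n = 0. The outer radius stays below
  -- R/2, so the supports are compact in (0, R), and tends to R/2, so they exhaust the interval.
  set b : (n : ℕ) → ContDiffBump (R / 2) := fun n =>
    { rIn := R / 2 * (1 - 2 / (n + 3))
      rOut := R / 2 * (1 - 1 / (n + 3))
      rIn_pos := by
        have : (2 : ℝ) / (n + 3) < 1 := by rw [div_lt_one (by positivity)]; linarith [n.cast_nonneg (α := ℝ)]
        have : 0 < 1 - (2 : ℝ) / (n + 3) := by linarith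
        positivity
      rIn_lt_rOut := by
        gcongr
        norm_num } with hb
  refine ⟨fun n => b n, fun n => (b n).contDiff, fun n => (b n).hasCompactSupport, fun n r hr => ?_,
    fun n r => (b n).nonneg, fun r hr => ?_⟩
  · rw [(b n).tsupport_eq, mem_closedBall, Real.dist_eq, abs_le] at hr
    have h1 : 0 < R / 2 * (1 / (n + 3 : ℝ)) := by positivity
    simp only [hb] at hr
    constructor <;> nlinarith [hr.1, hr.2]
  · have h1 : |r - R / 2| < R / 2 := abs_lt.2 ⟨by linarith [hr.1], by linarith [hr.2]⟩
    have h2 : Tendsto (fun n : ℕ => R / 2 * (1 - 1 / (((n + 2 : ℕ) : ℝ) + 1))) atTop (𝓝 (R / 2 * (1 - 0))) :=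
      ((tendsto_one_div_add_atTop_nhds_zero_nat.comp (tendsto_add_atTop_nat 2)).const_sub 1).const_mul _
    rw [sub_zero, mul_one] at h2
    obtain ⟨n, hn⟩ := (h2.eventually (lt_mem_nhds h1)).exists
    refine ⟨n, (b n).pos_of_mem_ball ?_⟩
    rw [mem_ball, Real.dist_eq]
    refine hn.trans_le (le_of_eq ?_)
    simp only [hb]
    push_cast
    ring_nf

lemma contDiff_mul_of_tsupport_subset {U : Set ℝ} (hU : IsOpen U) {f g : ℝ → ℝ} (hf : ContDiff ℝ 1 f)
    (hfs : tsupport f ⊆ U) (hg : ContDiffOn ℝ 1 g U) : ContDiff ℝ 1 (fun r => f r * g r) := by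
  rw [contDiff_iff_contDiffAt]
  intro r
  by_cases hr : r ∈ U
  · exact hf.contDiffAt.mul (hg.contDiffAt (hU.mem_nhds hr))
  · have hr' : r ∉ tsupport f := fun h => hr (hfs h)
    have : (fun r => f r * g r) =ᶠ[𝓝 r] fun _ => 0 := by
      filter_upwards [(isClosed_tsupport f).isOpen_compl.mem_nhds hr'] with s hs
      rw [image_eq_zero_of_notMem_tsupport hs, zero_mul]
    exact contDiffAt_const.congr_of_eventuallyEq this

section
variable {S : BarotropicStar}

lemma BarotropicStar.ρ_profile_contDiffOn : ContDiffOn ℝ 1 (profile S.ρ) (Ioo 0 S.R) :=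
  S.ρ_smooth.comp (by fun_prop : ContDiff ℝ 1 fun r : ℝ => r • unitVec 0).contDiffOn
    fun _ hr => S.smul_unitVec_mem hr

/-- Amplitudes of a polar current. -/
lemma BarotropicStar.exists_amplitudes (S : BarotropicStar) {l : ℕ} (hl : 1 ≤ l) : ∃ A B : ℝ → ℝ,
    ContDiff ℝ 1 A ∧ ContDiff ℝ 1 B ∧ A 0 = 0 ∧ deriv A 0 = 0 ∧ B 0 = 0 ∧ deriv B 0 = 0 ∧ A S.R = 0 ∧
    (∀ r ∈ Ioo 0 S.R, 0 < A r) ∧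
    ∀ r ∈ Ioo 0 S.R, HasDerivAt (fun r => profile S.ρ r * A r)
      (l * (l + 1) / r * (profile S.ρ r * B r) - 2 / r * (profile S.ρ r * A r)) r := by
  obtain ⟨Q, hQ, hQc, hQs, hQ0, hQp⟩ := exists_exhausting_bumps S.R_pos
  have hl0 : (0 : ℝ) < l := by exact_mod_cast hl
  have hρ : ∀ r ∈ Ioo 0 S.R, profile S.ρ r ≠ 0 := fun r hr => (S.ρ_profile_pos (Ioo_subset_Ico_self hr)).ne'
  -- The equation of continuity reads (r² ρ A)' = l(l+1) r ρ B. Any function Q solves it through r²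
  -- ρ A = Q and l(l+1) r ρ B = Q'; these are the corresponding weights.
  set wa : ℝ → ℝ := fun r => (r ^ 2 * profile S.ρ r)⁻¹ with hwa
  set wb : ℝ → ℝ := fun r => (l * (l + 1) * r * profile S.ρ r)⁻¹ with hwb
  have cwa : ContDiffOn ℝ 1 wa (Ioo 0 S.R) :=
    ((contDiff_id.pow 2).contDiffOn.mul S.ρ_profile_contDiffOn).inv fun r hr =>
      mul_ne_zero (pow_ne_zero 2 hr.1.ne') (hρ r hr)
  have cwb : ContDiffOn ℝ 1 wb (Ioo 0 S.R) :=
    ((contDiff_const.mul contDiff_id).contDiffOn.mul S.ρ_profile_contDiffOn).inv fun r hr =>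
      mul_ne_zero (mul_ne_zero (by positivity) hr.1.ne') (hρ r hr)
  have hQ'c : ∀ n, ContDiff ℝ 1 (deriv (Q n)) := fun n =>
    ((contDiff_succ_iff_deriv (n := 1)).1 ((hQ n).of_le (by rw [one_add_one_eq_two]; exact two_le_infty))).2.2
  have ha : ∀ n, ContDiff ℝ 1 (fun r => Q n r * wa r) := fun n =>
    contDiff_mul_of_tsupport_subset isOpen_Ioo ((hQ n).of_le one_le_infty) (hQs n) cwa
  have hb : ∀ n, ContDiff ℝ 1 (fun r => deriv (Q n) r * wb r) := fun n =>
    contDiff_mul_of_tsupport_subset isOpen_Ioo (hQ'c n) ((tsupport_deriv_subset).trans (hQs n)) cwb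
  -- The weights may be singular at the centre and at the surface, so a single Q positive on (0, R)
  -- need not give C¹ amplitudes, whereas each compactly supported bump does. Summing the pairs (A,
  -- B) with common weights preserves the linear equation and makes A positive throughout.
  obtain ⟨ε, hε, f, hf, hfs, hfs'⟩ := exists_summable_weights (fun n r => (Q n r * wa r, deriv (Q n) r * wb r))
    (fun n => (ha n).prodMk (hb n)) (fun n => by
      refine HasCompactSupport.intro (hQc n).isCompact fun r hr => ?_
      rw [image_eq_zero_of_notMem_tsupport hr,
        image_eq_zero_of_notMem_tsupport (fun h => hr (tsupport_deriv_subset h)), zero_mul, zero_mul]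
      rfl)
  have hd : ∀ n r, HasDerivAt (fun r => (Q n r * wa r, deriv (Q n) r * wb r))
      (deriv (fun r => Q n r * wa r) r, deriv (fun r => deriv (Q n) r * wb r) r) r := fun n r =>
    ((ha n).differentiable one_ne_zero r).hasDerivAt.prodMk ((hb n).differentiable one_ne_zero r).hasDerivAt
  have hfd : ∀ r, HasDerivAt f (deriv f r) r := fun r => (hf.differentiable one_ne_zero r).hasDerivAt
  have hfst : ∀ r, HasDerivAt (fun r => (f r).1) (deriv f r).1 r := fun r =>
    (ContinuousLinearMap.fst ℝ ℝ ℝ).hasFDerivAt.comp_hasDerivAt r (hfd r)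
  have hsnd : ∀ r, HasDerivAt (fun r => (f r).2) (deriv f r).2 r := fun r =>
    (ContinuousLinearMap.snd ℝ ℝ ℝ).hasFDerivAt.comp_hasDerivAt r (hfd r)
  have sA : ∀ r, HasSum (fun n => ε n * (Q n r * wa r)) (f r).1 := fun r =>
    (hfs r).map (AddMonoidHom.fst ℝ ℝ) continuous_fst
  have sB : ∀ r, HasSum (fun n => ε n * (deriv (Q n) r * wb r)) (f r).2 := fun r =>
    (hfs r).map (AddMonoidHom.snd ℝ ℝ) continuous_snd
  have sA' : ∀ r, HasSum (fun n => ε n * deriv (fun r => Q n r * wa r) r) (deriv f r).1 := fun r => by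
    have := (hfs' r).map (AddMonoidHom.fst ℝ ℝ) continuous_fst
    simp only [(hd _ r).deriv] at this
    exact this
  have hout : ∀ r, r ∉ Ioo 0 S.R → f r = 0 := fun r hr => by
    have h1 : ∀ n, r ∉ tsupport (Q n) := fun n h => hr (hQs n h)
    refine (hfs r).unique ?_
    have e : (fun n => ε n • ((Q n r * wa r, deriv (Q n) r * wb r) : ℝ × ℝ)) = fun _ => 0 := by
      ext1 n
      rw [image_eq_zero_of_notMem_tsupport (h1 n),
        image_eq_zero_of_notMem_tsupport (fun h => h1 n (tsupport_deriv_subset h)), zero_mul, zero_mul]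
      exact smul_zero _
    rw [e]; exact hasSum_zero
  -- The sum is C¹ on the line and vanishes for r ≤ 0, so its derivative at 0 can be computed from
  -- the left.
  have hder0 : deriv f 0 = 0 := by
    have h1 : HasDerivWithinAt f (deriv f 0) (Iic 0) 0 := (hfd 0).hasDerivWithinAt
    have h2 : HasDerivWithinAt f 0 (Iic 0) 0 :=
      (hasDerivWithinAt_const 0 (Iic 0) (0 : ℝ × ℝ)).congr (fun r hr => hout r fun h => not_lt.2 hr h.1)
        (hout 0 fun h => lt_irrefl _ h.1)
    exact (uniqueDiffWithinAt_Iic 0).eq_deriv _ h1 h2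
  refine ⟨fun r => (f r).1, fun r => (f r).2, contDiff_fst.comp hf, contDiff_snd.comp hf, ?_, ?_, ?_, ?_, ?_, ?_, ?_⟩
  · simp only [hout 0 fun h => lt_irrefl _ h.1]; rfl
  · rw [(hfst 0).deriv, hder0]; rfl
  · simp only [hout 0 fun h => lt_irrefl _ h.1]; rfl
  · rw [(hsnd 0).deriv, hder0]; rfl
  · simp only [hout S.R fun h => lt_irrefl _ h.2]; rfl
  · intro r hr
    obtain ⟨n, hn⟩ := hQp r hr
    have hw : 0 < wa r := inv_pos.2 (mul_pos (pow_pos hr.1 2) (S.ρ_profile_pos (Ioo_subset_Ico_self hr)))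
    change 0 < (f r).1
    rw [← (sA r).tsum_eq]
    exact (sA r).summable.tsum_pos (fun n => mul_nonneg (hε n).le (mul_nonneg (hQ0 n r) hw.le)) n
      (mul_pos (hε n) (mul_pos hn hw))
  · intro r hr
    have hr0 := hr.1.ne'
    have hρr := hρ r hr
    have dρ := S.ρ_profile_hasDerivAt hr
    refine (dρ.fun_mul (hfst r)).congr_deriv ?_
    have key : ∀ n, S.dρ r * (ε n * (Q n r * wa r)) + profile S.ρ r * (ε n * deriv (fun r => Q n r * wa r) r)
        = l * (l + 1) / r * (profile S.ρ r * (ε n * (deriv (Q n) r * wb r)))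
          - 2 / r * (profile S.ρ r * (ε n * (Q n r * wa r))) := by
      intro n
      have dQ : HasDerivAt (Q n) (deriv (Q n) r) r := ((hQ n).differentiable (by simp) r).hasDerivAt
      have dw := ((hasDerivAt_pow 2 r).fun_mul dρ).fun_inv (mul_ne_zero (pow_ne_zero 2 hr0) hρr)
      rw [(dQ.fun_mul dw).deriv, hwa, hwb]
      field_simp
      push_cast
      ring
    have s1 := ((sA r).mul_left (S.dρ r)).add ((sA' r).mul_left (profile S.ρ r))
    have s2 := (((sB r).mul_left (profile S.ρ r)).mul_left (l * (l + 1) / r)).sub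
      (((sA r).mul_left (profile S.ρ r)).mul_left (2 / r))
    simp only [key] at s1
    exact s1.unique s2

/-- The same construction works whether or not the star is isentropic. On a ray where the harmonic
is nonzero, positivity of A makes the radial component nonzero at every radius in (0, R). -/
lemma BarotropicStar.exists_polar_current (S : BarotropicStar) {l : ℕ} (hl : 1 ≤ l) :
    ∃ v, IsPolar S.R l v ∧ IsCurrent S v ∧ RadialNonvanishing S.R v := by
  obtain ⟨A, B, hA, hB, hA0, hA0', hB0, hB0', hAR, hApos, hode⟩ := S.exists_amplitudes hl
  obtain ⟨H, hH, x₀, -, hx₀⟩ := exists_cross_gradient_ne_zero hl one_pos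
  have hH1 : ∃ n : E3, ‖n‖ = 1 ∧ H n ≠ 0 := by
    by_contra hcon
    push Not at hcon
    have h0 : H = fun _ => 0 := by
      ext1 x
      by_cases hx : x = 0
      · have := hH.homogeneous 0 x
        rw [zero_smul, zero_pow (by omega), zero_mul] at this
        rw [hx, this]
      · have h1 := hH.homogeneous ‖x‖ (‖x‖⁻¹ • x)
        rw [hcon (‖x‖⁻¹ • x) (by rw [norm_smul, norm_inv, norm_norm, inv_mul_cancel₀ (norm_ne_zero_iff.2 hx)]), mul_zero,
          smul_smul, mul_inv_cancel₀ (norm_ne_zero_iff.2 hx), one_smul] at h1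
        exact h1
    apply hx₀
    rw [h0, show ∇ (fun _ : E3 => (0 : ℝ)) x₀ = 0 from gradient_const x₀ 0, cross_zero_left]
  obtain ⟨n, hn, hHn⟩ := hH1
  refine ⟨polarField H A B, isPolar_of_eq hH fun _ _ _ => rfl,
    isCurrent_of_polarField hH (contDiff_polarField hH.isHomog hA hB hA0 hA0' hB0 hB0').contDiffOn
      (fun _ _ _ => rfl) (fun r _ => hB.differentiable one_ne_zero r) hode (by rw [hAR, mul_zero]), ?_⟩
  intro a b ha hab hbR
  have hr : 0 < (a + b) / 2 := by linarith
  have hnr : ‖((a + b) / 2) • n‖ = (a + b) / 2 := by rw [norm_smul, hn, mul_one, Real.norm_of_nonneg hr.le]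
  refine ⟨((a + b) / 2) • n, by rw [hnr]; linarith, by rw [hnr]; linarith, ?_⟩
  have hn0 : n ≠ 0 := norm_pos_iff.1 (by rw [hn]; exact one_pos)
  rw [inner_polarField hH.isHomog _ _ (smul_ne_zero hr.ne' hn0), hnr, angular_smul H hr, angular, hn, inv_one,
    one_smul]
  exact mul_ne_zero (mul_ne_zero (hApos _ ⟨hr, by linarith⟩).ne' hHn) hr.ne'

end

/-! ### Vector spherical harmonics -/

/-- The vector spherical harmonics of a solid harmonic, as functions of the direction of `x`:
radial, gradient and axial. -/
def vectorHarmonic (τ : Fin 3) (H : E3 → ℝ) (x : E3) : E3 :=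
  match τ with
  | 0 => angular H x • (‖x‖⁻¹ • x)
  | 1 => ‖x‖ • ∇ (angular H) x
  | 2 => ‖x‖ • axialField H x

/-- The square norm of a vector spherical harmonic, relative to the scalar one. -/
def vectorWeight (τ : Fin 3) (l : ℕ) : ℝ := if τ = 0 then 1 else l * (l + 1)

lemma vectorWeight_ne_zero (τ : Fin 3) {l : ℕ} (hl : 1 ≤ l) : vectorWeight τ l ≠ 0 := by
  have : (0 : ℝ) < l := by exact_mod_cast hl
  unfold vectorWeight
  split_ifs
  · exact one_ne_zero
  · positivity

lemma vectorHarmonic_zero_sphere (H : E3 → ℝ) (n : sphere (0 : E3) 1) :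
    vectorHarmonic 0 H n = H n • (n : E3) := by
  simp [vectorHarmonic, angular]

lemma vectorHarmonic_one_sphere (H : E3 → ℝ) (n : sphere (0 : E3) 1) :
    vectorHarmonic 1 H n = ∇ (angular H) n := by
  simp [vectorHarmonic]

lemma vectorHarmonic_two_sphere (H : E3 → ℝ) (n : sphere (0 : E3) 1) :
    vectorHarmonic 2 H n = axialField H n := by
  simp [vectorHarmonic]

lemma vectorHarmonic_smul {l : ℕ} {H : E3 → ℝ} (hH : IsHomog l H) (τ : Fin 3) {c : ℝ} (hc : 0 < c) {x : E3}
    (hx : x ≠ 0) : vectorHarmonic τ H (c • x) = vectorHarmonic τ H x := by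
  fin_cases τ
  · change angular H (c • x) • (‖c • x‖⁻¹ • c • x) = angular H x • (‖x‖⁻¹ • x)
    rw [angular_smul H hc, norm_smul, Real.norm_of_nonneg hc.le, smul_smul (c * ‖x‖)⁻¹, mul_inv,
      mul_right_comm, inv_mul_cancel₀ hc.ne', one_mul]
  · change ‖c • x‖ • ∇ (angular H) (c • x) = ‖x‖ • ∇ (angular H) x
    rw [hH.gradient_angular_smul hc hx, norm_smul, Real.norm_of_nonneg hc.le, smul_smul]
    congr 1
    field_simp
  · change ‖c • x‖ • axialField H (c • x) = ‖x‖ • axialField H x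
    rw [hH.axialField_smul hc hx, norm_smul, Real.norm_of_nonneg hc.le, smul_smul]
    congr 1
    field_simp

lemma contDiffOn_vectorHarmonic {l : ℕ} {H : E3 → ℝ} (hH : IsHomog l H) (τ : Fin 3) :
    ContDiffOn ℝ 1 (vectorHarmonic τ H) {0}ᶜ := by
  have hc : ContDiffOn ℝ 1 (angular H) {0}ᶜ := hH.angular_contDiffOn.of_le one_le_infty
  have hu : ContDiffOn ℝ 1 (fun x : E3 => ‖x‖⁻¹ • x) {0}ᶜ := unitRadial_contDiffOn fun _ h => h
  have hn : ContDiffOn ℝ 1 (fun x : E3 => ‖x‖) {0}ᶜ := fun z hz => (contDiffAt_norm ℝ hz).contDiffWithinAt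
  have hg : ContDiffOn ℝ 1 (∇ (angular H)) {0}ᶜ := hH.gradient_angular_contDiffOn.of_le one_le_infty
  have ha : ContDiffOn ℝ 1 (axialField H) {0}ᶜ := hH.axialField_contDiffOn.of_le one_le_infty
  fin_cases τ
  · exact hc.smul hu
  · exact hn.smul hg
  · exact hn.smul ha

lemma continuous_vectorHarmonic_sphere {l : ℕ} {H : E3 → ℝ} (hH : IsHomog l H) (τ : Fin 3) :
    Continuous fun n : sphere (0 : E3) 1 => vectorHarmonic τ H n := by
  simpa using continuous_on_sphere (contDiffOn_vectorHarmonic hH τ).continuousOn (r := 1)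
    (fun n => smul_ne_zero one_ne_zero (sphere_ne_zero n))

lemma integral_inner_gradient_angular {l m : ℕ} {H G : E3 → ℝ} (hH : IsHomog l H) (hG : IsSolidHarmonic m G) :
    ∫ n : sphere (0 : E3) 1, ⟪∇ (angular H) n, ∇ (angular G) n⟫ ∂sphereMeasure
      = m * (m + 1) * ∫ n : sphere (0 : E3) 1, H n * G n ∂sphereMeasure := by
  have h := sphereIntegral_inner_gradient_angular isOpen_Ioi subset_rfl
    (by rw [shell_Ioi]; exact hH.angular_contDiffOn.of_le one_le_infty) hG (mem_Ioi.2 (one_pos (α := ℝ)))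
  simpa [sphereIntegral, angular] using h

lemma integral_inner_gradient_axial {l m : ℕ} {H G : E3 → ℝ} (hH : IsHomog l H) (hG : IsHomog m G) :
    ∫ n : sphere (0 : E3) 1, ⟪∇ (angular H) n, axialField G n⟫ ∂sphereMeasure = 0 := by
  have h := sphereIntegral_inner_gradient_axial isOpen_Ioi subset_rfl
    (by rw [shell_Ioi]; exact hH.angular_contDiffOn.of_le one_le_infty) hG (mem_Ioi.2 (one_pos (α := ℝ)))
  simpa [sphereIntegral] using h

lemma integral_harmonic_orthogonal {l m : ℕ} {H G : E3 → ℝ} (hH : IsSolidHarmonic l H) (hG : IsSolidHarmonic m G)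
    (hlm : l ≠ m) : ∫ n : sphere (0 : E3) 1, H n * G n ∂sphereMeasure = 0 := by
  have h := sphereIntegral_angular_orthogonal hH hG hlm one_pos
  simpa [sphereIntegral, angular] using h

lemma inner_vectorHarmonic_tangential {l : ℕ} {H G : E3 → ℝ} (hH : IsHomog l H) (n : sphere (0 : E3) 1) :
    ⟪vectorHarmonic 0 G n, vectorHarmonic 1 H n⟫ = 0 ∧ ⟪vectorHarmonic 0 G n, vectorHarmonic 2 H n⟫ = 0 := by
  rw [vectorHarmonic_zero_sphere, vectorHarmonic_one_sphere, vectorHarmonic_two_sphere, real_inner_smul_left,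
    real_inner_smul_left, real_inner_comm, hH.inner_gradient_angular (sphere_ne_zero n), real_inner_comm,
    inner_axialField, mul_zero, and_self]

/-- Radial and tangential harmonics are orthogonal pointwise, and gradients are orthogonal to axial
fields after integration by parts. The vector product with the normal is a quarter turn of the
tangent plane, so axial fields have the same inner products as gradients. -/
lemma integral_inner_vectorHarmonic {l m : ℕ} {H G : E3 → ℝ} (hH : IsSolidHarmonic l H) (hG : IsSolidHarmonic m G)
    (τ σ : Fin 3) :
    ∫ n : sphere (0 : E3) 1, ⟪vectorHarmonic τ H n, vectorHarmonic σ G n⟫ ∂sphereMeasure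
      = if τ = σ then vectorWeight τ m * ∫ n : sphere (0 : E3) 1, H n * G n ∂sphereMeasure else 0 := by
  have e1 := integral_inner_gradient_angular hH.isHomog hG
  have e2 := integral_inner_gradient_axial hH.isHomog hG.isHomog
  have e3 := integral_inner_gradient_axial hG.isHomog hH.isHomog
  have t1 := fun n => (inner_vectorHarmonic_tangential (G := H) hG.isHomog n)
  have t2 := fun n => (inner_vectorHarmonic_tangential (G := G) hH.isHomog n)
  fin_cases τ <;> fin_cases σ <;> simp only [Fin.zero_eta, Fin.mk_one, Fin.reduceFinMk, if_true, Fin.isValue,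
    Fin.reduceEq, if_false, zero_ne_one, one_ne_zero]
  · simp only [vectorHarmonic_zero_sphere, real_inner_smul_left, real_inner_smul_right,
      real_inner_self_eq_norm_sq, norm_sphere, vectorWeight, if_true, one_mul]
    simp [mul_comm]
  · simp only [(t1 _).1, integral_zero]
  · simp only [(t1 _).2, integral_zero]
  · simp only [real_inner_comm (vectorHarmonic 0 G _), (t2 _).1, integral_zero]
  · simp only [vectorHarmonic_one_sphere, e1]; rfl
  · simp only [vectorHarmonic_one_sphere, vectorHarmonic_two_sphere, e2]
  · simp only [real_inner_comm (vectorHarmonic 0 G _), (t2 _).2, integral_zero]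
  · simp only [vectorHarmonic_one_sphere, vectorHarmonic_two_sphere, real_inner_comm (∇ (angular G) _), e3]
  · have e : ∀ n : sphere (0 : E3) 1, ⟪axialField H n, axialField G n⟫ = ⟪∇ (angular H) n, ∇ (angular G) n⟫ := by
      intro n
      rw [axialField, axialField, norm_sphere, inv_one, one_smul, inner_cross_cross,
        hH.isHomog.inner_gradient_angular (sphere_ne_zero n), norm_sphere]
      ring
    simp only [vectorHarmonic_two_sphere, e, e1]; rfl

lemma vectorHarmonic_sum {d : ℕ} {Y : Fin d → E3 → ℝ} {l : ℕ} (hY : ∀ i, IsHomog l (Y i)) {G : E3 → ℝ}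
    {g : Fin d → ℝ} (hG : ∀ x, G x = ∑ i, g i * Y i x) (τ : Fin 3) {x : E3} (hx : x ≠ 0) :
    vectorHarmonic τ G x = ∑ i, g i • vectorHarmonic τ (Y i) x := by
  have h0 : ∀ z, angular G z = ∑ i, g i * angular (Y i) z := fun z => hG _
  have h1 : ∇ (angular G) x = ∑ i, g i • ∇ (angular (Y i)) x := by
    refine ext_inner_right ℝ fun y => ?_
    have e : angular G = fun z => ∑ i, g i * angular (Y i) z := funext h0
    have hd : ∀ i ∈ Finset.univ, DifferentiableAt ℝ (fun z => g i * angular (Y i) z) x := fun i _ =>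
      (angular_differentiableAt (hY i).1 hx).const_mul _
    rw [inner_grad, e, fderiv_fun_sum hd, sum_inner, sum_apply]
    refine Finset.sum_congr rfl fun i _ => ?_
    rw [fderiv_const_mul (angular_differentiableAt (hY i).1 hx), real_inner_smul_left, inner_grad]
    rfl
  have h2 : axialField G x = ∑ i, g i • axialField (Y i) x := by
    have hz : ∀ s : Finset (Fin d), cross (∑ i ∈ s, g i • ∇ (angular (Y i)) x) (‖x‖⁻¹ • x)
        = ∑ i ∈ s, g i • axialField (Y i) x := by
      intro s
      induction s using Finset.induction_on with
      | empty => simp [cross_zero_left]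
      | insert i s hi ih => rw [Finset.sum_insert hi, Finset.sum_insert hi, cross_add_left, ih, cross_smul_left]; rfl
    rw [axialField, h1]; exact hz _
  fin_cases τ
  · change angular G x • (‖x‖⁻¹ • x) = ∑ i, g i • (angular (Y i) x • (‖x‖⁻¹ • x))
    rw [h0, Finset.sum_smul]; simp only [mul_smul]
  · change ‖x‖ • ∇ (angular G) x = ∑ i, g i • (‖x‖ • ∇ (angular (Y i)) x)
    rw [h1, Finset.smul_sum]; simp only [smul_comm ‖x‖]
  · change ‖x‖ • axialField G x = ∑ i, g i • (‖x‖ • axialField (Y i) x)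
    rw [h2, Finset.smul_sum]; simp only [smul_comm ‖x‖]

/-- The expansion of a continuous field without radial mean in vector spherical harmonics. -/
lemma tendsto_vectorHarmonic_expansion {V : sphere (0 : E3) 1 → E3} (hV : Continuous V)
    (h0 : ∫ n, ⟪V n, (n : E3)⟫ ∂sphereMeasure = 0) {d : ℕ → ℕ} {Y : ∀ l, Fin (d l) → E3 → ℝ}
    (hY : ∀ l i, IsSolidHarmonic l (Y l i))
    (hYs : ∀ l G, IsSolidHarmonic l G → ∀ x,
      G x = ∑ i, (∫ n : sphere (0 : E3) 1, Y l i n * G n ∂sphereMeasure) * Y l i x) :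
    Tendsto (fun N : ℕ => ∫⁻ n, ‖V n - ∑ l ∈ Finset.Icc 1 N, ∑ i, ∑ τ,
      ((∫ m : sphere (0 : E3) 1, ⟪V m, vectorHarmonic τ (Y l i) m⟫ ∂sphereMeasure) / vectorWeight τ l) •
        vectorHarmonic τ (Y l i) n‖ₑ ^ 2 ∂sphereMeasure) atTop (𝓝 0) := by
  set X : Fin 3 → ∀ l, Fin (d l) → sphere (0 : E3) 1 → E3 := fun τ l i n => vectorHarmonic τ (Y l i) n with hX
  have hXc : ∀ τ l i, Continuous (X τ l i) := fun τ l i => continuous_vectorHarmonic_sphere (hY l i).isHomog τ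
  set c : Fin 3 → ∀ l, Fin (d l) → ℝ := fun τ l i => (∫ m, ⟪V m, X τ l i m⟫ ∂sphereMeasure) / vectorWeight τ l with hc
  set P : ℕ → sphere (0 : E3) 1 → E3 := fun N n => ∑ l ∈ Finset.Icc 1 N, ∑ i, ∑ τ, c τ l i • X τ l i n with hP
  have hPc : ∀ N, Continuous (P N) := fun N =>
    continuous_finsetSum _ fun l _ => continuous_finsetSum _ fun i _ => continuous_finsetSum _ fun τ _ =>
      show Continuous fun n => c τ l i • X τ l i n from (hXc τ l i).const_smul (c τ l i)
  have hint : ∀ {f g : sphere (0 : E3) 1 → E3}, Continuous f → Continuous g →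
      Integrable (fun n => ⟪f n, g n⟫) sphereMeasure := fun hf hg => continuous_sphere_integrable (hf.inner hg)
  -- pairing of the partial sums with vector spherical harmonics
  have hpair : ∀ N m (G : E3 → ℝ), IsSolidHarmonic m G → ∀ σ,
      ∫ n, ⟪P N n, vectorHarmonic σ G n⟫ ∂sphereMeasure = ∑ l ∈ Finset.Icc 1 N, ∑ i,
        c σ l i * (vectorWeight σ m * ∫ n : sphere (0 : E3) 1, Y l i n * G n ∂sphereMeasure) := by
    intro N m G hG σ
    have hGc := continuous_vectorHarmonic_sphere hG.isHomog σ
    simp only [hP, sum_inner, real_inner_smul_left]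
    rw [integral_finsetSum _ fun l _ => integrable_finsetSum _ fun i _ => integrable_finsetSum _ fun τ _ =>
      (hint (hXc τ l i) hGc).const_mul _]
    refine Finset.sum_congr rfl fun l _ => ?_
    rw [integral_finsetSum _ fun i _ => integrable_finsetSum _ fun τ _ => (hint (hXc τ l i) hGc).const_mul _]
    refine Finset.sum_congr rfl fun i _ => ?_
    rw [integral_finsetSum _ fun τ _ => (hint (hXc τ l i) hGc).const_mul _]
    simp only [integral_const_mul, hX, integral_inner_vectorHarmonic (hY l i) hG, mul_ite, mul_zero,
      Finset.sum_ite_eq', Finset.mem_univ, if_true]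
  -- The sums start at l = 1. In degree 0 only the radial harmonic is nonzero, and orthogonality to
  -- it is the hypothesis that the radial component has no mean.
  have horth : ∀ N m, m ≤ N → ∀ (G : E3 → ℝ), IsSolidHarmonic m G → ∀ σ,
      ∫ n, ⟪V n - P N n, vectorHarmonic σ G n⟫ ∂sphereMeasure = 0 := by
    intro N m hm G hG σ
    have hGc := continuous_vectorHarmonic_sphere hG.isHomog σ
    simp only [inner_sub_left]
    rw [integral_sub (hint hV hGc) (hint (hPc N) hGc), hpair N m G hG σ, sub_eq_zero]
    rcases Nat.eq_zero_or_pos m with rfl | hm1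
    · rw [Finset.sum_eq_zero]
      · have hGe : G = fun _ => G 0 := funext fun x => hG.isHomog.const_of_zero x
        have ha : angular G = fun _ => G 0 := by rw [hGe]; rfl
        have hgr : ∀ x, ∇ (angular G) x = 0 := fun x => by rw [ha]; exact gradient_const x _
        fin_cases σ
        · simp only [Fin.zero_eta, vectorHarmonic_zero_sphere, real_inner_smul_right]
          rw [hGe]
          simp only
          rw [integral_const_mul, h0, mul_zero]
        · simp [vectorHarmonic, hgr]
        · simp [vectorHarmonic, axialField, hgr, cross_zero_left]
      · intro l hl
        refine Finset.sum_eq_zero fun i _ => ?_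
        rw [integral_harmonic_orthogonal (hY l i) hG (by have := (Finset.mem_Icc.1 hl).1; omega)]
        ring
    · rw [Finset.sum_eq_single_of_mem m (Finset.mem_Icc.2 ⟨hm1, hm⟩)]
      · have hw := vectorWeight_ne_zero σ hm1
        have e : ∀ n : sphere (0 : E3) 1, ⟪V n, vectorHarmonic σ G n⟫
            = ∑ i, (∫ n : sphere (0 : E3) 1, Y m i n * G n ∂sphereMeasure) * ⟪V n, X σ m i n⟫ := fun n => by
          rw [vectorHarmonic_sum (fun i => (hY m i).isHomog) (hYs m G hG) σ (sphere_ne_zero n), inner_sum]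
          simp only [real_inner_smul_right, hX]
        simp only [e]
        rw [integral_finsetSum _ fun i _ => (hint hV (hXc σ m i)).const_mul _]
        refine Finset.sum_congr rfl fun i _ => ?_
        rw [integral_const_mul, hc]
        field_simp
      · intro l _ hl
        refine Finset.sum_eq_zero fun i _ => ?_
        rw [integral_harmonic_orthogonal (hY l i) hG hl]
        ring
  have hspan : ∀ N, ∀ p ∈ vectorSpan N, Continuous p ∧ ∫ n, ⟪V n - P N n, p n⟫ ∂sphereMeasure = 0 := by
    intro N p hp
    have hEc : Continuous fun n => V n - P N n := hV.sub (hPc N)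
    refine Submodule.span_induction (p := fun p _ => Continuous p ∧ ∫ n, ⟪V n - P N n, p n⟫ ∂sphereMeasure = 0)
      ?_ ?_ ?_ ?_ hp
    · rintro p ⟨l, hl, H, hH, rfl | rfl | rfl⟩
      · have := horth N l hl H hH 0
        have hc := continuous_vectorHarmonic_sphere hH.isHomog 0
        simp only [vectorHarmonic_zero_sphere] at this hc
        exact ⟨hc, this⟩
      · have := horth N l hl H hH 1
        have hc := continuous_vectorHarmonic_sphere hH.isHomog 1
        simp only [vectorHarmonic_one_sphere] at this hc
        exact ⟨hc, this⟩
      · have := horth N l hl H hH 2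
        have hc := continuous_vectorHarmonic_sphere hH.isHomog 2
        simp only [vectorHarmonic_two_sphere] at this hc
        exact ⟨hc, this⟩
    · exact ⟨continuous_const, by simp⟩
    · rintro p q - - ⟨hp, hp0⟩ ⟨hq, hq0⟩
      refine ⟨hp.add hq, ?_⟩
      simp only [Pi.add_apply, inner_add_right]
      rw [integral_add (hint hEc hp) (hint hEc hq), hp0, hq0, add_zero]
    · rintro a p - ⟨hp, hp0⟩
      refine ⟨hp.const_smul a, ?_⟩
      simp only [Pi.smul_apply, real_inner_smul_right]
      rw [integral_const_mul, hp0, mul_zero]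
  have hPmem : ∀ N, P N ∈ vectorSpan N := by
    intro N
    have e : P N = ∑ l ∈ Finset.Icc 1 N, ∑ i, ∑ τ, c τ l i • X τ l i := by
      ext1 n; simp [hP, Finset.sum_apply]
    rw [e]
    refine Submodule.sum_mem _ fun l hl => Submodule.sum_mem _ fun i _ => Submodule.sum_mem _ fun τ _ =>
      Submodule.smul_mem _ _ (Submodule.subset_span ⟨l, (Finset.mem_Icc.1 hl).2, Y l i, hY l i, ?_⟩)
    fin_cases τ
    · exact Or.inl (funext fun n => vectorHarmonic_zero_sphere _ n)
    · exact Or.inr (Or.inl (funext fun n => vectorHarmonic_one_sphere _ n))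
    · exact Or.inr (Or.inr (funext fun n => vectorHarmonic_two_sphere _ n))
  -- Best approximation: V - P is orthogonal to p - P, so its squared norm is its inner product with
  -- V - p. Young's inequality then bounds it by the squared norm of V - p.
  have hbound : ∀ ε > 0, ∃ N₀, ∀ N ≥ N₀, ∫ n, ‖V n - P N n‖ ^ 2 ∂sphereMeasure ≤ ε ^ 2 * sphereMeasure.real univ := by
    intro ε hε
    obtain ⟨N₀, p, hp, hpb⟩ := exists_vectorSpan_approx hV hε
    refine ⟨N₀, fun N hN => ?_⟩
    have hp' := vectorSpan_mono hN hp
    obtain ⟨hpc, -⟩ := hspan N p hp'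
    obtain ⟨hqc, hq0⟩ := hspan N (p - P N) (sub_mem hp' (hPmem N))
    have hEc : Continuous fun n => V n - P N n := hV.sub (hPc N)
    have i1 : Integrable (fun n => ‖V n - P N n‖ ^ 2) sphereMeasure := continuous_sphere_integrable (by fun_prop)
    have i2 : Integrable (fun n => ‖V n - p n‖ ^ 2) sphereMeasure := continuous_sphere_integrable (by fun_prop)
    have h1 : ∫ n, ‖V n - P N n‖ ^ 2 ∂sphereMeasure
        ≤ ∫ n, (‖V n - p n‖ ^ 2 / 2 + ‖V n - P N n‖ ^ 2 / 2 + ⟪V n - P N n, (p - P N) n⟫) ∂sphereMeasure := by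
      refine integral_mono i1 (((i2.div_const 2).add (i1.div_const 2)).add (hint hEc hqc)) fun n => ?_
      have e : ‖V n - P N n‖ ^ 2 = ⟪V n - P N n, V n - p n⟫ + ⟪V n - P N n, (p - P N) n⟫ := by
        rw [← inner_add_right, ← real_inner_self_eq_norm_sq, Pi.sub_apply]
        congr 1; abel
      have h2 := real_inner_le_norm (V n - P N n) (V n - p n)
      have h3 := sq_nonneg (‖V n - P N n‖ - ‖V n - p n‖)
      beta_reduce
      nlinarith
    have i3 : Integrable (fun n => ‖V n - p n‖ ^ 2 / 2 + ‖V n - P N n‖ ^ 2 / 2) sphereMeasure :=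
      (i2.div_const 2).add (i1.div_const 2)
    rw [integral_add i3 (hint hEc hqc), hq0,
      integral_add (i2.div_const 2) (i1.div_const 2), integral_div, integral_div] at h1
    have h4 : ∫ n, ‖V n - p n‖ ^ 2 ∂sphereMeasure ≤ ∫ n, ε ^ 2 ∂sphereMeasure :=
      integral_mono i2 (integrable_const _) fun n => pow_le_pow_left₀ (norm_nonneg _) (hpb n) 2
    rw [integral_const, smul_eq_mul, mul_comm] at h4
    linarith
  have hreal : Tendsto (fun N => ∫ n, ‖V n - P N n‖ ^ 2 ∂sphereMeasure) atTop (𝓝 0) := by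
    rw [Metric.tendsto_atTop]
    intro δ hδ
    have hm : 0 ≤ sphereMeasure.real univ := measureReal_nonneg
    obtain ⟨N₀, hN₀⟩ := hbound (Real.sqrt (δ / (sphereMeasure.real univ + 1))) (by positivity)
    refine ⟨N₀, fun N hN => ?_⟩
    have h1 := hN₀ N hN
    rw [Real.sq_sqrt (by positivity)] at h1
    have h2 : 0 ≤ ∫ n, ‖V n - P N n‖ ^ 2 ∂sphereMeasure := integral_nonneg fun n => by positivity
    rw [Real.dist_eq, sub_zero, abs_of_nonneg h2]
    refine h1.trans_lt ?_
    rw [div_mul_eq_mul_div, div_lt_iff₀ (by positivity)]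
    nlinarith
  have hfin := ENNReal.tendsto_ofReal hreal
  rw [ENNReal.ofReal_zero] at hfin
  refine hfin.congr fun N => ?_
  have hEc : Continuous fun n => V n - P N n := hV.sub (hPc N)
  rw [ofReal_integral_eq_lintegral_ofReal (continuous_sphere_integrable (by fun_prop))
    (Eventually.of_forall fun n => by positivity)]
  refine lintegral_congr fun n => ?_
  rw [ENNReal.ofReal_pow (norm_nonneg _), ofReal_norm]

/-! ### Amplitudes of a velocity field -/

/-- The amplitude of `v` on a vector spherical harmonic of degree `l`, as a function of the radius. -/
def amplitude (τ : Fin 3) (l : ℕ) (Y : E3 → ℝ) (v : E3 → E3) (r : ℝ) : ℝ :=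
  (∫ n : sphere (0 : E3) 1, ⟪v (r • (n : E3)), vectorHarmonic τ Y n⟫ ∂sphereMeasure) / vectorWeight τ l

lemma continuousOn_integral_sphere {I : Set ℝ} [LocallyCompactSpace I] {g : ℝ → sphere (0 : E3) 1 → ℝ}
    (hg : ContinuousOn (fun q : ℝ × sphere (0 : E3) 1 => g q.1 q.2) (I ×ˢ univ)) :
    ContinuousOn (fun r => ∫ n, g r n ∂sphereMeasure) I := by
  rw [continuousOn_iff_continuous_domRestrict]
  have : Continuous fun q : I × sphere (0 : E3) 1 => g q.1 q.2 :=
    continuousOn_univ.1 (hg.comp (by fun_prop : Continuous fun q : I × sphere (0 : E3) 1 =>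
      ((q.1 : ℝ), q.2)).continuousOn (fun q _ => ⟨q.1.2, mem_univ _⟩))
  have h := continuous_parametric_integral_of_continuous (μ := sphereMeasure)
    (f := fun (r : I) (n : sphere (0 : E3) 1) => g r n) this isCompact_univ
  simpa [Set.domRestrict_def] using h

lemma smul_sphere_mem_closedBall {R r : ℝ} (hr : r ∈ Icc 0 R) (n : sphere (0 : E3) 1) :
    r • (n : E3) ∈ closedBall (0 : E3) R := by
  rw [mem_closedBall_zero_iff, norm_smul_sphere hr.1]; exact hr.2

lemma mapsTo_smul_sphere (R : ℝ) : MapsTo (fun q : ℝ × sphere (0 : E3) 1 => q.1 • (q.2 : E3)) (Icc 0 R ×ˢ univ)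
    (closedBall 0 R) := fun q hq => smul_sphere_mem_closedBall hq.1 q.2

/-- Spherical averages of a continuously differentiable field are so up to the centre and the surface. -/
lemma exists_contDiff_sphere_average {v : E3 → E3} {R : ℝ} (hR : 0 < R) (hv : ContDiffOn ℝ 1 v (closedBall 0 R))
    {X : sphere (0 : E3) 1 → E3} (hX : Continuous X) : ∃ c : ℝ → ℝ, ContDiff ℝ 1 c ∧
    (∀ r ∈ Icc 0 R, c r = ∫ n, ⟪v (r • (n : E3)), X n⟫ ∂sphereMeasure) ∧
    deriv c 0 = ∫ n, ⟪fderiv ℝ v 0 n, X n⟫ ∂sphereMeasure := by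
  have hud : UniqueDiffOn ℝ (closedBall (0 : E3) R) := uniqueDiffOn_convex (convex_closedBall _ _) (by
    rw [interior_closedBall _ hR.ne']; exact nonempty_ball.2 hR)
  have : LocallyCompactSpace (Icc 0 R) := isClosed_Icc.isClosedEmbedding_subtypeVal.locallyCompactSpace
  have hsm : ContinuousOn (fun q : ℝ × sphere (0 : E3) 1 => q.1 • (q.2 : E3)) (Icc 0 R ×ˢ univ) := by fun_prop
  have hXq : ContinuousOn (fun q : ℝ × sphere (0 : E3) 1 => X q.2) (Icc 0 R ×ˢ univ) := by fun_prop
  -- The derivative within the closed ball is continuous up to the surface, unlike the full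
  -- derivative, about which nothing is known there.
  set D := fderivWithin ℝ v (closedBall 0 R) with hD
  have hDc : ContinuousOn D (closedBall 0 R) := hv.continuousOn_fderivWithin hud le_rfl
  have hgc : ContinuousOn (fun q : ℝ × sphere (0 : E3) 1 => ⟪v (q.1 • (q.2 : E3)), X q.2⟫) (Icc 0 R ×ˢ univ) :=
    (hv.continuousOn.comp hsm (mapsTo_smul_sphere R)).inner hXq
  have hg'c : ContinuousOn (fun q : ℝ × sphere (0 : E3) 1 => ⟪D (q.1 • (q.2 : E3)) q.2, X q.2⟫)
      (Icc 0 R ×ˢ univ) :=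
    ((hDc.comp hsm (mapsTo_smul_sphere R)).clm_apply (by fun_prop)).inner hXq
  set f : ℝ → ℝ := fun r => ∫ n, ⟪v (r • (n : E3)), X n⟫ ∂sphereMeasure with hf
  set φ : ℝ → ℝ := fun r => ∫ n : sphere (0 : E3) 1, ⟪D (r • (n : E3)) n, X n⟫ ∂sphereMeasure with hφ
  have hfc : ContinuousOn f (Icc 0 R) := continuousOn_integral_sphere hgc
  have hφc : ContinuousOn φ (Icc 0 R) := continuousOn_integral_sphere hg'c
  have hfd : ∀ r ∈ Ioo 0 R, HasDerivAt f (φ r) r := by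
    intro r hr
    have hs : ∀ t ∈ Ioo 0 R, t ∈ Icc 0 R := fun t ht => Ioo_subset_Icc_self ht
    refine hasDerivAt_integral_sphere (G := fun t n => ⟪v (t • (n : E3)), X n⟫)
      (G' := fun t n => ⟪D (t • (n : E3)) n, X n⟫) (isOpen_Ioo.mem_nhds hr) (fun t ht n => ?_) (fun t ht => ?_)
      (hg'c.mono (prod_mono Ioo_subset_Icc_self subset_rfl))
    · have hm : t • (n : E3) ∈ ball (0 : E3) R := by
        rw [mem_ball_zero_iff, norm_smul_sphere ht.1.le]; exact ht.2
      have h1 : HasFDerivAt v (D (t • (n : E3))) (t • (n : E3)) :=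
        ((hv.differentiableOn one_ne_zero _ (ball_subset_closedBall hm)).hasFDerivWithinAt).hasFDerivAt
          (closedBall_mem_nhds_of_mem hm)
      have h2 : HasDerivAt (fun s : ℝ => s • (n : E3)) (n : E3) t := by
        simpa using (hasDerivAt_id t).smul_const (n : E3)
      simpa using (h1.comp_hasDerivAt t h2).inner ℝ (hasDerivAt_const t (X n))
    · exact (continuous_on_sphere hv.continuousOn (smul_sphere_mem_closedBall (hs t ht))).inner hX
  -- The derivative of the average is frozen at its end values beyond [0, R]. Its primitive is a C¹
  -- function on the whole line that agrees with the average on [0, R].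
  set ψ : ℝ → ℝ := fun s => φ (projIcc 0 R hR.le s) with hψ
  have hψc : Continuous ψ := hφc.comp_continuous (continuous_subtype_val.comp continuous_projIcc)
    fun s => (projIcc 0 R hR.le s).2
  have hcd : ∀ r, HasDerivAt (fun r => f 0 + ∫ s in (0 : ℝ)..r, ψ s) (ψ r) r := fun r =>
    (intervalIntegral.integral_hasDerivAt_right (hψc.intervalIntegrable _ _)
      (hψc.stronglyMeasurableAtFilter _ _) hψc.continuousAt).const_add _
  have hde : deriv (fun r => f 0 + ∫ s in (0 : ℝ)..r, ψ s) = ψ := funext fun r => (hcd r).deriv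
  refine ⟨fun r => f 0 + ∫ s in (0 : ℝ)..r, ψ s, ?_, fun r hr => ?_, ?_⟩
  · rw [contDiff_one_iff_deriv, hde]
    exact ⟨fun r => (hcd r).differentiableAt, hψc⟩
  · have h1 : ∫ s in (0 : ℝ)..r, ψ s = f r - f 0 := by
      refine intervalIntegral.integral_eq_sub_of_hasDerivAt_of_le hr.1 (hfc.mono (Icc_subset_Icc_right hr.2))
        (fun t ht => ?_) (hψc.intervalIntegrable _ _)
      have ht' : t ∈ Ioo 0 R := ⟨ht.1, ht.2.trans_le hr.2⟩
      have e : ψ t = φ t := by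
        rw [hψ]; simp only; rw [projIcc_of_mem hR.le (Ioo_subset_Icc_self ht')]
      rw [e]; exact hfd t ht'
    beta_reduce
    rw [h1]; ring
  · rw [hde, hψ]
    simp only [projIcc_left, hφ, zero_smul]
    rw [hD, fderivWithin_of_mem_nhds (closedBall_mem_nhds 0 hR)]

/-- Both modes of `v` on a solid harmonic extend continuously differentiably to the centre. -/
def HasRegularModes (R : ℝ) (l : ℕ) (Y : E3 → ℝ) (v : E3 → E3) : Prop :=
  (∃ b, ContDiffOn ℝ 1 b (closedBall 0 R) ∧ ∀ x ∈ closedBall (0 : E3) R, x ≠ 0 →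
    b x = polarField Y (amplitude 0 l Y v) (amplitude 1 l Y v) x) ∧
  ∃ a, ContDiffOn ℝ 1 a (closedBall 0 R) ∧ ∀ x ∈ closedBall (0 : E3) R, x ≠ 0 →
    a x = amplitude 2 l Y v ‖x‖ • (‖x‖ • axialField Y x)

section
variable {R : ℝ} {l : ℕ} {Y : E3 → ℝ} {v w : E3 → E3}

lemma amplitude_congr (h : ∀ x ∈ closedBall (0 : E3) R, v x = w x) (τ : Fin 3) {r : ℝ} (hr : r ∈ Icc 0 R) :
    amplitude τ l Y v r = amplitude τ l Y w r := by
  unfold amplitude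
  simp only [h _ (smul_sphere_mem_closedBall hr _)]

lemma amplitude_add (hY : IsHomog l Y) (hv : ContinuousOn v (closedBall 0 R)) (hw : ContinuousOn w (closedBall 0 R))
    (τ : Fin 3) {r : ℝ} (hr : r ∈ Icc 0 R) :
    amplitude τ l Y (fun x => v x + w x) r = amplitude τ l Y v r + amplitude τ l Y w r := by
  have hX := continuous_vectorHarmonic_sphere hY τ
  have c1 := continuous_on_sphere hv (smul_sphere_mem_closedBall hr)
  have c2 := continuous_on_sphere hw (smul_sphere_mem_closedBall hr)
  unfold amplitude
  simp only [inner_add_left]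
  rw [integral_add (continuous_sphere_integrable (c1.inner hX)) (continuous_sphere_integrable (c2.inner hX)), add_div]

lemma norm_mem_Icc {x : E3} (hx : x ∈ closedBall (0 : E3) R) : ‖x‖ ∈ Icc 0 R :=
  ⟨norm_nonneg x, by simpa using hx⟩

lemma HasRegularModes.congr (hw : HasRegularModes R l Y w) (h : ∀ x ∈ closedBall (0 : E3) R, v x = w x) :
    HasRegularModes R l Y v := by
  obtain ⟨⟨b, hb, hbe⟩, a, ha, hae⟩ := hw
  refine ⟨⟨b, hb, fun x hx hx0 => ?_⟩, a, ha, fun x hx hx0 => ?_⟩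
  · rw [hbe x hx hx0, polarField, polarField, amplitude_congr h 0 (norm_mem_Icc hx),
      amplitude_congr h 1 (norm_mem_Icc hx)]
  · rw [hae x hx hx0, amplitude_congr h 2 (norm_mem_Icc hx)]

lemma HasRegularModes.add (hY : IsHomog l Y) (hv : HasRegularModes R l Y v) (hw : HasRegularModes R l Y w)
    (hvc : ContinuousOn v (closedBall 0 R)) (hwc : ContinuousOn w (closedBall 0 R)) :
    HasRegularModes R l Y (fun x => v x + w x) := by
  obtain ⟨⟨b, hb, hbe⟩, a, ha, hae⟩ := hv
  obtain ⟨⟨b', hb', hbe'⟩, a', ha', hae'⟩ := hw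
  refine ⟨⟨fun x => b x + b' x, hb.add hb', fun x hx hx0 => ?_⟩, fun x => a x + a' x, ha.add ha', fun x hx hx0 => ?_⟩
  · simp only [hbe x hx hx0, hbe' x hx hx0, polarField, amplitude_add hY hvc hwc _ (norm_mem_Icc hx)]
    module
  · simp only [hae x hx hx0, hae' x hx hx0, amplitude_add hY hvc hwc _ (norm_mem_Icc hx)]
    module

/-- If v vanishes to first order at the centre, so do all its amplitudes, and the factors r and φ
needed for regularity at the origin are supplied by the amplitudes themselves. -/
lemma hasRegularModes_of_flat (hR : 0 < R) (hY : IsHomog l Y) (hv : ContDiffOn ℝ 1 v (closedBall 0 R)) (h0 : v 0 = 0)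
    (h0' : fderiv ℝ v 0 = 0) : HasRegularModes R l Y v := by
  have hc : ∀ τ, ∃ c : ℝ → ℝ, ContDiff ℝ 1 c ∧ (∀ r ∈ Icc 0 R, c r = amplitude τ l Y v r) ∧ c 0 = 0 ∧ deriv c 0 = 0 := by
    intro τ
    obtain ⟨c, hc, hce, hc'⟩ := exists_contDiff_sphere_average hR hv (continuous_vectorHarmonic_sphere hY τ)
    refine ⟨fun r => c r / vectorWeight τ l, hc.div_const _, fun r hr => by beta_reduce; rw [hce r hr]; rfl, ?_, ?_⟩
    · beta_reduce
      rw [hce 0 ⟨le_rfl, hR.le⟩]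
      simp [h0]
    · rw [deriv_div_const, hc', h0']
      simp
  choose c hc hce hc0 hc0' using hc
  refine ⟨⟨_, (contDiff_polarField hY (hc 0) (hc 1) (hc0 0) (hc0' 0) (hc0 1) (hc0' 1)).contDiffOn,
    fun x hx _ => ?_⟩, _, (contDiff_axialField hY (hc 2) (hc0 2) (hc0' 2)).contDiffOn, fun x hx _ => ?_⟩
  · rw [polarField, polarField, hce 0 _ (norm_mem_Icc hx), hce 1 _ (norm_mem_Icc hx)]
  · rw [hce 2 _ (norm_mem_Icc hx)]

lemma gradient_eq_vectorHarmonic {j : ℕ} {h : E3 → ℝ} (hh : IsHomog (j + 1) h) {x : E3} (hx : x ≠ 0) :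
    ∇ h x = ‖x‖ ^ j • ((j + 1 : ℝ) • vectorHarmonic 0 h x + vectorHarmonic 1 h x) := by
  have hn := norm_ne_zero_iff.2 hx
  change _ = ‖x‖ ^ j • ((j + 1 : ℝ) • (angular h x • (‖x‖⁻¹ • x)) + ‖x‖ • ∇ (angular h) x)
  rw [hh.gradient_angular hx, hh.angular_eq]
  simp only [smul_add, smul_sub, smul_smul, inv_pow]
  have e1 : ‖x‖ ^ j * (‖x‖ * (‖x‖ ^ (j + 1))⁻¹) = 1 := by field_simp; ring
  have e2 : ‖x‖ ^ j * ((j + 1 : ℝ) * ((‖x‖ ^ (j + 1))⁻¹ * h x * ‖x‖⁻¹))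
      = ‖x‖ ^ j * (‖x‖ * (((j + 1 : ℕ) : ℝ) * (‖x‖ ^ (j + 1 + 2))⁻¹ * h x)) := by
    push_cast; field_simp; ring
  rw [e1, one_smul, e2]; abel

/-- By orthogonality the projection on Y is zero unless the degrees agree, and is then a multiple of
∇Y. This is smooth at the centre even in degree one, where the separate radial and tangential
amplitudes do not vanish at r = 0. -/
lemma hasRegularModes_gradient {j : ℕ} {h : E3 → ℝ} (hl : 1 ≤ l) (hY : IsSolidHarmonic l Y)
    (hh : IsSolidHarmonic (j + 1) h) : HasRegularModes R l Y (∇ h) := by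
  set g := ∫ n : sphere (0 : E3) 1, h n * Y n ∂sphereMeasure with hg
  have hamp : ∀ τ r, 0 < r → amplitude τ l Y (∇ h) r
      = r ^ j * ((j + 1 : ℝ) * (if (0 : Fin 3) = τ then g else 0) + if (1 : Fin 3) = τ then g else 0) := by
    intro τ r hr
    have hw := vectorWeight_ne_zero τ hl
    have e : ∀ n : sphere (0 : E3) 1, ⟪∇ h (r • (n : E3)), vectorHarmonic τ Y n⟫
        = r ^ j * ((j + 1 : ℝ) * ⟪vectorHarmonic 0 h n, vectorHarmonic τ Y n⟫
          + ⟪vectorHarmonic 1 h n, vectorHarmonic τ Y n⟫) := by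
      intro n
      rw [gradient_eq_vectorHarmonic hh.isHomog (smul_ne_zero hr.ne' (sphere_ne_zero n)),
        vectorHarmonic_smul hh.isHomog _ hr (sphere_ne_zero n), vectorHarmonic_smul hh.isHomog _ hr (sphere_ne_zero n),
        norm_smul_sphere hr.le, real_inner_smul_left, inner_add_left, real_inner_smul_left]
    have hX := continuous_vectorHarmonic_sphere hY.isHomog τ
    have i0 := continuous_sphere_integrable ((continuous_vectorHarmonic_sphere hh.isHomog 0).inner hX)
    have i1 := continuous_sphere_integrable ((continuous_vectorHarmonic_sphere hh.isHomog 1).inner hX)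
    unfold amplitude
    simp only [e]
    rw [integral_const_mul, integral_add (i0.const_mul _) i1, integral_const_mul,
      integral_inner_vectorHarmonic hh hY, integral_inner_vectorHarmonic hh hY]
    split_ifs with h1 h2 h2
    · rw [← h1] at h2; exact absurd h2 (by decide)
    · subst h1; field_simp; ring
    · subst h2; field_simp; ring
    · simp
  refine ⟨⟨fun x => g • ∇ Y x, (((gradient_contDiff hY.smooth).of_le one_le_infty).const_smul g).contDiffOn,
    fun x _ hx0 => ?_⟩, fun _ => 0, contDiffOn_const, fun x _ hx0 => ?_⟩
  · have hr := norm_pos_iff.2 hx0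
    simp only [polarField, hamp _ _ hr]
    by_cases hlj : j + 1 = l
    · subst hlj
      rw [gradient_eq_vectorHarmonic hY.isHomog hx0]
      simp only [vectorHarmonic, if_true, Fin.isValue, zero_ne_one, one_ne_zero, if_false]
      module
    · have : g = 0 := integral_harmonic_orthogonal hh hY hlj
      simp [this]
  · have hr := norm_pos_iff.2 hx0
    simp [hamp _ _ hr]

/-- The field is purely axial of one degree, so its projection on Y is zero or a multiple of ∇Y × x,
which is smooth at the centre. -/
lemma hasRegularModes_cross {k : ℕ} {h : E3 → ℝ} (hl : 1 ≤ l) (hY : IsSolidHarmonic l Y)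
    (hh : IsSolidHarmonic k h) : HasRegularModes R l Y (fun x => cross (∇ h x) x) := by
  set g := ∫ n : sphere (0 : E3) 1, h n * Y n ∂sphereMeasure with hg
  have hamp : ∀ τ r, 0 < r → amplitude τ l Y (fun x => cross (∇ h x) x) r
      = r ^ k * (if (2 : Fin 3) = τ then g else 0) := by
    intro τ r hr
    have hw := vectorWeight_ne_zero τ hl
    have e : ∀ n : sphere (0 : E3) 1, ⟪cross (∇ h (r • (n : E3))) (r • (n : E3)), vectorHarmonic τ Y n⟫
        = r ^ k * ⟪vectorHarmonic 2 h n, vectorHarmonic τ Y n⟫ := by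
      intro n
      rw [cross_gradient_eq_axialField hh.isHomog (smul_ne_zero hr.ne' (sphere_ne_zero n)),
        hh.isHomog.axialField_smul hr (sphere_ne_zero n), norm_smul_sphere hr.le, vectorHarmonic_two_sphere,
        smul_smul, real_inner_smul_left]
      congr 1
      field_simp
      ring
    unfold amplitude
    simp only [e]
    rw [integral_const_mul, integral_inner_vectorHarmonic hh hY]
    split_ifs with h1
    · subst h1; field_simp; rfl
    · simp
  refine ⟨⟨fun _ => 0, contDiffOn_const, fun x _ hx0 => ?_⟩, fun x => g • cross (∇ Y x) x,
    (contDiffOn_cross ((gradient_contDiff hY.smooth).of_le one_le_infty).contDiffOn contDiffOn_id).const_smul g,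
    fun x _ hx0 => ?_⟩
  · have hr := norm_pos_iff.2 hx0
    simp [polarField, hamp _ _ hr]
  · have hr := norm_pos_iff.2 hx0
    simp only [hamp _ _ hr, if_true]
    by_cases hlk : k = l
    · subst hlk
      rw [cross_gradient_eq_axialField hY.isHomog hx0, smul_smul, smul_smul]
      congr 1; ring
    · have : g = 0 := integral_harmonic_orthogonal hh hY hlk
      simp [this]

lemma hasRegularModes_radial (hl : 1 ≤ l) (hY : IsSolidHarmonic l Y) (c : ℝ) :
    HasRegularModes R l Y (fun x => c • x) := by
  have h1 : IsSolidHarmonic 0 (fun _ => 1) :=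
    ⟨contDiff_const, fun x => (isHomog_const 1).laplacian_eq_zero (by norm_num) x, (isHomog_const 1).homogeneous⟩
  have hamp : ∀ τ r, amplitude τ l Y (fun x => c • x) r = 0 := by
    intro τ r
    have e : ∀ n : sphere (0 : E3) 1, ⟪c • r • (n : E3), vectorHarmonic τ Y n⟫
        = c * (r * ⟪vectorHarmonic 0 (fun _ => 1) n, vectorHarmonic τ Y n⟫) := by
      intro n
      rw [vectorHarmonic_zero_sphere, one_smul, real_inner_smul_left, real_inner_smul_left]
    unfold amplitude
    simp only [e]
    rw [integral_const_mul, integral_const_mul, integral_inner_vectorHarmonic h1 hY,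
      integral_harmonic_orthogonal h1 hY (by omega)]
    simp
  exact ⟨⟨fun _ => 0, contDiffOn_const, fun x _ _ => by simp [polarField, hamp]⟩,
    fun _ => 0, contDiffOn_const, fun x _ _ => by simp [hamp]⟩

/-- A linear map is the sum of a gradient and a rotation. -/
lemma exists_linear_decomposition (M : E3 →L[ℝ] E3) : ∃ (h : E3 → ℝ) (c : ℝ) (a₀ : E3), IsSolidHarmonic 2 h ∧
    ∀ x, M x = ∇ h x + c • x + cross a₀ x := by
  -- The symmetric part of M is the gradient of half its quadratic form. Subtracting the trace part,
  -- a multiple of |x|², makes the form harmonic; the antisymmetric part of M is a vector product.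
  have hq : IsHomog 2 (fun x => 1 / 2 * ⟪M x, x⟫) := by
    refine IsHomog.const_mul ⟨M.contDiff.inner ℝ contDiff_fun_id, fun c x => ?_⟩ _
    simp only [map_smul, real_inner_smul_left, real_inner_smul_right]; ring
  set q : E3 → ℝ := fun x => 1 / 2 * ⟪M x, x⟫ with hqd
  have hgq : ∀ x y, ⟪∇ q x, y⟫ = 1 / 2 * (⟪M x, y⟫ + ⟪M y, x⟫) := by
    intro x y
    have h1 : HasFDerivAt q _ x := (M.hasFDerivAt.inner ℝ (hasFDerivAt_id x)).const_mul (1 / 2)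
    rw [inner_grad, h1.fderiv]
    simp
  set c := Δ q 0 / 6 with hc
  have hcn : IsHomog 2 (fun x => ‖x‖ ^ 2 * c) := isHomog_normSq.mul (isHomog_const c)
  have hlap : ∀ x, Δ (fun z : E3 => ‖z‖ ^ 2 * c) x = 6 * c := fun x => by
    rw [(isHomog_const c).laplacian_normSq_mul, (isHomog_const c).laplacian_eq_zero (by norm_num)]; norm_num
  refine ⟨fun x => q x - ‖x‖ ^ 2 * c, 2 * c,
    (1 / 2 : ℝ) • ((M (unitVec 1) 2 - M (unitVec 2) 1) • unitVec 0 + (M (unitVec 2) 0 - M (unitVec 0) 2) • unitVec 1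
      + (M (unitVec 0) 1 - M (unitVec 1) 0) • unitVec 2),
    ⟨(hq.sub hcn).1, fun x => ?_, (hq.sub hcn).2⟩, fun x => ?_⟩
  · rw [laplacian_sub' hq.contDiff_two hcn.contDiff_two, hlap, hq.laplacian.const_of_zero x, hc]; ring
  · have hg2 : ∇ (fun z : E3 => ‖z‖ ^ 2 * c) x = (2 * c) • x := by
      have : (fun z : E3 => ‖z‖ ^ 2 * c) = fun z => c * ‖z‖ ^ 2 := by ext z; ring
      rw [this, gradient_const_mul' _ (hasGradientAt_normSq x).differentiableAt, (hasGradientAt_normSq x).gradient,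
        smul_smul, mul_comm]
    rw [gradient_sub' (hq.differentiable x) (hcn.differentiable x), hg2, sub_add_cancel]
    have hMx := congrArg M (coord_sum x)
    simp only [map_add, map_smul] at hMx
    have hgi : ∀ i, (∇ q x) i = 1 / 2 * (M x i + ⟪M (unitVec i), x⟫) := fun i => by
      rw [← inner_unitVec, hgq, inner_unitVec]
    ext i
    rw [PiLp.add_apply, hgi, inner_E3, hMx]
    fin_cases i <;> simp [cross_zero, cross_one, cross_two, unitVec] <;> ring

lemma gradient_inner_const (a x : E3) : ∇ (fun z : E3 => ⟪a, z⟫) x = a := by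
  refine ext_inner_right ℝ fun y => ?_
  rw [inner_grad]
  have : HasFDerivAt (fun z : E3 => ⟪a, z⟫) (innerSL ℝ a) x := (innerSL ℝ a).hasFDerivAt
  rw [this.fderiv]; rfl

lemma isSolidHarmonic_inner (a : E3) : IsSolidHarmonic 1 (fun x => ⟪a, x⟫) :=
  ⟨(isHomog_inner a).1, (isHomog_inner a).laplacian_eq_zero (by norm_num), (isHomog_inner a).2⟩

/-- The modes of a continuously differentiable field are continuously differentiable. -/
lemma hasRegularModes_of_contDiffOn (hR : 0 < R) (hl : 1 ≤ l) (hY : IsSolidHarmonic l Y)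
    (hv : ContDiffOn ℝ 1 v (closedBall 0 R)) : HasRegularModes R l Y v := by
  obtain ⟨h, c, a₀, hh, hM⟩ := exists_linear_decomposition (fderiv ℝ v 0)
  set h₀ : E3 → ℝ := fun x => ⟪v 0, x⟫ with hh₀
  set h₁ : E3 → ℝ := fun x => ⟪a₀, x⟫ with hh₁
  have s0 := isSolidHarmonic_inner (v 0)
  have s1 := isSolidHarmonic_inner a₀
  set M := fderiv ℝ v 0 with hMd
  -- The first Taylor polynomial at the centre is split off, since its amplitudes need not vanish
  -- there to first order. Its parts are two gradients of solid harmonics, a multiple of x and a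
  -- rotation, each with an explicitly regular projection.
  have hw : ContDiffOn ℝ 1 (fun x => v x - (v 0 + M x)) (closedBall 0 R) :=
    hv.sub (contDiff_const.add M.contDiff).contDiffOn
  have hflat : HasRegularModes R l Y (fun x => v x - (v 0 + M x)) := by
    refine hasRegularModes_of_flat hR hY.isHomog hw (by simp) ?_
    have hd : HasFDerivAt v M 0 :=
      ((hv.contDiffAt (closedBall_mem_nhds 0 hR)).differentiableAt one_ne_zero).hasFDerivAt
    have := hd.fun_sub (M.hasFDerivAt.const_add (v 0) (x := 0))
    rw [this.fderiv, sub_self]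
  have c0 : Continuous (∇ h₀) := (gradient_contDiff s0.smooth).continuous
  have c1 : Continuous (∇ h) := (gradient_contDiff hh.smooth).continuous
  have c3 : ContinuousOn (fun x : E3 => cross (∇ h₁ x) x) (closedBall 0 R) :=
    (contDiffOn_cross ((gradient_contDiff s1.smooth).of_le one_le_infty).contDiffOn contDiffOn_id).continuousOn
  have h2 := (hasRegularModes_gradient (R := R) hl hY s0).add hY.isHomog (hasRegularModes_gradient (j := 1) hl hY hh)
    c0.continuousOn c1.continuousOn
  have h3 := h2.add hY.isHomog (hasRegularModes_radial hl hY c) (c0.add c1).continuousOn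
    (continuous_const_smul c).continuousOn
  have h4 := h3.add hY.isHomog (hasRegularModes_cross hl hY s1)
    ((c0.add c1).add (continuous_const_smul c)).continuousOn c3
  have h5 := h4.add hY.isHomog hflat (((c0.add c1).add (continuous_const_smul c)).continuousOn.add c3) hw.continuousOn
  refine h5.congr fun x _ => ?_
  rw [gradient_inner_const, gradient_inner_const, hM]
  abel

end

/-! ### The zero-frequency subspace of an isentropic star -/

section
variable {S : BarotropicStar} {γ : ℝ → ℝ} {v w : E3 → E3} {l : ℕ} {Y : E3 → ℝ}

lemma IsCurrent.isZeroFrequency (h : IsCurrent S v) (hS : S.IsIsentropic γ) (hγ : ∀ r ∈ Ico 0 S.R, 0 < γ r) :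
    IsZeroFrequency S γ (current v) :=
  isZeroFrequency_current_iff.2 ⟨h, fun x hx => hS.adiabatic hγ (v x) hx⟩

lemma IsCurrent.differentiableAt (h : IsCurrent S v) {x : E3} (hx : x ∈ ball (0 : E3) S.R) :
    DifferentiableAt ℝ v x :=
  (h.smooth.contDiffAt (closedBall_mem_nhds_of_mem hx)).differentiableAt one_ne_zero

lemma IsCurrent.add (hv : IsCurrent S v) (hw : IsCurrent S w) : IsCurrent S (v + w) where
  smooth := hv.smooth.add hw.smooth
  mass x hx := by
    simp only [Pi.add_apply, smul_add]
    rw [divergence_add ((S.ρ_diffAt hx).fun_smul (hv.differentiableAt hx))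
      ((S.ρ_diffAt hx).fun_smul (hw.differentiableAt hx)), hv.mass x hx, hw.mass x hx, add_zero]
  surface y hy := by
    rw [Pi.add_apply, inner_add_left, mul_add, hv.surface y hy, hw.surface y hy, add_zero]

lemma IsCurrent.const_smul (hv : IsCurrent S v) (c : ℝ) : IsCurrent S (c • v) where
  smooth := hv.smooth.const_smul c
  mass x hx := by
    simp only [Pi.smul_apply, smul_comm _ c]
    rw [divergence_const_smul c ((S.ρ_diffAt hx).fun_smul (hv.differentiableAt hx)), hv.mass x hx, mul_zero]
  surface y hy := by
    rw [Pi.smul_apply, real_inner_smul_left, mul_left_comm, hv.surface y hy, mul_zero]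

lemma isCurrent_zero : IsCurrent S 0 where
  smooth := contDiffOn_const
  mass x _ := by
    simp only [Pi.zero_apply, smul_zero]
    exact divergence_zero x
  surface y _ := by simp

lemma unitRadial_continuousOn : ContinuousOn (fun x : E3 => ‖x‖⁻¹ • x) {0}ᶜ :=
  (unitRadial_contDiffOn (n := 0) (s := {0}ᶜ) fun _ h => h).continuousOn

lemma IsCurrent.radial_continuousOn (hv : IsCurrent S v) :
    ContinuousOn (fun x => ⟪v x, ‖x‖⁻¹ • x⟫) (shell (Ioo 0 S.R)) :=
  (hv.smooth.continuousOn.mono (S.shell_Ioo_subset.trans ball_subset_closedBall)).inner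
    (unitRadial_continuousOn.mono (shell_subset_compl_zero fun _ h => h.1))

lemma Ioo_subset_Ioi' (R : ℝ) : Ioo 0 R ⊆ Ioi 0 := fun _ h => h.1

lemma mean_eq_zero_of_mode (hv : IsRMode S γ l v ∨ IsGMode S γ l v) {r : ℝ} (hr : r ∈ Ioo 0 S.R) :
    sphereIntegral (fun x => ⟪v x, ‖x‖⁻¹ • x⟫) r = 0 := by
  have hc : ∀ x : E3, ‖x‖ = r → x ∈ closedBall (0 : E3) S.R := fun x hx => by
    rw [mem_closedBall_zero_iff, hx]; exact hr.2.le
  rcases hv with ⟨-, hv, -⟩ | ⟨hl, ⟨H, W, V, hH, h⟩, -⟩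
  · rw [sphereIntegral_congr (g := fun _ => 0) hr.1]
    · simp [sphereIntegral]
    · intro x hx
      rw [real_inner_smul_right, hv.inner_eq_zero (hc x hx), mul_zero]
  · rw [sphereIntegral_congr (g := fun x => (W r / r) * angular H x) hr.1]
    · rw [sphereIntegral_const_mul]
      have h1 : IsSolidHarmonic 0 (fun _ => 1) :=
        ⟨contDiff_const, fun x => (isHomog_const 1).laplacian_eq_zero (by norm_num) x, (isHomog_const 1).homogeneous⟩
      have h2 := sphereIntegral_angular_orthogonal h1 hH (by omega) hr.1
      have e : angular (fun _ => (1 : ℝ)) = fun _ => 1 := rfl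
      simp only [e, one_mul] at h2
      rw [h2, mul_zero]
    · intro x hx
      have hx0 : x ≠ 0 := norm_pos_iff.1 (hx ▸ hr.1)
      have hn := norm_ne_zero_iff.2 hx0
      rw [h x (hc x hx) hx0, inner_add_left, real_inner_smul_left, real_inner_smul_left, real_inner_smul_right,
        real_inner_smul_right, real_inner_smul_left, hH.isHomog.inner_gradient_angular hx0,
        real_inner_self_eq_norm_sq, hx]
      rw [hx] at hn
      field_simp
      ring

/-- Linear combinations of modes are currents without radial mean. -/
lemma span_modes (hv : v ∈ Submodule.span ℝ {v : E3 → E3 | ∃ l, IsRMode S γ l v ∨ IsGMode S γ l v}) :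
    IsCurrent S v ∧ ∀ r ∈ Ioo 0 S.R, sphereIntegral (fun x => ⟪v x, ‖x‖⁻¹ • x⟫) r = 0 := by
  refine Submodule.span_induction (p := fun v _ => IsCurrent S v ∧
    ∀ r ∈ Ioo 0 S.R, sphereIntegral (fun x => ⟪v x, ‖x‖⁻¹ • x⟫) r = 0) ?_ ?_ ?_ ?_ hv
  · rintro u ⟨l, hu⟩
    refine ⟨?_, fun r hr => mean_eq_zero_of_mode hu hr⟩
    rcases hu with hu | hu
    · exact (isZeroFrequency_current_iff.1 hu.2.2).1
    · exact (isZeroFrequency_current_iff.1 hu.2.2).1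
  · exact ⟨isCurrent_zero, fun r _ => by simp [sphereIntegral]⟩
  · rintro u u' - - ⟨hu, hu0⟩ ⟨hu', hu0'⟩
    refine ⟨hu.add hu', fun r hr => ?_⟩
    simp only [Pi.add_apply, inner_add_left]
    rw [sphereIntegral_add hu.radial_continuousOn hu'.radial_continuousOn (smul_mem_shell (Ioo_subset_Ioi' _) hr),
      hu0 r hr, hu0' r hr, add_zero]
  · rintro c u - ⟨hu, hu0⟩
    refine ⟨hu.const_smul c, fun r hr => ?_⟩
    simp only [Pi.smul_apply, real_inner_smul_left]
    rw [sphereIntegral_const_mul, hu0 r hr, mul_zero]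

lemma isNonRadial_current (h : ∀ r ∈ Ioo 0 S.R, sphereIntegral (fun x => ⟪v x, ‖x‖⁻¹ • x⟫) r = 0) :
    IsNonRadial S (current v) :=
  ⟨fun r _ => by simp [current, sphereIntegral], fun r _ => by simp [current, sphereIntegral],
    fun r _ => by simp [current, sphereIntegral], h⟩

/-- The equation of continuity for the amplitudes of a current. -/
lemma IsCurrent.amplitude_hasDerivAt (hv : IsCurrent S v) (hl : 1 ≤ l) (hY : IsSolidHarmonic l Y) {r : ℝ}
    (hr : r ∈ Ioo 0 S.R) :
    HasDerivAt (fun r => profile S.ρ r * amplitude 0 l Y v r)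
      (l * (l + 1) / r * (profile S.ρ r * amplitude 1 l Y v r)
        - 2 / r * (profile S.ρ r * amplitude 0 l Y v r)) r := by
  have hI0 := Ioo_subset_Ioi' S.R
  have hs := shell_subset_compl_zero hI0
  have hsb := S.shell_Ioo_subset
  have hYs : ContDiffOn ℝ 1 (angular Y) (shell (Ioo 0 S.R)) :=
    (hY.isHomog.angular_contDiffOn.mono hs).of_le one_le_infty
  have hρv : ContDiffOn ℝ 1 (fun x => S.ρ x • v x) (shell (Ioo 0 S.R)) :=
    (S.ρ_smooth.mono hsb).smul (hv.smooth.mono (hsb.trans ball_subset_closedBall))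
  -- The flux of ρ v weighted with the harmonic is ρ times the radial amplitude. The divergence
  -- drops out, and the pairing with ∇Y is the tangential amplitude.
  have h := sphereIntegral_weighted_flux isOpen_Ioo hI0 hYs hρv hr
  have e0 : ∀ t ∈ Ioo 0 S.R, sphereIntegral (fun x => angular Y x * ⟪S.ρ x • v x, ‖x‖⁻¹ • x⟫) t
      = profile S.ρ t * amplitude 0 l Y v t := by
    intro t ht
    unfold sphereIntegral amplitude
    rw [vectorWeight, if_pos rfl, div_one, ← integral_const_mul]
    refine integral_congr_ae (Eventually.of_forall fun n => ?_)
    beta_reduce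
    rw [unit_smul_sphere ht.1, angular_sphere Y ht.1, eq_profile S.ρ_radial (t • (n : E3)), norm_smul_sphere ht.1.le,
      vectorHarmonic_zero_sphere, real_inner_smul_left, real_inner_smul_right]
    ring
  have e1 : sphereIntegral (fun x => angular Y x * divergence (fun z => S.ρ z • v z) x) r = 0 := by
    rw [sphereIntegral_congr (g := fun _ => 0) hr.1]
    · simp [sphereIntegral]
    · intro x hx
      rw [hv.mass x (S.ball_eq_norm.2 (hx ▸ hr.2)), mul_zero]
  have e2 : sphereIntegral (fun x => ⟪∇ (angular Y) x, S.ρ x • v x⟫) r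
      = l * (l + 1) / r * (profile S.ρ r * amplitude 1 l Y v r) := by
    have hw := vectorWeight_ne_zero 1 hl
    have hw1 : vectorWeight 1 l = l * (l + 1) := by simp [vectorWeight]
    unfold sphereIntegral amplitude
    have e : ∀ n : sphere (0 : E3) 1, ⟪∇ (angular Y) (r • (n : E3)), S.ρ (r • (n : E3)) • v (r • (n : E3))⟫
        = (profile S.ρ r * r⁻¹) * ⟪v (r • (n : E3)), vectorHarmonic 1 Y n⟫ := by
      intro n
      rw [hY.isHomog.gradient_angular_smul hr.1 (sphere_ne_zero n), eq_profile S.ρ_radial (r • (n : E3)),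
        norm_smul_sphere hr.1.le, vectorHarmonic_one_sphere, real_inner_smul_left, real_inner_smul_right,
        real_inner_comm]
      ring
    simp only [e]
    rw [integral_const_mul, ← hw1]
    have := hr.1.ne'
    field_simp
  rw [e0 r hr, e1, e2, zero_add] at h
  refine h.congr_of_eventuallyEq ?_
  filter_upwards [isOpen_Ioo.mem_nhds hr] with t ht using (e0 t ht).symm

lemma differentiableAt_amplitude (hv : ContDiffOn ℝ 1 v (closedBall 0 S.R)) (hY : IsHomog l Y) (τ : Fin 3) {r : ℝ}
    (hr : r ∈ Ioo 0 S.R) : DifferentiableAt ℝ (amplitude τ l Y v) r := by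
  obtain ⟨c, hc, hce, -⟩ := exists_contDiff_sphere_average S.R_pos hv (continuous_vectorHarmonic_sphere hY τ)
  refine ((hc.differentiable one_ne_zero r).div_const (vectorWeight τ l)).congr_of_eventuallyEq ?_
  filter_upwards [isOpen_Ioo.mem_nhds hr] with t ht
  rw [hce t (Ioo_subset_Icc_self ht)]; rfl

/-- The projections of a current on vector spherical harmonics are modes. -/
lemma IsCurrent.exists_modes (hv : IsCurrent S v) (hS : S.IsIsentropic γ) (hγ : ∀ r ∈ Ico 0 S.R, 0 < γ r)
    (hl : 1 ≤ l) (hY : IsSolidHarmonic l Y) : ∃ a b, IsRMode S γ l a ∧ IsGMode S γ l b ∧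
    ∀ r ∈ Ioo 0 S.R, ∀ n : sphere (0 : E3) 1,
      a (r • (n : E3)) + b (r • (n : E3)) = ∑ τ, amplitude τ l Y v r • vectorHarmonic τ Y n := by
  obtain ⟨⟨b, hb, hbe⟩, a, ha, hae⟩ := hasRegularModes_of_contDiffOn S.R_pos hl hY hv.smooth
  refine ⟨a, b, IsAxial.isRMode hl ha ⟨Y, fun r => amplitude 2 l Y v r * r, hY, fun x hx hx0 => ?_⟩,
    ⟨hl, isPolar_of_eq hY hbe, ?_⟩, fun r hr n => ?_⟩
  · rw [hae x hx hx0, smul_smul]; rfl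
  · refine (isCurrent_of_polarField hY hb hbe (fun r hr => differentiableAt_amplitude hv.smooth hY.isHomog 1 hr)
      (fun r hr => hv.amplitude_hasDerivAt hl hY hr) ?_).isZeroFrequency hS hγ
    -- What remains is the surface condition for the amplitude. It follows from ρ v^r = 0, which
    -- holds at every point of the surface.
    unfold amplitude
    rw [vectorWeight, if_pos rfl, div_one, ← integral_const_mul]
    refine integral_eq_zero_of_ae (Eventually.of_forall fun n => ?_)
    have hs := hv.surface (S.R • (n : E3)) (by rw [mem_sphere_zero_iff_norm, norm_smul_sphere S.R_pos.le])
    rw [eq_profile S.ρ_radial, norm_smul_sphere S.R_pos.le, real_inner_smul_right] at hs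
    have hs' : S.R * (profile S.ρ S.R * ⟪v (S.R • (n : E3)), (n : E3)⟫) = 0 := by rw [← hs]; ring
    have := (mul_eq_zero.1 hs').resolve_left S.R_pos.ne'
    beta_reduce
    rw [vectorHarmonic_zero_sphere, real_inner_smul_right, Pi.zero_apply]
    linear_combination Y n * this
  · have hx0 := smul_ne_zero hr.1.ne' (sphere_ne_zero n)
    have hx := smul_sphere_mem_closedBall (Ioo_subset_Icc_self hr) n
    have e : ∀ τ, vectorHarmonic τ Y n = vectorHarmonic τ Y (r • (n : E3)) := fun τ =>
      (vectorHarmonic_smul hY.isHomog τ hr.1 (sphere_ne_zero n)).symm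
    rw [hae _ hx hx0, hbe _ hx hx0, Fin.sum_univ_three, e, e, e, polarField, norm_smul_sphere hr.1.le]
    simp only [vectorHarmonic, norm_smul_sphere hr.1.le]
    module

/-- A current without radial mean is a sum of modes. -/
lemma IsCurrent.exists_expansion (hv : IsCurrent S v) (hS : S.IsIsentropic γ) (hγ : ∀ r ∈ Ico 0 S.R, 0 < γ r)
    (h0 : ∀ r ∈ Ioo 0 S.R, sphereIntegral (fun x => ⟪v x, ‖x‖⁻¹ • x⟫) r = 0) :
    ∃ a b : ℕ → E3 → E3, (∀ l, a l ∈ Submodule.span ℝ {v : E3 → E3 | IsRMode S γ l v}) ∧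
      (∀ l, b l ∈ Submodule.span ℝ {v : E3 → E3 | IsGMode S γ l v}) ∧
      IsSumOnSpheres S.R (fun l => a l + b l) v := by
  choose d Y hY _ hYs using exists_harmonic_basis
  -- The condition 1 ≤ l is kept inside so that the choice can be made for all l; degree 0 receives
  -- dummy fields and is not summed.
  have hm : ∀ l (i : Fin (d l)), ∃ a b, (1 ≤ l → IsRMode S γ l a ∧ IsGMode S γ l b ∧
      ∀ r ∈ Ioo 0 S.R, ∀ n : sphere (0 : E3) 1,
        a (r • (n : E3)) + b (r • (n : E3)) = ∑ τ, amplitude τ l (Y l i) v r • vectorHarmonic τ (Y l i) n) := by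
    intro l i
    by_cases hl : 1 ≤ l
    · obtain ⟨a, b, h⟩ := hv.exists_modes hS hγ hl (hY l i)
      exact ⟨a, b, fun _ => h⟩
    · exact ⟨0, 0, fun h => absurd h hl⟩
  choose a b hab using hm
  refine ⟨fun l => if 1 ≤ l then ∑ i, a l i else 0, fun l => if 1 ≤ l then ∑ i, b l i else 0, fun l => ?_, fun l => ?_,
    fun r hr => ?_⟩
  · by_cases hl : 1 ≤ l
    · simp only [hl, if_true]
      exact Submodule.sum_mem _ fun i _ => Submodule.subset_span (hab l i hl).1
    · simp [hl]
  · by_cases hl : 1 ≤ l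
    · simp only [hl, if_true]
      exact Submodule.sum_mem _ fun i _ => Submodule.subset_span (hab l i hl).2.1
    · simp [hl]
  · have hV : Continuous fun n : sphere (0 : E3) 1 => v (r • (n : E3)) :=
      continuous_on_sphere hv.smooth.continuousOn (smul_sphere_mem_closedBall (Ioo_subset_Icc_self hr))
    have h1 : ∫ n : sphere (0 : E3) 1, ⟪v (r • (n : E3)), (n : E3)⟫ ∂sphereMeasure = 0 := by
      rw [← h0 r hr]
      unfold sphereIntegral
      simp only [unit_smul_sphere hr.1]
    refine (tendsto_vectorHarmonic_expansion hV h1 hY hYs).congr fun N => ?_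
    refine lintegral_congr fun n => ?_
    congr 3
    refine Finset.sum_congr rfl fun l hl => ?_
    have hl1 := (Finset.mem_Icc.1 hl).1
    simp only [hl1, if_true, Pi.add_apply, Finset.sum_apply]
    rw [← Finset.sum_add_distrib]
    exact Finset.sum_congr rfl fun i _ => ((hab l i hl1).2.2 r hr n).symm

end

end StellarModes

end

/-! ### The theorem -/

open StellarModes in
theorem mainTheorem3 (S : BarotropicStar) (γ : ℝ → ℝ)
    (hγ : ContinuousOn γ (Set.Ico 0 S.R)) (hγ_pos : ∀ r ∈ Set.Ico 0 S.R, 0 < γ r) :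
    -- Stationary non-radial perturbations, for any equation of state of the perturbed star
    (∀ (q : Perturbation) (ξ : ℝ → E3 → E3), IsStationary S q ξ → IsNonRadial S q →
      (∃ c : E3, IsTranslation S c q) ∧
      (IsCentred q → ScalarsVanish S q) ∧
      ∀ x ∈ Metric.ball (0 : E3) S.R, divergence (fun z => S.ρ z • q.dv z) x = 0) ∧
    -- r-modes always exist: every regular axial field is one
    (∀ l : ℕ, 1 ≤ l →
      (∃ v, IsRMode S γ l v ∧ ∃ x ∈ Metric.ball (0 : E3) S.R, v x ≠ 0) ∧
      ∀ v, ContDiffOn ℝ 1 v (Metric.closedBall 0 S.R) → IsAxial S.R l v → IsRMode S γ l v) ∧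
    -- g-modes exist if and only if the star is isentropic
    (∀ l : ℕ, 1 ≤ l →
      ((∃ v, IsGMode S γ l v ∧ RadialNonvanishing S.R v) ↔ S.IsIsentropic γ) ∧
      ((∀ v ξ, IsPolar S.R l v → IsStationary S (current v) ξ → IsGMode S γ l v)
        ↔ S.IsIsentropic γ)) ∧
    -- the zero-frequency subspace of an isentropic star is spanned by the r- and g-modes
    (S.IsIsentropic γ →
      (∀ v ∈ Submodule.span ℝ {v : E3 → E3 | ∃ l, IsRMode S γ l v ∨ IsGMode S γ l v},
        IsZeroFrequency S γ (current v) ∧ IsNonRadial S (current v)) ∧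
      ∀ q : Perturbation, IsZeroFrequency S γ q → IsNonRadial S q →
        (∃ c : E3, IsTranslation S c q) ∧
        (IsCentred q → ScalarsVanish S q) ∧
        ∃ a b : ℕ → E3 → E3,
          (∀ l, a l ∈ Submodule.span ℝ {v : E3 → E3 | IsRMode S γ l v}) ∧
          (∀ l, b l ∈ Submodule.span ℝ {v : E3 → E3 | IsGMode S γ l v}) ∧
          IsSumOnSpheres S.R (fun l => a l + b l) q.dv) := by
  have part1 : ∀ (q : Perturbation) (ξ : ℝ → E3 → E3), IsStationary S q ξ → IsNonRadial S q →
      (∃ c : E3, IsTranslation S c q) ∧ (IsCentred q → ScalarsVanish S q) := fun q ξ h hn => by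
    obtain ⟨c, hc⟩ := h.exists_translation hn
    exact ⟨⟨c, hc⟩, hc.scalarsVanish⟩
  refine ⟨fun q ξ h hn => ⟨(part1 q ξ h hn).1, (part1 q ξ h hn).2, h.mass⟩,
    fun l hl => ⟨exists_rMode hl, fun v hs hv => hv.isRMode hl hs⟩, fun l hl => ?_, fun hS => ⟨fun v hv => ?_, ?_⟩⟩
  -- One polar current with nonvanishing radial part serves both equivalences: in an isentropic star
  -- it is the required g-mode, and if all stationary polar currents are g-modes then it is one,
  -- which forces isentropy.
  · have isentropic : ∀ v, IsGMode S γ l v → RadialNonvanishing S.R v → S.IsIsentropic γ := fun v hv hr =>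
      isIsentropic_of_adiabatic hγ hγ_pos hr (isZeroFrequency_current_iff.1 hv.2.2).2
    obtain ⟨v, hp, hc, hr⟩ := S.exists_polar_current hl
    exact ⟨⟨fun ⟨u, hu, hur⟩ => isentropic u hu hur,
        fun hS => ⟨v, ⟨hl, hp, hc.isZeroFrequency hS hγ_pos⟩, hr⟩⟩,
      ⟨fun h => isentropic v (h v _ hp hc.isStationary) hr,
        fun hS u ξ hu h => ⟨hl, hu, h.isCurrent.isZeroFrequency hS hγ_pos⟩⟩⟩
  · obtain ⟨hc, h0⟩ := span_modes hv
    exact ⟨hc.isZeroFrequency hS hγ_pos, isNonRadial_current h0⟩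
  · rintro q ⟨ξ, h, -⟩ hn
    exact ⟨(part1 q ξ h hn).1, (part1 q ξ h hn).2, h.isCurrent.exists_expansion hS hγ_pos hn.dv_mean⟩
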